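/- Let $n\ge 2$, all indices $i$ being taken modulo $n$, and let $X_n$ be the $n$-faceted banana: two vertices $a,b$, edges $e_1,\dots,e_n$ from $a$ to $b$, bi-gons $f_1,\dots,f_n$ with $\partial_0 f_i=e_i-e_{i+1}$, and one 3-cell $h$ with $\partial_0h=f_1+\cdots+f_n$. Let $A=\bigoplus_k A_k$ be the free graded Lie algebra over $\mathbb Q$, completed with respect to the number of brackets, on generators $a,b$ (degree $-1$), $e_i$ (degree $0$), $f_i$ (degree $1$), $h$ (degree $2$). Write $E_i=\mathrm{ad}_{e_i}$, let $\mathrm{BCH}$ be the (iterated) Baker–Campbell–Hausdorff series ($e^xe^y=e^{\mathrm{BCH}(x,y)}$), and for a differential $\partial$ (derivation of degree $-1$) and $e\in A_0$ put $u_e(a)=e^{-\mathrm{ad}_e}a+\frac{1-e^{-\mathrm{ad}_e}}{\mathrm{ad}_e}\partial e$. A universal average of $n$ variables is an element $\mu$ of the completed free Lie algebra on $t_1,\dots,t_n$ (in degree $0$) which is totally symmetric and such that, in every completed free DGLA with finitely many generators (with a differential that does not decrease the number of brackets), if $p,q$ of degree $-1$ satisfy the Maurer–Cartan equation and $y_1,\dots,y_n$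 of degree $0$ satisfy $u_{y_i}(p)=q$ for all $i$, then $u_{\mu(y_1,\dots,y_n)}(p)=q$; it is odd if $\mu(-t_1,\dots,-t_n)=-\mu(t_1,\dots,t_n)$. Odd universal averages exist: the solution $y$ of $\sum_i\mathrm{BCH}(-y,t_i)=0$ is one. Let $\mu_n$ be any universal average of $n$ variables, $\mu_2(x,y)=\mathrm{BCH}(x,\tfrac12\mathrm{BCH}(-x,y))$, and $$v_i=\mu_2(e_i,e_{i+1}),\quad v=\mu_n(e_1,\dots,e_n),\quad x_i=u_{\frac12v_i}(a),\quad x=u_{\frac12v}(a).$$ Let $P_1,\dots,P_n$ be formal power series over $\mathbb Q$ in $n-1$ non-commuting variables, with constant term $1$, satisfying $$\sum_{i=1}^{n-1}P_i(\mathrm{ad}_{t_1},\dots,\mathrm{ad}_{t_{n-1}})t_i=P_n(\mathrm{ad}_{t_1},\dots,\mathrm{ad}_{t_{n-1}})\,\mathrm{BCH}(t_1,\dots,t_{n-1})\tag{6}$$ in the completed free Lie algebra on $t_1,\dots,t_{n-1}$, and, for all $i$ modulo $n$, $$P_{i+1}(t_1,\dots,t_{n-1})=P_i(t_2,\dots,t_{n-1},-\mathrm{BCH}(t_1,\dots,t_{n-1})),\tag{8}$$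 $$P_{n-i}(t_1,\dots,t_{n-1})=P_i(-t_{n-1},\dots,-t_1).\tag{9}$$ Then there is a unique derivation $\partial$ of $A$ of degree $-1$ (not decreasing the number of brackets) with $$\partial a=-\tfrac12[a,a],\qquad \partial b=-\tfrac12[b,b],\tag{1}$$ $$\partial e_i=\frac{E_i}{1-e^{E_i}}a+\frac{E_i}{1-e^{-E_i}}b,\tag{2}$$ $$\partial f_i=\mathrm{BCH}(-\tfrac12v_i,e_i,-e_{i+1},\tfrac12v_i)-[x_i,f_i],\tag{3}$$ $$\partial h+[x,h]=e^{-\frac12\mathrm{ad}_v}\Big(\sum_{i=1}^nP_i\big(\mathrm{BCH}(E_1,-E_2),\dots,\mathrm{BCH}(E_{n-1},-E_n)\big)\,e^{\frac12\mathrm{ad}_{v_i}}f_i\Big).\tag{7}$$ With this $\partial$, $A$ is a DGLA model of $X_n$: $\partial^2=0$, the vertices satisfy the Maurer–Cartan equation, the part of $\partial c$ without brackets is $\partial_0c$ for every cell $c$, and $\partial c$ lies in the completed Lie subalgebra generated by the cells of the closure of $c$. It is obtained by twisting the model localised at $a$: for $f_i'=e^{\frac12\mathrm{ad}_{v_i}}f_i$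 and $h'=e^{\frac12\mathrm{ad}_v}h$ one has $$\partial f_i'+[a,f_i']=\mathrm{BCH}(e_i,-e_{i+1}),\qquad \partial h'+[a,h']=\sum_{i=1}^nP_i\big(\mathrm{BCH}(E_1,-E_2),\dots,\mathrm{BCH}(E_{n-1},-E_n)\big)f_i'.$$ The model is invariant under the symmetries fixing the vertices, that is, $\partial$ commutes with the automorphisms of $A$ given by $$\tau:\ e_i\mapsto e_{i+1},\ f_i\mapsto f_{i+1},\ a,b,h\text{ fixed};\qquad \sigma:\ a,b\text{ fixed},\ e_i\mapsto e_{n-i},\ f_i\mapsto -f_{n-i-1},\ h\mapsto -h.$$ If moreover $\mu_n$ is odd and, for all $i$, as operators on $A$, $$e^{\frac12\mathrm{ad}_v}P_i\big(\mathrm{BCH}(-E_1,E_2),\dots,\mathrm{BCH}(-E_{n-1},E_n)\big)e^{-\frac12\mathrm{ad}_{v_i}}=e^{-\frac12\mathrm{ad}_v}P_i\big(\mathrm{BCH}(E_1,-E_2),\dots,\mathrm{BCH}(E_{n-1},-E_n)\big)e^{\frac12\mathrm{ad}_{v_i}},\tag{10}$$ then the model is also invariant under $$\iota:\ a\leftrightarrow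 b,\ e_i\mapsto-e_i,\ f_i\mapsto-f_i,\ h\mapsto-h,$$ hence under all geometric symmetries of the cell. -/

import Mathlib

open Finset

noncomputable section

/-- Formal power series over `ℚ` in the non-commuting variables `X`: a series is the family of
its coefficients, indexed by words (lists of letters). Addition and multiplication by scalars are
coefficientwise; the product of series is `NC.mul` below (never the pointwise product). -/
abbrev NC (X : Type) : Type := List X → ℚ

namespace NC

variable {X Y ι : Type}

/-! ### The associative algebra of non-commutative series -/

/-- The series `1`. -/
def one : NC X
  | [] => 1
  | _ :: _ => 0

open Classical in
/-- The variable `x`, as a series. -/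
def var (x : X) : NC X := fun w => if w = [x] then 1 else 0

/-- The (concatenation, Cauchy) product. -/
def mul (f g : NC X) : NC X := fun w =>
  ∑ k ∈ range (w.length + 1), f (w.take k) * g (w.drop k)

/-- Powers. -/
def pow (f : NC X) : ℕ → NC X
  | 0 => one
  | k + 1 => mul f (pow f k)

/-- The exponential `∑ fᵏ / k!` of a series without constant term (the powers `fᵏ` with
`k > |w|` do not contribute to the coefficient of `w`). -/
def exp (f : NC X) : NC X := fun w =>
  ∑ k ∈ range (w.length + 1), pow f k w / (k.factorial : ℚ)

/-- The logarithm `∑ (-1)ᵏ⁺¹ (f - 1)ᵏ / k` of a series with constant term `1`. -/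
def log (f : NC X) : NC X := fun w =>
  ∑ k ∈ Icc 1 w.length, (-1 : ℚ) ^ (k + 1) / (k : ℚ) * pow (f - one) k w

/-- `BCH(f, g)`, the series with `exp f · exp g = exp BCH(f, g)`. -/
def bch (f g : NC X) : NC X := log (mul (exp f) (exp g))

/-- The iterated `BCH(f₁, …, fₘ)`. -/
def bchList : List (NC X) → NC X
  | [] => 0
  | f :: l => bch f (bchList l)

/-- The product `y_{i₁} ⋯ y_{iₖ}` attached to a word `i₁ ⋯ iₖ`. -/
def prodWord (y : ι → NC X) : List ι → NC X
  | [] => one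
  | i :: w => mul (y i) (prodWord y w)

/-- Substitution `P(y)` of series `yᵢ` without constant term in a series `P` in finitely many
variables; every coefficient of the result is a finite sum. -/
def subst (P : NC ι) (y : ι → NC X) : NC X := fun u =>
  ∑ᶠ w : List ι, P w * prodWord y w u

/-- The part of `f` supported on the words of length `m`. On Lie series this is the part with
exactly `m - 1` brackets. -/
def lengthPart (m : ℕ) : NC X →ₗ[ℚ] NC X where
  toFun f := fun w => if w.length = m then f w else 0
  map_add' f g := by
    funext w
    show (if w.length = m then f w + g w else 0)
      = (if w.length = m then f w else 0) + (if w.length = m then g w else 0)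
    split_ifs <;> simp
  map_smul' c f := by
    funext w
    show (if w.length = m then c * f w else 0) = c * (if w.length = m then f w else 0)
    split_ifs <;> simp

/-! ### The graded commutator and Lie series -/

/-- The degree of a word, when each letter `x` has degree `deg x`. -/
def wdeg (deg : X → ℤ) (w : List X) : ℤ := (w.map deg).sum

/-- The graded commutator: bilinear, with `[f, g] = f g - (-1)^{|f| |g|} g f` for homogeneous
`f` and `g`. -/
def bracket (deg : X → ℤ) : NC X →ₗ[ℚ] NC X →ₗ[ℚ] NC X :=
  LinearMap.mk₂ ℚ
    (fun f g => fun w => ∑ k ∈ range (w.length + 1),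
      (f (w.take k) * g (w.drop k)
        - (-1 : ℚ) ^ (wdeg deg (w.take k) * wdeg deg (w.drop k)) *
          (g (w.take k) * f (w.drop k))))
    (fun f f' g => by
      funext w
      rw [Pi.add_apply, ← Finset.sum_add_distrib]
      refine Finset.sum_congr rfl fun k _ => ?_
      simp only [Pi.add_apply]
      ring)
    (fun c f g => by
      funext w
      rw [Pi.smul_apply, smul_eq_mul, Finset.mul_sum]
      refine Finset.sum_congr rfl fun k _ => ?_
      simp only [Pi.smul_apply, smul_eq_mul]
      ring)
    (fun f g g' => by
      funext w
      rw [Pi.add_apply, ← Finset.sum_add_distrib]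
      refine Finset.sum_congr rfl fun k _ => ?_
      simp only [Pi.add_apply]
      ring)
    (fun c f g => by
      funext w
      rw [Pi.smul_apply, smul_eq_mul, Finset.mul_sum]
      refine Finset.sum_congr rfl fun k _ => ?_
      simp only [Pi.smul_apply, smul_eq_mul]
      ring)

/-- Iterated graded commutators of the letters belonging to `S`. -/
inductive IsLieMonomial (deg : X → ℤ) (S : Set X) : NC X → Prop
  | gen (x : X) (hx : x ∈ S) : IsLieMonomial deg S (var x)
  | bracket (f g : NC X) (hf : IsLieMonomial deg S f) (hg : IsLieMonomial deg S g) :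
      IsLieMonomial deg S (NC.bracket deg f g)

/-- The degree-`k` part of the (completed) graded Lie algebra over `ℚ` generated by the letters
belonging to `S`: the series which are homogeneous of degree `k` and all of whose length
components are linear combinations of iterated graded commutators of letters of `S`. -/
def lieSeriesOn (deg : X → ℤ) (S : Set X) (k : ℤ) : Submodule ℚ (NC X) where
  carrier := {z | (∀ w, z w ≠ 0 → wdeg deg w = k) ∧
    ∀ m, lengthPart m z ∈ Submodule.span ℚ {f | IsLieMonomial deg S f}}
  add_mem' := by
    rintro f g ⟨hf, hf'⟩ ⟨hg, hg'⟩
    refine ⟨fun w hw => ?_, fun m => ?_⟩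
    · by_cases h : f w = 0
      · exact hg w fun h' => hw (by rw [Pi.add_apply, h, h', add_zero])
      · exact hf w h
    · rw [map_add]
      exact Submodule.add_mem _ (hf' m) (hg' m)
  zero_mem' := ⟨fun w hw => absurd rfl hw, fun m => by
    rw [map_zero]
    exact Submodule.zero_mem _⟩
  smul_mem' := by
    rintro c f ⟨hf, hf'⟩
    refine ⟨fun w hw => hf w fun h => hw (by rw [Pi.smul_apply, smul_eq_mul, h, mul_zero]), fun m => ?_⟩
    rw [map_smul]
    exact Submodule.smul_mem _ c (hf' m)

/-- The degree-`k` part `A_k` of the completed free graded Lie algebra over `ℚ` on the letters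
`X` of degrees `deg`, realised as usual (in characteristic zero) by the graded commutators inside
the completed free associative algebra; "completed" means that infinite sums of terms with an
increasing number of brackets are allowed. -/
def lieSeries (deg : X → ℤ) (k : ℤ) : Submodule ℚ (NC X) := lieSeriesOn deg Set.univ k

/-! ### Power series in adjoint operators -/

/-- `∑ₖ cₖ (ad_e)ᵏ z`, for `e` without constant term (the terms with `k > |w|` do not contribute
to the coefficient of `w`). -/
def adSeries (deg : X → ℤ) (c : ℕ → ℚ) (e z : NC X) : NC X := fun w =>
  ∑ k ∈ range (w.length + 1), c k * ((bracket deg e)^[k] z) w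

/-- `e^{ad_e} z`. -/
def expAd (deg : X → ℤ) (e z : NC X) : NC X :=
  adSeries deg (fun k => 1 / (k.factorial : ℚ)) e z

/-- `ad_{y_{i₁}} ⋯ ad_{y_{iₖ}} z` for a word `i₁ ⋯ iₖ`. -/
def adWord (deg : X → ℤ) (y : ι → NC X) (z : NC X) : List ι → NC X
  | [] => z
  | i :: w => bracket deg (y i) (adWord deg y z w)

/-- `P(ad_{y₁}, ad_{y₂}, …) · z` for a series `P` in finitely many non-commuting variables and
series `yᵢ` without constant term; every coefficient of the result is a finite sum. -/
def act (deg : X → ℤ) (P : NC ι) (y : ι → NC X) (z : NC X) : NC X := fun u =>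
  ∑ᶠ w : List ι, P w * adWord deg y z w u

/-- The result `u_e(a) = e^{-ad_e} a + ((1 - e^{-ad_e}) / ad_e) ∂e` of flowing from `a` by `e`
for unit time, for a differential `∂ = D`. -/
def flow (deg : X → ℤ) (D : NC X →ₗ[ℚ] NC X) (e a : NC X) : NC X :=
  adSeries deg (fun k => (-1 : ℚ) ^ k / (k.factorial : ℚ)) e a
    + adSeries deg (fun k => (-1 : ℚ) ^ k / ((k + 1).factorial : ℚ)) e (D e)

end NC

/-! ### Differential graded Lie algebras -/

/-- The subspaces `𝒜 p` of `V`, with the bracket `br`, form a graded Lie algebra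
`A = ⨁ 𝒜 p`. -/
structure IsGradedLieAlgebra {V : Type} [AddCommGroup V] [Module ℚ V]
    (𝒜 : ℤ → Submodule ℚ V) (br : V →ₗ[ℚ] V →ₗ[ℚ] V) : Prop where
  independent : iSupIndep 𝒜
  bracket_mem : ∀ p q : ℤ, ∀ x ∈ 𝒜 p, ∀ y ∈ 𝒜 q, br x y ∈ 𝒜 (p + q)
  symmetry : ∀ p q : ℤ, ∀ x ∈ 𝒜 p, ∀ y ∈ 𝒜 q, br y x = -((-1 : ℚ) ^ (p * q) • br x y)
  jacobi : ∀ p q r : ℤ, ∀ x ∈ 𝒜 p, ∀ y ∈ 𝒜 q, ∀ z ∈ 𝒜 r,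
    (-1 : ℚ) ^ (p * q) • br (br y z) x + (-1 : ℚ) ^ (q * r) • br (br z x) y
      + (-1 : ℚ) ^ (r * p) • br (br x y) z = 0

/-- `D` restricts to a derivation of degree `-1` of `A = ⨁ 𝒜 p`. (A linear map on `A` is
represented by a linear map on the ambient space `V`, of which only the values on `A` matter.) -/
structure IsGradedDerivation {V : Type} [AddCommGroup V] [Module ℚ V]
    (𝒜 : ℤ → Submodule ℚ V) (br : V →ₗ[ℚ] V →ₗ[ℚ] V) (D : V →ₗ[ℚ] V) : Prop where
  mem : ∀ p : ℤ, ∀ x ∈ 𝒜 p, D x ∈ 𝒜 (p - 1)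
  leibniz : ∀ p q : ℤ, ∀ x ∈ 𝒜 p, ∀ y ∈ 𝒜 q,
    D (br x y) = br (D x) y + (-1 : ℚ) ^ p • br x (D y)

/-- The subspaces `𝒜 p`, with the bracket `br` and the differential `D`, form a DGLA. -/
structure IsDGLA {V : Type} [AddCommGroup V] [Module ℚ V]
    (𝒜 : ℤ → Submodule ℚ V) (br : V →ₗ[ℚ] V →ₗ[ℚ] V) (D : V →ₗ[ℚ] V) : Prop where
  lie : IsGradedLieAlgebra 𝒜 br
  derivation : IsGradedDerivation 𝒜 br D
  square_zero : ∀ p : ℤ, ∀ x ∈ 𝒜 p, D (D x) = 0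

open NC

/-- `D` does not decrease the number of brackets on the completed free graded Lie algebra, so
that it may be applied termwise to infinite sums. -/
def PreservesBracketFiltration {X : Type} (deg : X → ℤ) (D : NC X →ₗ[ℚ] NC X) : Prop :=
  ∀ k : ℤ, ∀ z ∈ lieSeries deg k, ∀ m : ℕ,
    (∀ w, w.length < m → z w = 0) → ∀ w, w.length < m → D z w = 0

/-! ### Models of cell complexes -/

/-- The combinatorial data of a regular cell complex with set of cells `X`: dimensions of cells,
the cells contained in the closure of a given cell, and geometric boundaries `∂₀`. -/
structure CellData (X : Type) where
  dim : X → ℕ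
  closure : X → Set X
  boundary : X → X →₀ ℤ

/-- The degree of the generator attached to a cell. -/
def CellData.deg {X : Type} (K : CellData X) (c : X) : ℤ := (K.dim c : ℤ) - 1

/-- The completed free graded Lie algebra on the cells of `K`, with the differential `D`, is a
DGLA model of `K`. -/
structure IsModel {X : Type} (K : CellData X) (D : NC X →ₗ[ℚ] NC X) : Prop where
  dgla : IsDGLA (lieSeries K.deg) (bracket K.deg) D
  filtration : PreservesBracketFiltration K.deg D
  /-- Vertices satisfy the Maurer-Cartan equation. -/
  vertex : ∀ c, K.dim c = 0 → D (var c) + (1 / 2 : ℚ) • bracket K.deg (var c) (var c) = 0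
  /-- The part of `∂c` without brackets is the geometric boundary of `c`. -/
  initial : ∀ c y, D (var c) [y] = (K.boundary c y : ℚ)
  /-- `∂c` lies in the Lie algebra generated by the cells of the closure of `c`. -/
  locality : ∀ c, D (var c) ∈ lieSeriesOn K.deg (K.closure c) (K.deg c - 1)

/-! ### Universal averages -/

/-- `μ` is a universal average of the variables `xᵢ`: a totally symmetric element of the
completed free Lie algebra on the `xᵢ` such that, in every completed free DGLA, if each of the
elements `xᵢ` of degree `0` flows from the point `a` to the point `b`, then so does `μ(x)`. -/
structure IsUniversalAverage {ι : Type} (μ : NC ι) : Prop where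
  lie : μ ∈ lieSeries (fun _ => 0) 0
  symm : ∀ π : Equiv.Perm ι, subst μ (fun i => var (π i)) = μ
  flow : ∀ (Y : Type) [Finite Y] (deg : Y → ℤ) (D : NC Y →ₗ[ℚ] NC Y),
    IsDGLA (lieSeries deg) (bracket deg) D → PreservesBracketFiltration deg D →
    ∀ a ∈ lieSeries deg (-1), ∀ b ∈ lieSeries deg (-1), ∀ x : ι → NC Y,
      (∀ i, x i ∈ lieSeries deg 0) →
      D a + (1 / 2 : ℚ) • bracket deg a a = 0 → D b + (1 / 2 : ℚ) • bracket deg b b = 0 →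
      (∀ i, NC.flow deg D (x i) a = b) → NC.flow deg D (subst μ x) a = b

/-- `μ(-x₁, …, -xₙ) = -μ(x₁, …, xₙ)`. -/
def IsOddAverage {ι : Type} (μ : NC ι) : Prop := subst μ (fun i => -var i) = -μ

/-- Successive approximations, starting with `0`, of the solution `y` of
`∑ᵢ BCH(-y, xᵢ) = 0`; the `k`-th one is exact on words of length at most `k`. -/
def barycentreApprox (ι : Type) [Fintype ι] : ℕ → NC ι
  | 0 => 0
  | k + 1 => bch (barycentreApprox ι k)
      ((1 / (Fintype.card ι : ℚ)) • ∑ i : ι, bch (-barycentreApprox ι k) (var i))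

/-- An explicit universal average: the solution `y` of `∑ᵢ BCH(-y, xᵢ) = 0`. -/
def barycentre (ι : Type) [Fintype ι] : NC ι := fun w => barycentreApprox ι w.length w

/-- `μ₂(x, y) = BCH(x, ½ BCH(-x, y))`. -/
def mu2 {X : Type} (x y : NC X) : NC X := bch x ((1 / 2 : ℚ) • bch (-x) y)

/-! ### The banana -/

/-- The cells of the `n`-faceted banana; indices are taken modulo `n`. -/
inductive BananaCell (n : ℕ) : Type
  | a : BananaCell n
  | b : BananaCell n
  | e (i : ZMod n) : BananaCell n
  | f (i : ZMod n) : BananaCell n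
  | h : BananaCell n

namespace Banana

open BananaCell

variable {n : ℕ}

/-- Dimensions of the cells. -/
def dim : BananaCell n → ℕ
  | .a => 0
  | .b => 0
  | .e _ => 1
  | .f _ => 2
  | .h => 3

/-- The cells in the closure of a cell. -/
def closure : BananaCell n → Set (BananaCell n)
  | .a => {a}
  | .b => {b}
  | .e i => {a, b, e i}
  | .f i => {a, b, e i, e (i + 1), f i}
  | .h => Set.univ

/-- Geometric boundaries. -/
def boundary [NeZero n] : BananaCell n → BananaCell n →₀ ℤ
  | .a => 0
  | .b => 0
  | .e _ => Finsupp.single b 1 - Finsupp.single a 1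
  | .f i => Finsupp.single (e i) 1 - Finsupp.single (e (i + 1)) 1
  | .h => ∑ i : ZMod n, Finsupp.single (f i) 1

/-- The `n`-faceted banana `Xₙ`. -/
def cells (n : ℕ) [NeZero n] : CellData (BananaCell n) where
  dim := dim
  closure := closure
  boundary := boundary

variable [NeZero n]

/-- Degrees of the generators of the model. -/
abbrev deg : BananaCell n → ℤ := (cells n).deg

/-- `[x, y]` in the graded Lie algebra generated by the cells of the banana. -/
abbrev br (x y : NC (BananaCell n)) : NC (BananaCell n) := bracket deg x y

/-- The generator of the cell `c`. -/
abbrev gen (c : BananaCell n) : NC (BananaCell n) := var c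

/-- `vᵢ = μ₂(eᵢ, eᵢ₊₁)`. -/
def vFace (i : ZMod n) : NC (BananaCell n) := mu2 (gen (e i)) (gen (e (i + 1)))

/-- `v = μ(e₁, …, eₙ)`. -/
def vMain (μ : NC (ZMod n)) : NC (BananaCell n) := subst μ (fun i => gen (e i))

/-- The centre `xᵢ = u_{vᵢ/2}(a)` of the `i`-th face. -/
def xFace (D : NC (BananaCell n) →ₗ[ℚ] NC (BananaCell n)) (i : ZMod n) : NC (BananaCell n) :=
  flow deg D ((1 / 2 : ℚ) • vFace i) (gen a)

/-- The centre `x = u_{v/2}(a)` of the 3-cell. -/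
def xMain (D : NC (BananaCell n) →ₗ[ℚ] NC (BananaCell n)) (μ : NC (ZMod n)) :
    NC (BananaCell n) :=
  flow deg D ((1 / 2 : ℚ) • vMain μ) (gen a)

/-- The elements `BCH(e₁, -e₂), …, BCH(eₙ₋₁, -eₙ)` (the variable number `j : Fin (n - 1)` is
`x_{j+1}`). -/
def loops (j : Fin (n - 1)) : NC (BananaCell n) :=
  bch (gen (e ((j + 1 : ℕ) : ZMod n))) (-gen (e ((j + 2 : ℕ) : ZMod n)))

/-- The elements `BCH(-e₁, e₂), …, BCH(-eₙ₋₁, eₙ)`. -/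
def revLoops (j : Fin (n - 1)) : NC (BananaCell n) :=
  bch (-gen (e ((j + 1 : ℕ) : ZMod n))) (gen (e ((j + 2 : ℕ) : ZMod n)))

/-- `Pᵢ(BCH(E₁, -E₂), …, BCH(Eₙ₋₁, -Eₙ)) · z` with `Eⱼ = ad_{eⱼ}`, where
`BCH(ad_x, ad_y) = ad_{BCH(x, y)}`. -/
def actLoops (p : NC (Fin (n - 1))) (z : NC (BananaCell n)) : NC (BananaCell n) :=
  act deg p loops z

/-- `Pᵢ(BCH(-E₁, E₂), …, BCH(-Eₙ₋₁, Eₙ)) · z`. -/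
def actRevLoops (p : NC (Fin (n - 1))) (z : NC (BananaCell n)) : NC (BananaCell n) :=
  act deg p revLoops z

/-- `f'ᵢ = e^{½ ad_{vᵢ}} fᵢ`. -/
def fTwist (i : ZMod n) : NC (BananaCell n) :=
  expAd deg ((1 / 2 : ℚ) • vFace i) (gen (f i))

/-- `h' = e^{½ ad_v} h`. -/
def hTwist (μ : NC (ZMod n)) : NC (BananaCell n) :=
  expAd deg ((1 / 2 : ℚ) • vMain μ) (gen h)

/-- `D` is a differential (degree `-1` derivation) given on the generators by the formulae of the
symmetric model:
* `∂a = -½[a, a]` and `∂b = -½[b, b]`;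
* `∂eᵢ = (Eᵢ / (1 - e^{Eᵢ})) a + (Eᵢ / (1 - e^{-Eᵢ})) b`, where `-t / (1 - e^t) = ∑ Bₖ tᵏ / k!`
  and `t / (1 - e^{-t}) = ∑ B'ₖ tᵏ / k!`, with `B₁ = -½` and `B'₁ = ½`;
* `∂fᵢ = BCH(-½vᵢ, eᵢ, -eᵢ₊₁, ½vᵢ) - [xᵢ, fᵢ]`;
* `∂h + [x, h] = e^{-½ ad_v} (∑ᵢ Pᵢ(BCH(E₁, -E₂), …, BCH(Eₙ₋₁, -Eₙ)) e^{½ ad_{vᵢ}} fᵢ)`. -/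
structure IsSymmetricDifferential (P : ZMod n → NC (Fin (n - 1))) (μ : NC (ZMod n))
    (D : NC (BananaCell n) →ₗ[ℚ] NC (BananaCell n)) : Prop where
  derivation : IsGradedDerivation (lieSeries deg) (bracket deg) D
  filtration : PreservesBracketFiltration deg D
  vertex_a : D (gen a) = -((1 / 2 : ℚ) • br (gen a) (gen a))
  vertex_b : D (gen b) = -((1 / 2 : ℚ) • br (gen b) (gen b))
  edge : ∀ i, D (gen (e i)) =
    adSeries deg (fun k => -(bernoulli k / (k.factorial : ℚ))) (gen (e i)) (gen a)
      + adSeries deg (fun k => bernoulli' k / (k.factorial : ℚ)) (gen (e i)) (gen b)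
  face : ∀ i, D (gen (f i)) =
    bchList [-((1 / 2 : ℚ) • vFace i), gen (e i), -gen (e (i + 1)), (1 / 2 : ℚ) • vFace i]
      - br (xFace D i) (gen (f i))
  solid : D (gen h) + br (xMain D μ) (gen h) =
    expAd deg (-((1 / 2 : ℚ) • vMain μ))
      (∑ i : ZMod n, actLoops (P i) (expAd deg ((1 / 2 : ℚ) • vFace i) (gen (f i))))

/-! ### Conditions on `P₁, …, Pₙ` -/

/-- `∑_{i=1}^{n-1} Pᵢ(ad_{x₁}, …, ad_{xₙ₋₁}) xᵢ = Pₙ(ad_{x₁}, …, ad_{xₙ₋₁}) BCH(x₁, …, xₙ₋₁)`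
in the completed free Lie algebra on `x₁, …, xₙ₋₁` (and `Pₙ = P₀`). -/
def BoundaryCondition (P : ZMod n → NC (Fin (n - 1))) : Prop :=
  ∑ j : Fin (n - 1), act (fun _ => 0) (P ((j + 1 : ℕ) : ZMod n)) var (var j)
    = act (fun _ => 0) (P 0) var (bchList (List.ofFn fun j : Fin (n - 1) => var j))

/-- The variables `(x₂, …, xₙ₋₁, -BCH(x₁, …, xₙ₋₁))`. -/
def cyclicShift (n : ℕ) (j : Fin (n - 1)) : NC (Fin (n - 1)) :=
  if hj : (j : ℕ) + 1 < n - 1 then var ⟨(j : ℕ) + 1, hj⟩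
  else -bchList (List.ofFn fun j : Fin (n - 1) => var j)

/-- `Pᵢ₊₁(x₁, …, xₙ₋₁) = Pᵢ(x₂, …, xₙ₋₁, -BCH(x₁, …, xₙ₋₁))`, indices modulo `n`. -/
def CyclicCondition (P : ZMod n → NC (Fin (n - 1))) : Prop :=
  ∀ i, P (i + 1) = subst (P i) (cyclicShift n)

/-- `Pₙ₋ᵢ(x₁, …, xₙ₋₁) = Pᵢ(-xₙ₋₁, …, -x₁)`, indices modulo `n`. -/
def ReversalCondition (P : ZMod n → NC (Fin (n - 1))) : Prop :=
  ∀ i, P (-i) = subst (P i) (fun j => -var (Fin.rev j))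

/-- `e^{½ ad_v} Pᵢ(BCH(-E₁, E₂), …) e^{-½ ad_{vᵢ}} = e^{-½ ad_v} Pᵢ(BCH(E₁, -E₂), …) e^{½ ad_{vᵢ}}`
as operators on the graded Lie algebra generated by the cells. -/
def SwapCondition (P : ZMod n → NC (Fin (n - 1))) (μ : NC (ZMod n)) : Prop :=
  ∀ i : ZMod n, ∀ k : ℤ, ∀ z ∈ lieSeries (deg (n := n)) k,
    expAd deg ((1 / 2 : ℚ) • vMain μ)
        (actRevLoops (P i) (expAd deg (-((1 / 2 : ℚ) • vFace i)) z))
      = expAd deg (-((1 / 2 : ℚ) • vMain μ))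
        (actLoops (P i) (expAd deg ((1 / 2 : ℚ) • vFace i) z))

/-! ### Symmetries -/

/-- The rotation, on generators. -/
def tau : BananaCell n → NC (BananaCell n)
  | .a => gen a
  | .b => gen b
  | .e i => gen (e (i + 1))
  | .f i => gen (f (i + 1))
  | .h => gen h

/-- The reflection in a plane through the axis `ab`, on generators: `eᵢ ↦ eₙ₋ᵢ`,
`fᵢ ↦ -fₙ₋ᵢ₋₁`. -/
def sigma : BananaCell n → NC (BananaCell n)
  | .a => gen a
  | .b => gen b
  | .e i => gen (e (-i))
  | .f i => -gen (f (-i - 1))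
  | .h => -gen h

/-- The reflection exchanging `a` and `b`, on generators. -/
def iota : BananaCell n → NC (BananaCell n)
  | .a => gen b
  | .b => gen a
  | .e i => -gen (e i)
  | .f i => -gen (f i)
  | .h => -gen h

/-- `D` commutes, on the graded Lie algebra generated by the cells, with the automorphism given
on generators by `s`. -/
def InvariantUnder (D : NC (BananaCell n) →ₗ[ℚ] NC (BananaCell n))
    (s : BananaCell n → NC (BananaCell n)) : Prop :=
  ∀ k : ℤ, ∀ z ∈ lieSeries (deg (n := n)) k, D (subst z s) = subst (D z) s

end Banana

end

open NC Banana

noncomputable section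

/-! Everything is moved from the Lie algebra to the completed free associative algebra `Ser X`,
where exponentials exist. A derivation of Lie series of degree `-1` is determined by its values on
letters and extends to an odd derivation `δ` of `Ser X` (`eq_derivExt`). By the formula for the
derivative of an exponential (`IsDer.map_exp`), `u_e(a) = b` is equivalent to `δ(exp e) = exp e * b
- a * exp e` (`flow_eq_iff`). Hence BCH products correspond to composition of flows, and the edge
formula says exactly that every `eᵢ` flows from `a` to `b`.

Put `∂ₐ = δ + [a, ·]`. The loop `BCH(eᵢ, -eᵢ₊₁)` flows from `a` to itself, which means that `∂ₐ`
kills it. Conjugation by `exp w` intertwines the differentials twisted at `u_w(a)` and at `a`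
(`twist_conj`), so the formulae for faces and solid become `∂ₐ f'ᵢ = loop i` and `∂ₐ h' = ∑ Pᵢ f'ᵢ`.
Since `a` is a Maurer-Cartan element, `∂ₐ² = δ²`; this is an even derivation, so it need only vanish
on generators. On edges one differentiates the exponential form of the flow; on `f'ᵢ` the loop is
closed; on `h'` one obtains `∑ Pᵢ(loops) loop i`, which is zero because the boundary condition on
the `Pᵢ` is evaluated at `n - 1` consecutive loops whose BCH product telescopes to minus the
remaining one.

For existence and uniqueness the point is that the centres `xᵢ` and `x` depend only on the values of
`δ` on edges, so that the formulae are not circular.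

For a symmetry `T`, the commutator of `δ` and `T` is a twisted derivation and again need only vanish
on generators. On edges it vanishes because `T` respects flows. If `T` fixes `a`, faces and solid
may be replaced by `f'ᵢ` and `h'`; the cyclic and reversal conditions then match the permuted sums.
The exchange of `a` and `b` moves the base point but fixes the centres, because an odd average that
flows from `a` to `b` has the same midpoint from either end; the last operator condition then
compares the two boundaries of the solid.

The barycentre is the unique fixed point of a contraction; uniqueness gives symmetry and oddness. It
respects flows because the elements `BCH(-y, xᵢ)` sum to zero and share start and end points, and
differentiating their sum makes the two points agree to every order. -/

/-- Formal power series in non-commuting variables, with the ring structure given by the Cauchy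
product. -/
def Ser (X : Type) : Type := List X → ℚ

/-! ### The ring of non-commutative series, its filtration by word length, infinite sums. -/

namespace Ser

variable {X Y Z ι : Type}

/-- Only the linear structure is taken over from functions. `Ser` is not reducible, so the pointwise
product of functions does not compete with the Cauchy product. -/
instance : AddCommGroup (Ser X) := inferInstanceAs (AddCommGroup (List X → ℚ))
instance : Module ℚ (Ser X) := inferInstanceAs (Module ℚ (List X → ℚ))

/-- The coefficient of a word. -/
def coeff (w : List X) : Ser X →ₗ[ℚ] ℚ where
  toFun f := f w
  map_add' _ _ := rfl
  map_smul' _ _ := rfl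

/-- The series with given coefficients. -/
def ofFun (f : List X → ℚ) : Ser X := f

@[simp] theorem coeff_ofFun (f : List X → ℚ) (w : List X) : coeff w (ofFun f) = f w := rfl

@[ext] theorem ext {f g : Ser X} (h : ∀ w, coeff w f = coeff w g) : f = g := funext h

/-- The series of the coefficients of the words that begin with `x`. -/
def tail (x : X) : Ser X →ₗ[ℚ] Ser X where
  toFun f := ofFun fun w => coeff (x :: w) f
  map_add' _ _ := rfl
  map_smul' _ _ := rfl

@[simp] theorem coeff_tail (x : X) (f : Ser X) (w : List X) :
    coeff w (tail x f) = coeff (x :: w) f := rfl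

instance : Mul (Ser X) := ⟨NC.mul⟩
instance : One (Ser X) := ⟨NC.one⟩

@[simp] theorem coeff_one_nil : coeff [] (1 : Ser X) = 1 := rfl
@[simp] theorem coeff_one_cons (x : X) (w : List X) : coeff (x :: w) (1 : Ser X) = 0 := rfl

theorem coeff_mul (f g : Ser X) (w : List X) : coeff w (f * g)
    = ∑ k ∈ range (w.length + 1), coeff (w.take k) f * coeff (w.drop k) g := rfl

@[simp] theorem coeff_mul_nil (f g : Ser X) : coeff [] (f * g) = coeff [] f * coeff [] g := by
  simp [coeff_mul]

/-- A cut of `x :: w` is either before the first letter or a cut of `w`. This turns statements on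
products into inductions on words. -/
theorem coeff_mul_cons (f g : Ser X) (x : X) (w : List X) :
    coeff (x :: w) (f * g) = coeff [] f * coeff (x :: w) g + coeff w (tail x f * g) := by
  rw [coeff_mul, List.length_cons, Finset.sum_range_succ', add_comm]
  rfl

theorem tail_mul (x : X) (f g : Ser X) :
    tail x (f * g) = coeff [] f • tail x g + tail x f * g := by
  ext w; simp [coeff_mul_cons]

@[simp] theorem tail_one (x : X) : tail x (1 : Ser X) = 0 := rfl

theorem ext_tail {f g : Ser X} (h : coeff [] f = coeff [] g) (h' : ∀ x, tail x f = tail x g) :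
    f = g := by
  ext w
  cases w with
  | nil => exact h
  | cons x w => exact congrArg (coeff w) (h' x)

protected theorem smul_mul (c : ℚ) (f g : Ser X) : (c • f) * g = c • (f * g) := by
  ext w; simp only [coeff_mul, map_smul, smul_eq_mul, Finset.mul_sum, mul_assoc]

protected theorem mul_smul (c : ℚ) (f g : Ser X) : f * (c • g) = c • (f * g) := by
  ext w; simp only [coeff_mul, map_smul, smul_eq_mul, Finset.mul_sum]
  exact Finset.sum_congr rfl fun _ _ => by ring

protected theorem add_mul (f g h : Ser X) : (f + g) * h = f * h + g * h := by
  ext w; simp only [coeff_mul, map_add, ← Finset.sum_add_distrib, _root_.add_mul]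

protected theorem mul_add (f g h : Ser X) : f * (g + h) = f * g + f * h := by
  ext w; simp only [coeff_mul, map_add, ← Finset.sum_add_distrib, _root_.mul_add]

protected theorem zero_mul (f : Ser X) : 0 * f = 0 := by
  ext w; simp [coeff_mul]

protected theorem mul_zero (f : Ser X) : f * 0 = 0 := by
  ext w; simp [coeff_mul]

protected theorem mul_assoc (f g h : Ser X) : f * g * h = f * (g * h) := by
  ext w
  induction w generalizing f g h with
  | nil => simp [_root_.mul_assoc]
  | cons x w ih =>
    rw [coeff_mul_cons, coeff_mul_cons, coeff_mul_nil, tail_mul, Ser.add_mul, Ser.smul_mul, map_add,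
      map_smul, ih, coeff_mul_cons, smul_eq_mul]
    ring

protected theorem one_mul (f : Ser X) : 1 * f = f := by
  refine ext_tail (by simp) fun x => ?_
  simp [tail_mul, Ser.zero_mul]

protected theorem mul_one (f : Ser X) : f * 1 = f := by
  ext w
  induction w generalizing f with
  | nil => simp
  | cons x w ih => rw [coeff_mul_cons, ih]; simp

instance : Ring (Ser X) where
  __ := (inferInstance : AddCommGroup (Ser X))
  mul_assoc := Ser.mul_assoc
  one_mul := Ser.one_mul
  mul_one := Ser.mul_one
  left_distrib := Ser.mul_add
  right_distrib := Ser.add_mul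
  zero_mul := Ser.zero_mul
  mul_zero := Ser.mul_zero

instance : Algebra ℚ (Ser X) := Algebra.ofModule Ser.smul_mul Ser.mul_smul

/-! ### The filtration by word length -/

/-- Series without words of length smaller than `m`. -/
def Fil (X : Type) (m : ℕ) : Submodule ℚ (Ser X) where
  carrier := {f | ∀ w : List X, w.length < m → coeff w f = 0}
  add_mem' hf hg w hw := by rw [map_add, hf w hw, hg w hw, add_zero]
  zero_mem' _ _ := rfl
  smul_mem' c f hf w hw := by rw [map_smul, hf w hw, smul_zero]

theorem mem_Fil {m : ℕ} {f : Ser X} : f ∈ Fil X m ↔ ∀ w : List X, w.length < m → coeff w f = 0 :=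
  Iff.rfl

theorem mem_Fil_zero (f : Ser X) : f ∈ Fil X 0 := fun _ h => absurd h (Nat.not_lt_zero _)

theorem mem_Fil_one {f : Ser X} : f ∈ Fil X 1 ↔ coeff [] f = 0 := by
  rw [mem_Fil]
  refine ⟨fun h => h [] (by simp), fun h w hw => ?_⟩
  obtain rfl : w = [] := List.length_eq_zero_iff.mp (by omega)
  exact h

theorem Fil_mono {m k : ℕ} (h : m ≤ k) {f : Ser X} (hf : f ∈ Fil X k) : f ∈ Fil X m :=
  fun w hw => hf w (hw.trans_le h)

theorem mul_mem_Fil {m k : ℕ} {f g : Ser X} (hf : f ∈ Fil X m) (hg : g ∈ Fil X k) :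
    f * g ∈ Fil X (m + k) := by
  intro w hw
  rw [coeff_mul]
  refine Finset.sum_eq_zero fun j hj => ?_
  rw [Finset.mem_range] at hj
  by_cases h : j < m
  · rw [hf _ (by rw [List.length_take]; omega), zero_mul]
  · rw [hg _ (by rw [List.length_drop]; omega), mul_zero]

theorem mul_mem_Fil_right {k : ℕ} (f : Ser X) {g : Ser X} (hg : g ∈ Fil X k) : f * g ∈ Fil X k := by
  simpa using mul_mem_Fil (mem_Fil_zero f) hg

theorem mul_mem_Fil_left {k : ℕ} {f : Ser X} (g : Ser X) (hf : f ∈ Fil X k) : f * g ∈ Fil X k := by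
  simpa using mul_mem_Fil hf (mem_Fil_zero g)

/-- The filtration is separated. Most identities between series below are obtained by showing, by
induction on `m`, that the difference of the two sides lies in `Fil X m`. -/
theorem eq_zero_of_mem_Fil {f : Ser X} (h : ∀ m, f ∈ Fil X m) : f = 0 :=
  ext fun w => h (w.length + 1) w (Nat.lt_succ_self _)

theorem eq_of_sub_mem_Fil {f g : Ser X} (h : ∀ m, f - g ∈ Fil X m) : f = g :=
  sub_eq_zero.mp (eq_zero_of_mem_Fil h)

/-- Linear maps that preserve the filtration by word length. -/
def Pres (T : Ser X →ₗ[ℚ] Ser Y) : Prop := ∀ m, ∀ z ∈ Fil X m, T z ∈ Fil Y m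

/-- Linear maps that raise the filtration by word length. -/
def Raises (T : Ser X →ₗ[ℚ] Ser Y) : Prop := ∀ m, ∀ z ∈ Fil X m, T z ∈ Fil Y (m + 1)

theorem Raises.pres {T : Ser X →ₗ[ℚ] Ser Y} (h : Raises T) : Pres T :=
  fun m z hz => Fil_mono (Nat.le_succ m) (h m z hz)

theorem Pres.id : Pres (LinearMap.id : Ser X →ₗ[ℚ] Ser X) := fun _ _ h => h

theorem Pres.comp {S : Ser Y →ₗ[ℚ] Ser Z} {T : Ser X →ₗ[ℚ] Ser Y} (hS : Pres S) (hT : Pres T) :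
    Pres (S ∘ₗ T) := fun m z hz => hS m _ (hT m z hz)

theorem Pres.mul {S T : Module.End ℚ (Ser X)} (hS : Pres S) (hT : Pres T) : Pres (S * T) :=
  Pres.comp hS hT

theorem Pres.add {S T : Ser X →ₗ[ℚ] Ser Y} (hS : Pres S) (hT : Pres T) : Pres (S + T) :=
  fun m z hz => (Fil Y m).add_mem (hS m z hz) (hT m z hz)

theorem Pres.sub {S T : Ser X →ₗ[ℚ] Ser Y} (hS : Pres S) (hT : Pres T) : Pres (S - T) :=
  fun m z hz => (Fil Y m).sub_mem (hS m z hz) (hT m z hz)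

theorem Raises.sub {S T : Ser X →ₗ[ℚ] Ser Y} (hS : Raises S) (hT : Raises T) : Raises (S - T) :=
  fun m z hz => (Fil Y (m + 1)).sub_mem (hS m z hz) (hT m z hz)

theorem Raises.pow_mem {T : Module.End ℚ (Ser X)} (hT : Raises T) (k : ℕ) {m : ℕ} {z : Ser X}
    (hz : z ∈ Fil X m) : (T ^ k) z ∈ Fil X (m + k) := by
  induction k with
  | zero => simpa using hz
  | succ k ih => rw [pow_succ', Module.End.mul_apply]; exact hT _ _ ih

theorem Raises.pow_mem' {T : Module.End ℚ (Ser X)} (hT : Raises T) (k : ℕ) (z : Ser X) :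
    (T ^ k) z ∈ Fil X k := by
  simpa using hT.pow_mem k (mem_Fil_zero z)

/-- Left multiplication. -/
def L (f : Ser X) : Module.End ℚ (Ser X) := LinearMap.mulLeft ℚ f
/-- Right multiplication. -/
def R (f : Ser X) : Module.End ℚ (Ser X) := LinearMap.mulRight ℚ f

@[simp] theorem L_apply (f z : Ser X) : L f z = f * z := rfl
@[simp] theorem R_apply (f z : Ser X) : R f z = z * f := rfl

theorem pres_L (f : Ser X) : Pres (L f) := fun _ _ hz => mul_mem_Fil_right f hz
theorem pres_R (f : Ser X) : Pres (R f) := fun _ _ hz => mul_mem_Fil_left f hz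

theorem raises_L {f : Ser X} (hf : f ∈ Fil X 1) : Raises (L f) := fun m z hz => by
  rw [add_comm]; exact mul_mem_Fil hf hz
theorem raises_R {f : Ser X} (hf : f ∈ Fil X 1) : Raises (R f) := fun _ _ hz => mul_mem_Fil hz hf

theorem commute_L_R (f g : Ser X) : Commute (L f) (R g) :=
  LinearMap.ext fun z => by simp [Module.End.mul_apply, mul_assoc]

/-! ### Infinite sums -/

/-- The sum of the series `u k`, where `u k` has no words of length smaller than `k`. -/
def ser (u : ℕ → Ser X) : Ser X := ofFun fun w => ∑ k ∈ range (w.length + 1), coeff w (u k)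

theorem coeff_ser (u : ℕ → Ser X) (w : List X) :
    coeff w (ser u) = ∑ k ∈ range (w.length + 1), coeff w (u k) := rfl

theorem coeff_ser_of_lt {u : ℕ → Ser X} (hu : ∀ k, u k ∈ Fil X k) {w : List X} {N : ℕ}
    (hN : w.length < N) : coeff w (ser u) = ∑ k ∈ range N, coeff w (u k) := by
  rw [coeff_ser]
  refine Finset.sum_subset (Finset.range_mono hN) fun k _ hk' => hu k w ?_
  simpa using hk'

theorem ser_sub_mem {u : ℕ → Ser X} (hu : ∀ k, u k ∈ Fil X k) (N : ℕ) :
    ser u - ∑ k ∈ range N, u k ∈ Fil X N := fun w hw => by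
  rw [map_sub, coeff_ser_of_lt hu hw, map_sum, sub_self]

theorem ser_add (u v : ℕ → Ser X) : ser (fun k => u k + v k) = ser u + ser v := by
  ext w; simp [coeff_ser, Finset.sum_add_distrib]

theorem ser_smul (c : ℚ) (u : ℕ → Ser X) : ser (fun k => c • u k) = c • ser u := by
  ext w; simp [coeff_ser, Finset.mul_sum]

theorem ser_sub (u v : ℕ → Ser X) : ser (fun k => u k - v k) = ser u - ser v := by
  ext w; simp [coeff_ser, Finset.sum_sub_distrib]

theorem ser_mem {u : ℕ → Ser X} {m : ℕ} (hu : ∀ k, u k ∈ Fil X m) : ser u ∈ Fil X m := fun w hw => by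
  rw [coeff_ser]; exact Finset.sum_eq_zero fun k _ => hu k w hw

/-- Maps that preserve the filtration are continuous: both sides agree modulo `Fil Y m` with the
image of the same finite partial sum. -/
theorem map_ser {T : Ser X →ₗ[ℚ] Ser Y} (hT : Pres T) {u : ℕ → Ser X} (hu : ∀ k, u k ∈ Fil X k) :
    T (ser u) = ser fun k => T (u k) := by
  refine eq_of_sub_mem_Fil fun m => ?_
  have h1 := hT m _ (ser_sub_mem hu m)
  have h2 := ser_sub_mem (fun k => hT k _ (hu k)) m
  rw [map_sub, map_sum] at h1
  simpa using (Fil Y m).sub_mem h1 h2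

theorem ser_ser {u : ℕ → ℕ → Ser X} (hu : ∀ i j, u i j ∈ Fil X (i + j)) :
    (ser fun i => ser fun j => u i j)
      = ser fun k => ∑ i ∈ range (k + 1), u i (k - i) := by
  ext w
  simp only [coeff_ser, map_sum]
  rw [Finset.sum_range_diag_flip (w.length + 1) fun i j => coeff w (u i j)]
  refine Finset.sum_congr rfl fun i hi => ?_
  symm
  -- For fixed `i` the two inner sums differ by terms with `i + j > w.length`, whose coefficient at
  -- `w` is zero.
  refine Finset.sum_subset (Finset.range_mono (Nat.sub_le _ _)) fun j _ hj' => hu i j w ?_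
  simp only [Finset.mem_range] at hi hj'
  omega

theorem ser_succ {u : ℕ → Ser X} (hu : ∀ k, u k ∈ Fil X k) :
    ser u = u 0 + ser fun k => u (k + 1) := by
  ext w
  rw [map_add, coeff_ser_of_lt hu (N := w.length + 1 + 1) (by omega), Finset.sum_range_succ',
    coeff_ser, add_comm]

end Ser

/-! ### Power series in one operator; exponential, logarithm and BCH. -/

namespace Ser

variable {X Y Z ι : Type}

open PowerSeries (C)

/-! ### Power series in an operator -/

/-- `∑ₖ pₖ Tᵏ` for an operator `T` that raises the filtration. -/
def opS (p : PowerSeries ℚ) (T : Module.End ℚ (Ser X)) : Module.End ℚ (Ser X) where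
  toFun z := ser fun k => PowerSeries.coeff k p • (T ^ k) z
  map_add' z z' := by simp only [map_add, smul_add, ser_add]
  map_smul' c z := by simp only [map_smul, smul_comm _ c, ser_smul, RingHom.id_apply]

theorem opS_apply (p : PowerSeries ℚ) (T : Module.End ℚ (Ser X)) (z : Ser X) :
    opS p T z = ser fun k => PowerSeries.coeff k p • (T ^ k) z := rfl

theorem Raises.term_mem {T : Module.End ℚ (Ser X)} (hT : Raises T) (p : PowerSeries ℚ) (z : Ser X)
    (k : ℕ) : PowerSeries.coeff k p • (T ^ k) z ∈ Fil X k :=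
  (Fil X k).smul_mem _ (hT.pow_mem' k z)

/-- A map that intertwines two operators intertwines all power series in them. Compatibility of
`exp`, `log` and `ad`-series with multiplications and homomorphisms all comes from here. -/
theorem map_opS {g : Ser X →ₗ[ℚ] Ser Y} (hg : Pres g) {T : Module.End ℚ (Ser X)} (hT : Raises T)
    {T' : Module.End ℚ (Ser Y)} (h : ∀ z, g (T z) = T' (g z)) (p : PowerSeries ℚ) (z : Ser X) :
    g (opS p T z) = opS p T' (g z) := by
  rw [opS_apply, map_ser hg (hT.term_mem p z), opS_apply]
  congr 1
  funext k
  rw [map_smul]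
  congr 1
  induction k generalizing z with
  | zero => rfl
  | succ k ih => rw [pow_succ, pow_succ, Module.End.mul_apply, Module.End.mul_apply, ih, h]

theorem pres_opS {T : Module.End ℚ (Ser X)} (hT : Raises T) (p : PowerSeries ℚ) :
    Pres (opS p T) := fun m _ hz =>
  ser_mem fun k => (Fil X m).smul_mem _ (Fil_mono (Nat.le_add_right m k) (hT.pow_mem k hz))

/-- To leading order, a power series in a raising operator is multiplication by its constant term.
-/
theorem opS_sub_mem {T : Module.End ℚ (Ser X)} (hT : Raises T) (p : PowerSeries ℚ) {m : ℕ}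
    {z : Ser X} (hz : z ∈ Fil X m) :
    opS p T z - PowerSeries.constantCoeff p • z ∈ Fil X (m + 1) := by
  rw [opS_apply, ser_succ (hT.term_mem p z)]
  simp only [PowerSeries.coeff_zero_eq_constantCoeff, pow_zero, Module.End.one_apply,
    add_sub_cancel_left]
  exact ser_mem fun k => (Fil X _).smul_mem _ (Fil_mono (by omega) (hT.pow_mem (k + 1) hz))

theorem raises_opS {T : Module.End ℚ (Ser X)} (hT : Raises T) {p : PowerSeries ℚ}
    (hp : PowerSeries.constantCoeff p = 0) : Raises (opS p T) := fun m z hz => by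
  simpa [hp] using opS_sub_mem hT p hz

theorem opS_add (p q : PowerSeries ℚ) (T : Module.End ℚ (Ser X)) :
    opS (p + q) T = opS p T + opS q T := by
  ext1 z
  simp only [opS_apply, map_add, add_smul, ser_add, LinearMap.add_apply]

theorem opS_smul (c : ℚ) (p : PowerSeries ℚ) (T : Module.End ℚ (Ser X)) :
    opS (c • p) T = c • opS p T := by
  ext1 z
  simp only [opS_apply, map_smul, smul_assoc, ser_smul, LinearMap.smul_apply]

theorem opS_neg (p : PowerSeries ℚ) (T : Module.End ℚ (Ser X)) :
    opS (-p) T = -opS p T := by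
  simpa using opS_smul (-1) p T

theorem opS_sub (p q : PowerSeries ℚ) (T : Module.End ℚ (Ser X)) :
    opS (p - q) T = opS p T - opS q T := by
  rw [sub_eq_add_neg, opS_add, opS_neg, sub_eq_add_neg]

/-- Since `p ↦ p(T)` is multiplicative, identities such as `t/(1 - e^{-t}) · (1 - e^{-t})/t = 1` may
be proved in the commutative ring `PowerSeries ℚ` and then applied to operators. -/
theorem opS_mul {T : Module.End ℚ (Ser X)} (hT : Raises T) (p q : PowerSeries ℚ) :
    opS (p * q) T = opS p T * opS q T := by
  ext1 z
  rw [Module.End.mul_apply, opS_apply q]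
  simp only [opS_apply]
  rw [show (fun k => PowerSeries.coeff k p • (T ^ k) (ser fun k => PowerSeries.coeff k q • (T ^ k) z))
      = fun i => ser fun j => PowerSeries.coeff i p • (T ^ i) (PowerSeries.coeff j q • (T ^ j) z) from
    funext fun i => map_ser (T := PowerSeries.coeff i p • T ^ i)
      (fun m y hy => (Fil X m).smul_mem _ (Fil_mono (Nat.le_add_right _ _) (hT.pow_mem i hy)))
      (hT.term_mem q z)]
  rw [ser_ser fun i j => (Fil X _).smul_mem _ (by
    rw [add_comm]; exact hT.pow_mem i (hT.term_mem q z j))]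
  congr 1
  funext k
  rw [PowerSeries.coeff_mul, Finset.Nat.sum_antidiagonal_eq_sum_range_succ_mk, Finset.sum_smul]
  refine Finset.sum_congr rfl fun i hi => ?_
  rw [map_smul, smul_smul, ← Module.End.mul_apply, ← pow_add,
    Nat.add_sub_cancel' (Nat.le_of_lt_succ (Finset.mem_range.mp hi))]

theorem opS_one (T : Module.End ℚ (Ser X)) : opS 1 T = 1 := by
  ext z w
  rw [opS_apply, coeff_ser, Finset.sum_eq_single 0]
  · simp
  · intro k _ hk; simp [PowerSeries.coeff_one, hk]
  · simp

theorem opS_X {T : Module.End ℚ (Ser X)} (hT : Raises T) : opS PowerSeries.X T = T := by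
  ext z w
  rw [opS_apply, coeff_ser_of_lt (hT.term_mem _ z) (N := w.length + 2) (by omega),
    Finset.sum_eq_single 1]
  · simp
  · intro k _ hk; simp [PowerSeries.coeff_X, hk]
  · simp

theorem opS_pow {T : Module.End ℚ (Ser X)} (hT : Raises T) (p : PowerSeries ℚ) (k : ℕ) :
    opS (p ^ k) T = opS p T ^ k := by
  induction k with
  | zero => simp [opS_one]
  | succ k ih => rw [pow_succ, pow_succ, opS_mul hT, ih]

theorem commute_opS {S T : Module.End ℚ (Ser X)} (hS : Pres S) (hT : Raises T) (h : Commute S T)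
    (p : PowerSeries ℚ) : Commute S (opS p T) :=
  LinearMap.ext fun z => map_opS hS hT (fun y => LinearMap.congr_fun h.eq y) p z

theorem opS_smul_right (c : ℚ) (p : PowerSeries ℚ) (T : Module.End ℚ (Ser X)) :
    opS p (c • T) = opS (PowerSeries.rescale c p) T := by
  ext1 z
  simp only [opS_apply, PowerSeries.coeff_rescale, smul_pow, LinearMap.smul_apply, smul_smul]
  congr 1; funext k; rw [mul_comm]

/-- This serves to prove `exp (log u) = u`. As `q` has no constant term, `q ^ d` starts in degree
`d`, and both sides are the same finite triangular double sum in each coefficient. -/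
theorem opS_subst {T : Module.End ℚ (Ser X)} (hT : Raises T) (p : PowerSeries ℚ)
    {q : PowerSeries ℚ} (hq : PowerSeries.constantCoeff q = 0) :
    opS (p.subst q) T = opS p (opS q T) := by
  ext z w
  have hsub : PowerSeries.HasSubst q := PowerSeries.HasSubst.of_constantCoeff_zero' hq
  have hX : PowerSeries.X ∣ q := PowerSeries.X_dvd_iff.mpr hq
  have hco : ∀ d e, e < d → PowerSeries.coeff e (q ^ d) = 0 := fun d e h =>
    PowerSeries.X_pow_dvd_iff.mp (pow_dvd_pow_of_dvd hX d) e h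
  rw [opS_apply, opS_apply, coeff_ser, coeff_ser]
  have h1 : ∀ d ∈ range (w.length + 1), coeff w (PowerSeries.coeff d p • (opS q T ^ d) z)
      = ∑ e ∈ range (w.length + 1), PowerSeries.coeff d p * (PowerSeries.coeff e (q ^ d) *
        coeff w ((T ^ e) z)) := fun d _ => by
    rw [← opS_pow hT, opS_apply, map_smul, coeff_ser, smul_eq_mul, Finset.mul_sum]
    simp
  rw [Finset.sum_congr rfl h1, Finset.sum_comm]
  refine Finset.sum_congr rfl fun e he => ?_
  rw [map_smul, PowerSeries.coeff_subst' hsub, finsum_eq_sum_of_support_subset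
    (s := range (w.length + 1)), smul_eq_mul, Finset.sum_mul]
  · exact Finset.sum_congr rfl fun d _ => by rw [smul_eq_mul, mul_assoc]
  · intro d hd
    rw [Finset.coe_range, Set.mem_Iio]
    by_contra h
    exact hd (by simp only [hco d e (by rw [Finset.mem_range] at he; omega), smul_zero])

/-- The exponential series. -/
abbrev expS : PowerSeries ℚ := PowerSeries.exp ℚ

/-- The binomial theorem for commuting operators. It is applied to multiplications on the same side
by commuting series, and to left and right multiplication, which always commute. -/
theorem opS_exp_add {S T : Module.End ℚ (Ser X)} (hS : Raises S) (hT : Raises T)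
    (h : Commute S T) : opS expS (S + T) = opS expS S * opS expS T := by
  ext1 z
  rw [Module.End.mul_apply, opS_apply expS T]
  simp only [opS_apply]
  rw [show (fun k => PowerSeries.coeff k expS • (S ^ k)
        (ser fun k => PowerSeries.coeff k expS • (T ^ k) z))
      = fun i => ser fun j => PowerSeries.coeff i expS • (S ^ i)
        (PowerSeries.coeff j expS • (T ^ j) z) from
    funext fun i => map_ser (T := PowerSeries.coeff i expS • S ^ i)
      (fun m y hy => (Fil X m).smul_mem _ (Fil_mono (Nat.le_add_right _ _) (hS.pow_mem i hy)))
      (hT.term_mem expS z)]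
  rw [ser_ser fun i j => (Fil X _).smul_mem _ (by
    rw [add_comm]; exact hS.pow_mem i (hT.term_mem expS z j))]
  congr 1
  funext k
  rw [h.add_pow, LinearMap.sum_apply, Finset.smul_sum]
  refine Finset.sum_congr rfl fun i hi => ?_
  have hik : i ≤ k := Nat.le_of_lt_succ (Finset.mem_range.mp hi)
  rw [map_smul, smul_smul, Module.End.mul_apply, Module.End.mul_apply,
    show ((k.choose i : ℕ) : Module.End ℚ (Ser X)) z = (k.choose i : ℚ) • z by
      rw [Module.End.natCast_apply, Nat.cast_smul_eq_nsmul], map_smul, map_smul, smul_smul]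
  congr 1
  simp only [PowerSeries.coeff_exp, eq_ratCast, Rat.cast_eq_id, id_eq]
  have := Nat.choose_mul_factorial_mul_factorial hik
  have hk : (k.factorial : ℚ) ≠ 0 := by positivity
  have hi : (i.factorial : ℚ) ≠ 0 := by positivity
  have hki : ((k - i).factorial : ℚ) ≠ 0 := by positivity
  field_simp
  exact_mod_cast by rw [← this]

/-! ### The exponential and the logarithm -/

/-- The exponential of a series without constant term. -/
def exp (f : Ser X) : Ser X := opS expS (L f) 1

/-- The logarithm of a series with constant term `1`. -/
def log (u : Ser X) : Ser X := opS (PowerSeries.log ℚ) (L (u - 1)) 1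

/-- Right multiplication by `z` commutes with `L f`, so that `p(L f)` is left multiplication by its
value at `1`. -/
theorem opS_L_apply {f : Ser X} (hf : f ∈ Fil X 1) (p : PowerSeries ℚ) (z : Ser X) :
    opS p (L f) z = opS p (L f) 1 * z := by
  have := map_opS (pres_R z) (raises_L hf) (T' := L f) (fun y => by simp [mul_assoc]) p 1
  simpa using this.symm

theorem opS_R_apply {f : Ser X} (hf : f ∈ Fil X 1) (p : PowerSeries ℚ) (z : Ser X) :
    opS p (R f) z = z * opS p (L f) 1 := by
  have h1 := map_opS (pres_L z) (raises_R hf) (T' := R f) (fun y => by simp [mul_assoc]) p 1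
  have h2 : opS p (R f) 1 = opS p (L f) 1 := by
    rw [opS_apply, opS_apply]; congr 1; funext k; congr 1
    induction k with
    | zero => rfl
    | succ k ih =>
      have : (L f ^ k) 1 = f ^ k := by
        rw [L, LinearMap.pow_mulLeft]; simp
      rw [pow_succ', pow_succ', Module.End.mul_apply, Module.End.mul_apply, ih, this, L_apply,
        R_apply, ← pow_succ', ← pow_succ]
  simpa [h2] using h1.symm

theorem opS_exp_L {f : Ser X} (hf : f ∈ Fil X 1) (z : Ser X) : opS expS (L f) z = exp f * z :=
  opS_L_apply hf _ z

theorem opS_exp_R {f : Ser X} (hf : f ∈ Fil X 1) (z : Ser X) : opS expS (R f) z = z * exp f :=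
  opS_R_apply hf _ z

theorem exp_add {f g : Ser X} (hf : f ∈ Fil X 1) (hg : g ∈ Fil X 1) (h : Commute f g) :
    exp (f + g) = exp f * exp g := by
  have : L (f + g) = L f + L g := LinearMap.ext fun z => by simp [add_mul]
  rw [exp, this, opS_exp_add (raises_L hf) (raises_L hg), Module.End.mul_apply, ← exp, opS_exp_L hf]
  exact LinearMap.ext fun z => by simp [Module.End.mul_apply, ← mul_assoc, h.eq]

theorem exp_zero : exp (0 : Ser X) = 1 := by
  ext w
  rw [exp, opS_apply, coeff_ser, Finset.sum_eq_single 0]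
  · simp
  · intro k _ hk
    have : L (0 : Ser X) = 0 := LinearMap.ext fun z => by simp
    simp [this, hk]
  · simp

theorem exp_mul_exp_neg {f : Ser X} (hf : f ∈ Fil X 1) : exp f * exp (-f) = 1 := by
  rw [← exp_add hf ((Fil X 1).neg_mem hf) (Commute.refl f).neg_right, add_neg_cancel, exp_zero]

theorem exp_neg_mul_exp {f : Ser X} (hf : f ∈ Fil X 1) : exp (-f) * exp f = 1 := by
  simpa using exp_mul_exp_neg ((Fil X 1).neg_mem hf)

theorem exp_sub_mem {f : Ser X} (hf : f ∈ Fil X 1) : exp f - 1 ∈ Fil X 1 := by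
  simpa [exp] using opS_sub_mem (raises_L hf) expS (mem_Fil_zero (1 : Ser X))

theorem log_mem {u : Ser X} (hu : u - 1 ∈ Fil X 1) : log u ∈ Fil X 1 := by
  simpa [log] using raises_opS (raises_L hu) (p := PowerSeries.log ℚ) (by simp) 0 1 (mem_Fil_zero _)

/-- The composite `E` satisfies `(1 + X) E' = E` and `E(0) = 1`, and `1 + X` is the only solution.
-/
theorem expS_subst_log : expS.subst (PowerSeries.log ℚ) = 1 + PowerSeries.X := by
  set E := expS.subst (PowerSeries.log ℚ) with hE
  have hl : PowerSeries.HasSubst (PowerSeries.log ℚ) := PowerSeries.HasSubst.log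
  have h0 : PowerSeries.constantCoeff E = 1 := by
    rw [← PowerSeries.coeff_zero_eq_constantCoeff_apply, hE, PowerSeries.coeff_subst' hl,
      finsum_eq_single _ 0]
    · simp
    · intro d hd
      simp [hd]
  have hd : PowerSeries.derivative ℚ E = E * PowerSeries.derivative ℚ (PowerSeries.log ℚ) := by
    rw [hE, PowerSeries.derivative_subst hl, PowerSeries.derivative_exp]
  have hlog : (1 + PowerSeries.X) * PowerSeries.derivative ℚ (PowerSeries.log ℚ) = 1 := by
    rw [PowerSeries.deriv_log]
    ext n
    rw [add_mul, one_mul, map_add]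
    cases n with
    | zero => simp
    | succ n => simp [PowerSeries.coeff_succ_X_mul, PowerSeries.coeff_one, pow_succ]
  have hode : (1 + PowerSeries.X) * PowerSeries.derivative ℚ E = E := by
    rw [hd, mul_left_comm, hlog, mul_one]
  -- The equation reads `(k + 1) c_{k+1} = (1 - k) c_k` on coefficients; `k = 1` gives `c₂ = 0`, and
  -- zero propagates from there.
  have hstep : ∀ n, PowerSeries.coeff (n + 2) E = 0 := by
    intro n
    induction n with
    | zero =>
      have := congrArg (PowerSeries.coeff 1) hode
      rw [add_mul, one_mul, map_add, PowerSeries.coeff_succ_X_mul] at this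
      simp only [PowerSeries.coeff_derivative] at this
      norm_num at this
      exact this
    | succ n ih =>
      have := congrArg (PowerSeries.coeff (n + 2)) hode
      rw [add_mul, one_mul, map_add, PowerSeries.coeff_succ_X_mul] at this
      simp only [PowerSeries.coeff_derivative] at this
      rw [show n + 1 + 1 = n + 2 from rfl, ih, zero_mul, add_zero] at this
      exact (mul_eq_zero.mp this).resolve_right (by positivity)
  ext n
  match n with
  | 0 => simpa using h0
  | 1 =>
    have := congrArg (PowerSeries.coeff 0) hode
    rw [add_mul, one_mul, map_add] at this
    simp [PowerSeries.coeff_derivative, h0] at this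
    simp [this, PowerSeries.coeff_one]
  | n + 2 => simp [hstep n, PowerSeries.coeff_one, PowerSeries.coeff_X]

theorem exp_log {u : Ser X} (hu : u - 1 ∈ Fil X 1) : exp (log u) = u := by
  have h := opS_subst (raises_L hu) expS (q := PowerSeries.log ℚ) (by simp)
  have hL : L (log u) = opS (PowerSeries.log ℚ) (L (u - 1)) :=
    LinearMap.ext fun z => (opS_L_apply hu _ z).symm
  rw [exp, hL, ← h, expS_subst_log, opS_add, opS_one, opS_X (raises_L hu)]
  simp

/-- In a difference of powers with exponent at least `2`, each occurrence of `f - g` is accompanied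
by another factor from `Fil X 1`, which gains one letter. -/
theorem pow_sub_pow_mem {f g : Ser X} {m : ℕ} (hf : f ∈ Fil X 1) (hg : g ∈ Fil X 1)
    (h : f - g ∈ Fil X m) (k : ℕ) : f ^ (k + 2) - g ^ (k + 2) ∈ Fil X (m + 1) := by
  induction k with
  | zero =>
    have : f ^ (0 + 2) - g ^ (0 + 2) = f * (f - g) + (f - g) * g := by noncomm_ring
    rw [this]
    refine (Fil X _).add_mem ?_ (mul_mem_Fil h hg)
    rw [add_comm]; exact mul_mem_Fil hf h
  | succ k ih =>
    have : f ^ (k + 1 + 2) - g ^ (k + 1 + 2)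
        = f * (f ^ (k + 2) - g ^ (k + 2)) + (f - g) * (g * g ^ (k + 1)) := by
      rw [pow_succ' f (k + 2), ← pow_succ' g (k + 1), pow_succ' g (k + 2)]; noncomm_ring
    rw [this]
    exact (Fil X _).add_mem (mul_mem_Fil_right f ih)
      (mul_mem_Fil h (mul_mem_Fil_left _ hg))

theorem L_pow_one (f : Ser X) (k : ℕ) : (L f ^ k) 1 = f ^ k := by
  rw [L, LinearMap.pow_mulLeft]; simp

/-- First-order expansion: only the linear coefficient of `p` is visible modulo one further letter.
For `exp` and `log` this coefficient is `1`. -/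
theorem opS_L_sub_mem {f g : Ser X} {m : ℕ} (hf : f ∈ Fil X 1) (hg : g ∈ Fil X 1)
    (h : f - g ∈ Fil X m) (p : PowerSeries ℚ) :
    opS p (L f) 1 - opS p (L g) 1 - PowerSeries.coeff 1 p • (f - g) ∈ Fil X (m + 1) := by
  have hf' := ((raises_L hf).term_mem p 1)
  have hg' := ((raises_L hg).term_mem p 1)
  simp only [opS_apply]
  rw [ser_succ hf', ser_succ hg', ser_succ fun k => Fil_mono (Nat.le_succ k) (hf' (k + 1)),
    ser_succ fun k => Fil_mono (Nat.le_succ k) (hg' (k + 1))]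
  simp only [L_pow_one]
  have key : (ser fun k => PowerSeries.coeff (k + 1 + 1) p • (f ^ (k + 1 + 1) - g ^ (k + 1 + 1)))
      ∈ Fil X (m + 1) :=
    ser_mem fun k => (Fil X _).smul_mem _ (pow_sub_pow_mem hf hg h k)
  convert key using 1
  simp only [smul_sub, ser_sub]
  simp
  abel

theorem exp_sub_exp_mem {f g : Ser X} {m : ℕ} (hf : f ∈ Fil X 1) (hg : g ∈ Fil X 1)
    (h : f - g ∈ Fil X m) : exp f - exp g - (f - g) ∈ Fil X (m + 1) := by
  simpa [exp] using opS_L_sub_mem hf hg h expS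

theorem log_sub_log_mem {u v : Ser X} {m : ℕ} (hu : u - 1 ∈ Fil X 1) (hv : v - 1 ∈ Fil X 1)
    (h : u - v ∈ Fil X m) : log u - log v - (u - v) ∈ Fil X (m + 1) := by
  simpa [log] using opS_L_sub_mem hu hv (by simpa using h) (PowerSeries.log ℚ)

/-- By the first-order expansion, equality of the exponentials improves `f - g ∈ Fil X m` to `f - g
∈ Fil X (m + 1)`. Identities involving BCH are usually reduced to products of exponentials in this
way. -/
theorem exp_injective {f g : Ser X} (hf : f ∈ Fil X 1) (hg : g ∈ Fil X 1) (h : exp f = exp g) :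
    f = g := by
  refine eq_of_sub_mem_Fil fun m => ?_
  induction m with
  | zero => exact mem_Fil_zero _
  | succ m ih => simpa [h] using (Fil X _).neg_mem (exp_sub_exp_mem hf hg ih)

theorem log_exp {f : Ser X} (hf : f ∈ Fil X 1) : log (exp f) = f :=
  exp_injective (log_mem (exp_sub_mem hf)) hf (exp_log (exp_sub_mem hf))

theorem mul_sub_one_mem {u v : Ser X} (hu : u - 1 ∈ Fil X 1) (hv : v - 1 ∈ Fil X 1) :
    u * v - 1 ∈ Fil X 1 := by
  have : u * v - 1 = (u - 1) * v + (v - 1) := by noncomm_ring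
  rw [this]; exact (Fil X 1).add_mem (mul_mem_Fil_left v hu) hv

/-- The Baker-Campbell-Hausdorff series. -/
def bch (f g : Ser X) : Ser X := log (exp f * exp g)

theorem bch_mem {f g : Ser X} (hf : f ∈ Fil X 1) (hg : g ∈ Fil X 1) : bch f g ∈ Fil X 1 :=
  log_mem (mul_sub_one_mem (exp_sub_mem hf) (exp_sub_mem hg))

theorem exp_bch {f g : Ser X} (hf : f ∈ Fil X 1) (hg : g ∈ Fil X 1) :
    exp (bch f g) = exp f * exp g :=
  exp_log (mul_sub_one_mem (exp_sub_mem hf) (exp_sub_mem hg))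

end Ser

/-! ### Series in several operators, substitution, homomorphisms and derivations. -/

namespace Ser

variable {X Y Z ι : Type}

/-- The letter `x`, as a series. -/
def letter (x : X) : Ser X := NC.var x

open Classical in
theorem coeff_letter (x : X) (w : List X) : coeff w (letter x) = if w = [x] then 1 else 0 := by
  show NC.var x w = _
  rw [NC.var]

theorem letter_mem (x : X) : letter x ∈ Fil X 1 := by
  rw [mem_Fil_one, coeff_letter, if_neg (by simp)]

open Classical in
theorem tail_letter (x y : X) : tail x (letter y) = if x = y then 1 else 0 := by
  ext w
  rw [coeff_tail, coeff_letter]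
  by_cases h : x = y
  · subst h
    cases w with
    | nil => simp
    | cons z w => simp
  · simp [h]

/-- The decomposition by first letters. Iterating it gains one letter each time, which is why maps
compatible with products are determined by their values on letters. -/
theorem eq_sum_tail [Fintype X] (f : Ser X) :
    f = coeff [] f • (1 : Ser X) + ∑ x, letter x * tail x f := by
  classical
  refine ext_tail ?_ fun y => ?_
  · rw [map_add, map_sum, Finset.sum_eq_zero]
    · simp
    · intro x _; rw [coeff_mul_nil, mem_Fil_one.mp (letter_mem x), zero_mul]
  · rw [map_add, map_sum, map_smul, tail_one, smul_zero, zero_add, Finset.sum_eq_single y]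
    · rw [tail_mul, mem_Fil_one.mp (letter_mem y), zero_smul, zero_add, tail_letter, if_pos rfl,
        one_mul]
    · intro x _ hx
      rw [tail_mul, mem_Fil_one.mp (letter_mem x), zero_smul, zero_add, tail_letter,
        if_neg hx.symm, zero_mul]
    · simp

theorem tail_mem_Fil {f : Ser X} {m : ℕ} (hf : f ∈ Fil X (m + 1)) (x : X) : tail x f ∈ Fil X m :=
  fun w hw => hf (x :: w) (by simpa using hw)

/-! ### Series in several operators -/

variable [Fintype ι]

/-- The terms of degree `k` in `P(T₁, T₂, …) z`. -/
def level (T : ι → Module.End ℚ (Ser X)) : ℕ → Ser ι →ₗ[ℚ] Module.End ℚ (Ser X)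
  | 0 => (coeff []).smulRight 1
  | k + 1 => ∑ i, (LinearMap.mulLeft ℚ (T i)) ∘ₗ level T k ∘ₗ tail i

theorem level_mem {T : ι → Module.End ℚ (Ser X)} (hT : ∀ i, Raises (T i)) (k : ℕ) (P : Ser ι)
    {m : ℕ} {z : Ser X} (hz : z ∈ Fil X m) : level T k P z ∈ Fil X (m + k) := by
  induction k generalizing P with
  | zero => exact (Fil X _).smul_mem _ (by simpa using hz)
  | succ k ih =>
    rw [level, LinearMap.sum_apply, LinearMap.sum_apply]
    exact (Fil X _).sum_mem fun i _ => hT i _ _ (ih _)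

theorem level_mem' {T : ι → Module.End ℚ (Ser X)} (hT : ∀ i, Raises (T i)) (P : Ser ι) (z : Ser X)
    (k : ℕ) : level T k P z ∈ Fil X k := by
  simpa using level_mem hT k P (mem_Fil_zero z)

/-- `P(T₁, T₂, …)`, for operators that raise the filtration. -/
def opW (P : Ser ι) (T : ι → Module.End ℚ (Ser X)) : Module.End ℚ (Ser X) where
  toFun z := ser fun k => level T k P z
  map_add' z z' := by simp only [map_add, ser_add]
  map_smul' c z := by simp only [map_smul, ser_smul, RingHom.id_apply]

theorem opW_apply (P : Ser ι) (T : ι → Module.End ℚ (Ser X)) (z : Ser X) :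
    opW P T z = ser fun k => level T k P z := rfl

/-- The map `P ↦ P(T₁, T₂, …) z`. -/
def evalW (T : ι → Module.End ℚ (Ser X)) (z : Ser X) : Ser ι →ₗ[ℚ] Ser X where
  toFun P := opW P T z
  map_add' P Q := by simp only [opW_apply, map_add, LinearMap.add_apply, ser_add]
  map_smul' c P := by
    simp only [opW_apply, map_smul, LinearMap.smul_apply, ser_smul, RingHom.id_apply]

theorem evalW_apply (T : ι → Module.End ℚ (Ser X)) (z : Ser X) (P : Ser ι) :
    evalW T z P = opW P T z := rfl

theorem opW_rec {T : ι → Module.End ℚ (Ser X)} (hT : ∀ i, Raises (T i)) (P : Ser ι) (z : Ser X) :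
    opW P T z = coeff [] P • z + ∑ i, T i (opW (tail i P) T z) := by
  rw [opW_apply, ser_succ (level_mem' hT P z)]
  congr 1
  simp only [opW_apply]
  rw [Finset.sum_congr rfl fun i _ =>
    map_ser (hT i).pres (level_mem' hT (tail i P) z)]
  ext w
  simp only [coeff_ser, map_sum]
  rw [Finset.sum_comm]
  refine Finset.sum_congr rfl fun k _ => ?_
  rw [level, LinearMap.sum_apply, LinearMap.sum_apply, map_sum]
  rfl

/-- Each unfolding of the recursion puts a raising operator in front of the difference of two
solutions. Naturality and multiplicativity of `opW` follow by checking that the other side satisfies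
the recursion. -/
theorem opW_unique {T : ι → Module.End ℚ (Ser X)} (hT : ∀ i, Raises (T i)) {z : Ser X}
    {G : Ser ι → Ser X} (hG : ∀ P, G P = coeff [] P • z + ∑ i, T i (G (tail i P))) (P : Ser ι) :
    G P = opW P T z := by
  refine eq_of_sub_mem_Fil fun m => ?_
  induction m generalizing P with
  | zero => exact mem_Fil_zero _
  | succ m ih =>
    rw [hG, opW_rec hT, add_sub_add_left_eq_sub, ← Finset.sum_sub_distrib]
    refine (Fil X _).sum_mem fun i _ => ?_
    rw [← map_sub]
    exact hT i _ _ (ih _)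

theorem map_opW {g : Ser X →ₗ[ℚ] Ser Y} {T : ι → Module.End ℚ (Ser X)}
    (hT : ∀ i, Raises (T i)) {T' : ι → Module.End ℚ (Ser Y)} (hT' : ∀ i, Raises (T' i))
    (h : ∀ i z, g (T i z) = T' i (g z)) (P : Ser ι) (z : Ser X) :
    g (opW P T z) = opW P T' (g z) := by
  refine opW_unique (G := fun P => g (opW P T z)) hT' (fun P => ?_) P
  rw [opW_rec hT, map_add, map_smul, map_sum]
  simp only [h]

theorem opW_mul {T : ι → Module.End ℚ (Ser X)} (hT : ∀ i, Raises (T i)) (P Q : Ser ι)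
    (z : Ser X) : opW (P * Q) T z = opW P T (opW Q T z) := by
  refine opW_unique (G := fun P => opW (P * Q) T z) hT (fun P => ?_) P
  have h : ∀ i, opW (tail i (P * Q)) T z
      = coeff [] P • opW (tail i Q) T z + opW (tail i P * Q) T z := fun i => by
    rw [tail_mul, ← evalW_apply, map_add, map_smul]; rfl
  rw [opW_rec hT (P * Q), opW_rec hT Q]
  simp only [h, map_add, map_smul, coeff_mul_nil, Finset.sum_add_distrib, smul_add, mul_smul,
    Finset.smul_sum, add_assoc]

theorem opW_one {T : ι → Module.End ℚ (Ser X)} (hT : ∀ i, Raises (T i)) (z : Ser X) :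
    opW 1 T z = z := by
  rw [opW_rec hT]
  simp only [tail_one, coeff_one_nil, one_smul]
  simp [← evalW_apply]

theorem opW_letter {T : ι → Module.End ℚ (Ser X)} (hT : ∀ i, Raises (T i)) (i : ι) (z : Ser X) :
    opW (letter i) T z = T i z := by
  classical
  rw [opW_rec hT, mem_Fil_one.mp (letter_mem i), zero_smul, zero_add, Finset.sum_eq_single i]
  · rw [tail_letter, if_pos rfl, opW_one hT]
  · intro j _ hj
    rw [tail_letter, if_neg hj, ← evalW_apply, map_zero, map_zero]
  · simp

theorem pres_evalW {T : ι → Module.End ℚ (Ser X)} (hT : ∀ i, Raises (T i)) (z : Ser X) :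
    Pres (evalW T z) := by
  intro m P hP
  induction m generalizing P with
  | zero => exact mem_Fil_zero _
  | succ m ih =>
    rw [evalW_apply, opW_rec hT, hP [] (by simp), zero_smul, zero_add]
    exact (Fil X _).sum_mem fun i _ => hT i _ _ (ih _ (tail_mem_Fil hP i))

theorem pres_opW {T : ι → Module.End ℚ (Ser X)} (hT : ∀ i, Raises (T i)) (P : Ser ι) :
    Pres (opW P T) := fun m _ hz =>
  ser_mem fun k => Fil_mono (Nat.le_add_right m k) (level_mem hT k P hz)

theorem raises_opW {T : ι → Module.End ℚ (Ser X)} (hT : ∀ i, Raises (T i)) {P : Ser ι}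
    (hP : P ∈ Fil ι 1) : Raises (opW P T) := fun m _ hz => by
  rw [opW_rec hT, mem_Fil_one.mp hP, zero_smul, zero_add]
  exact (Fil X _).sum_mem fun i _ => hT i _ _ (pres_opW hT _ _ _ hz)

/-! ### Substitution -/

/-- Substitution of series without constant terms. -/
def subst (P : Ser ι) (y : ι → Ser X) : Ser X := opW P (fun i => L (y i)) 1

section
variable {y : ι → Ser X} (hy : ∀ i, y i ∈ Fil X 1)
include hy

theorem opW_L_apply (P : Ser ι) (z : Ser X) : opW P (fun i => L (y i)) z = subst P y * z := by
  have h := map_opW (g := R z) (fun i => raises_L (hy i)) (fun i => raises_L (hy i))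
    (fun i w => by simp [mul_assoc]) P 1
  simpa [subst] using h.symm

theorem subst_mul (P Q : Ser ι) : subst (P * Q) y = subst P y * subst Q y := by
  rw [subst, opW_mul fun i => raises_L (hy i), opW_L_apply hy]; rfl

theorem subst_one : subst (1 : Ser ι) y = 1 := opW_one (fun i => raises_L (hy i)) 1

theorem subst_letter (i : ι) : subst (letter i) y = y i := by
  rw [subst, opW_letter fun i => raises_L (hy i)]; simp

/-- `Q ↦ Q(T) z` intertwines left multiplication by `y i` with the operator `(y i)(T)`, so that this
is an instance of `map_opW`. -/
theorem opW_subst [Fintype X] {T : X → Module.End ℚ (Ser Y)} (hT : ∀ i, Raises (T i)) (P : Ser ι)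
    (z : Ser Y) : opW (subst P y) T z = opW P (fun i => opW (y i) T) z := by
  have := map_opW (g := evalW T z) (fun i => raises_L (hy i))
    (T' := fun i => opW (y i) T) (fun i => raises_opW hT (hy i))
    (fun i Q => by rw [evalW_apply, L_apply, opW_mul hT]; rfl) P 1
  rw [evalW_apply, evalW_apply, opW_one hT] at this
  exact this

end

/-- Homomorphisms of algebras that preserve the filtration by word length. -/
structure IsHom (g : Ser X →ₗ[ℚ] Ser Y) : Prop where
  pres : Pres g
  map_one : g 1 = 1
  map_mul : ∀ f f', g (f * f') = g f * g f'

namespace IsHom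

variable {g : Ser X →ₗ[ℚ] Ser Y} (hg : IsHom g)
include hg

theorem map_mem {f : Ser X} (hf : f ∈ Fil X 1) : g f ∈ Fil Y 1 := hg.pres 1 f hf

theorem map_opS_L {f : Ser X} (hf : f ∈ Fil X 1) (p : PowerSeries ℚ) :
    g (opS p (L f) 1) = opS p (L (g f)) 1 := by
  rw [map_opS hg.pres (raises_L hf) (T' := L (g f)) (fun z => by simp [hg.map_mul]), hg.map_one]

theorem map_exp {f : Ser X} (hf : f ∈ Fil X 1) : g (exp f) = exp (g f) := hg.map_opS_L hf _

theorem map_log {u : Ser X} (hu : u - 1 ∈ Fil X 1) : g (log u) = log (g u) := by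
  rw [log, hg.map_opS_L hu, map_sub, hg.map_one, log]

theorem map_bch {f f' : Ser X} (hf : f ∈ Fil X 1) (hf' : f' ∈ Fil X 1) :
    g (bch f f') = bch (g f) (g f') := by
  rw [bch, hg.map_log (mul_sub_one_mem (exp_sub_mem hf) (exp_sub_mem hf')), hg.map_mul,
    hg.map_exp hf, hg.map_exp hf', bch]

theorem map_subst {y : ι → Ser X} (hy : ∀ i, y i ∈ Fil X 1) (P : Ser ι) :
    g (subst P y) = subst P fun i => g (y i) := by
  rw [subst, map_opW (fun i => raises_L (hy i)) (fun i => raises_L (hg.map_mem (hy i)))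
    (fun i z => by simp [hg.map_mul]), hg.map_one, subst]

theorem eq_subst [Fintype X] (f : Ser X) : g f = subst f fun x => g (letter x) := by
  refine opW_unique (fun x => raises_L (hg.map_mem (letter_mem x))) (fun f => ?_) f
  conv_lhs => rw [eq_sum_tail f]
  simp only [map_add, map_smul, map_sum, hg.map_mul, hg.map_one, L_apply]

end IsHom

/-- Substitution, as a linear map. -/
def substL (y : ι → Ser X) : Ser ι →ₗ[ℚ] Ser X := evalW (fun i => L (y i)) 1

theorem substL_apply (y : ι → Ser X) (P : Ser ι) : substL y P = subst P y := rfl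

theorem isHom_subst {y : ι → Ser X} (hy : ∀ i, y i ∈ Fil X 1) : IsHom (substL y) where
  pres := pres_evalW (fun i => raises_L (hy i)) 1
  map_one := subst_one hy
  map_mul := subst_mul hy

theorem subst_subst [Fintype X] {y : ι → Ser X} (hy : ∀ i, y i ∈ Fil X 1) {y' : X → Ser Y}
    (hy' : ∀ x, y' x ∈ Fil Y 1) (P : Ser ι) :
    subst (subst P y) y' = subst P fun i => subst (y i) y' :=
  (isHom_subst hy').map_subst hy P

omit [Fintype ι] in
theorem isHom_id : IsHom (LinearMap.id : Ser ι →ₗ[ℚ] Ser ι) := ⟨Pres.id, rfl, fun _ _ => rfl⟩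

theorem subst_mem {y : ι → Ser X} (hy : ∀ i, y i ∈ Fil X 1) {P : Ser ι} {m : ℕ}
    (hP : P ∈ Fil ι m) : subst P y ∈ Fil X m :=
  (isHom_subst hy).pres m P hP

/-- Conjugation by a unit. -/
theorem isHom_conj {u v : Ser X} (h : v * u = 1) (h' : u * v = 1) : IsHom (L u * R v) where
  pres := (pres_L u).mul (pres_R v)
  map_one := by simp [Module.End.mul_apply, h']
  map_mul f f' := by
    simp only [Module.End.mul_apply, L_apply, R_apply]
    rw [show u * (f * v) * (u * (f' * v)) = u * f * (v * u) * f' * v by noncomm_ring, h]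
    noncomm_ring

/-! ### The adjoint action of an even element -/

/-- The ordinary commutator with `f`. -/
def ad (f : Ser X) : Module.End ℚ (Ser X) := L f - R f

@[simp] theorem ad_apply (f z : Ser X) : ad f z = f * z - z * f := rfl

theorem raises_ad {f : Ser X} (hf : f ∈ Fil X 1) : Raises (ad f) :=
  (raises_L hf).sub (raises_R hf)

theorem ad_neg (f : Ser X) : ad (-f) = -ad f := LinearMap.ext fun z => by simp; abel

/-- `ad f` is the sum of the commuting operators `L f` and `R (-f)`, so its exponential is
conjugation. -/
theorem opS_exp_ad {f : Ser X} (hf : f ∈ Fil X 1) (z : Ser X) :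
    opS expS (ad f) z = exp f * z * exp (-f) := by
  have hf' := (Fil X 1).neg_mem hf
  have : ad f = L f + R (-f) := LinearMap.ext fun z => by simp [sub_eq_add_neg]
  rw [this, opS_exp_add (raises_L hf) (raises_R hf') (commute_L_R _ _), Module.End.mul_apply,
    opS_exp_R hf', opS_exp_L hf, mul_assoc]

/-- The series `e^{-t}`. -/
def expNegS : PowerSeries ℚ := PowerSeries.rescale (-1) expS

/-- The series `(1 - e^{-t}) / t`. -/
def flowS : PowerSeries ℚ := PowerSeries.mk fun k => (-1 : ℚ) ^ k / ((k + 1).factorial : ℚ)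

/-- The series `(e^t - 1) / t`. -/
def expShiftS : PowerSeries ℚ := PowerSeries.mk fun k => 1 / ((k + 1).factorial : ℚ)

theorem coeff_expNegS (k : ℕ) : PowerSeries.coeff k expNegS = (-1 : ℚ) ^ k / (k.factorial : ℚ) := by
  simp [expNegS, PowerSeries.coeff_rescale, PowerSeries.coeff_exp, div_eq_mul_inv]

theorem X_mul_flowS : PowerSeries.X * flowS = 1 - expNegS := by
  ext k
  cases k with
  | zero => rw [PowerSeries.coeff_zero_X_mul, map_sub, coeff_expNegS]; simp
  | succ k =>
    rw [PowerSeries.coeff_succ_X_mul, map_sub, coeff_expNegS, flowS, PowerSeries.coeff_mk,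
      PowerSeries.coeff_one, if_neg (by omega), pow_succ]
    ring

theorem X_mul_expShiftS : PowerSeries.X * expShiftS = expS - 1 := by
  ext k
  cases k with
  | zero => simp
  | succ k =>
    simp [PowerSeries.coeff_succ_X_mul, expShiftS, PowerSeries.coeff_one, PowerSeries.coeff_exp]

theorem expS_mul_expNegS : expS * expNegS = 1 := PowerSeries.exp_mul_exp_neg_eq_one

theorem expShiftS_mul_expNegS : expShiftS * expNegS = flowS := by
  refine mul_left_cancel₀ (PowerSeries.X_ne_zero) ?_
  rw [← mul_assoc, X_mul_expShiftS, X_mul_flowS, sub_mul, expS_mul_expNegS, one_mul]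

theorem opS_expNeg_ad {f : Ser X} (hf : f ∈ Fil X 1) (z : Ser X) :
    opS expNegS (ad f) z = exp (-f) * z * exp f := by
  rw [expNegS, ← opS_smul_right, neg_one_smul, ← ad_neg, opS_exp_ad ((Fil X 1).neg_mem hf), neg_neg]

theorem commute_exp {f : Ser X} (hf : f ∈ Fil X 1) : Commute f (exp f) := by
  have h := commute_opS (pres_L f) (raises_L hf) (Commute.refl _) expS
  have := LinearMap.congr_fun h.eq 1
  simp only [Module.End.mul_apply] at this
  rw [opS_exp_L hf, opS_exp_L hf] at this
  simpa [Commute, SemiconjBy] using this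

/-! ### Derivations -/

/-- Derivations `δ(fg) = δ(f) φ(g) + ψ(f) δ(g)` that preserve the filtration. -/
structure IsDer (φ ψ δ : Ser X →ₗ[ℚ] Ser Y) : Prop where
  pres : Pres δ
  leibniz : ∀ f g, δ (f * g) = δ f * φ g + ψ f * δ g

/-- The left side is `((a + r)^(k+1) - r^(k+1)) / a` written without division. Pascal's rule yields
the recursion in `k` that the Leibniz rule for powers will produce. -/
theorem sum_choose_step {A : Type*} [Ring A] {a r : A} (h : Commute a r) (k : ℕ) :
    ∑ i ∈ range (k + 1), ((k + 1).choose (i + 1) : A) * (a ^ i * r ^ (k - i))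
      = (∑ i ∈ range k, (k.choose (i + 1) : A) * (a ^ i * r ^ (k - 1 - i))) * r + (a + r) ^ k := by
  rw [h.add_pow, Finset.sum_mul]
  simp only [Nat.choose_succ_succ, Nat.cast_add, add_mul, Finset.sum_add_distrib]
  rw [add_comm]
  congr 1
  · rw [Finset.sum_range_succ]
    simp only [Nat.choose_succ_self, Nat.cast_zero, zero_mul, add_zero]
    refine Finset.sum_congr rfl fun i hi => ?_
    rw [Finset.mem_range] at hi
    rw [mul_assoc, mul_assoc, ← pow_succ, show k - 1 - i + 1 = k - i by omega]
  · exact Finset.sum_congr rfl fun i _ => (Nat.cast_commute _ _).eq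

namespace IsDer

variable {φ ψ δ : Ser X →ₗ[ℚ] Ser Y} (hδ : IsDer φ ψ δ)
include hδ

theorem map_one (hφ : φ 1 = 1) (hψ : ψ 1 = 1) : δ 1 = 0 := by
  have := hδ.leibniz 1 1
  rw [hφ, hψ, one_mul, mul_one, one_mul] at this
  simpa using this

/-- With left multiplication written as `ad + R`, the Leibniz rule for `f ^ k * f` is the recursion
of `sum_choose_step`. The condition `φ f = ψ f` lets both twists of `δ` act on `f` by the same
element. -/
theorem map_pow (hψ : IsHom ψ) {f : Ser X} (hf : φ f = ψ f) (k : ℕ) :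
    δ (f ^ (k + 1)) = (∑ i ∈ range (k + 1), ((k + 1).choose (i + 1) : Module.End ℚ (Ser Y)) *
      (ad (φ f) ^ i * R (φ f) ^ (k - i))) (δ f) := by
  have hL : L (φ f) = ad (φ f) + R (φ f) := by rw [ad, sub_add_cancel]
  have hc : Commute (ad (φ f)) (R (φ f)) := by
    rw [ad]; exact (commute_L_R _ _).sub_left (Commute.refl _)
  have hpow : ∀ k, ψ (f ^ k) = φ f ^ k := fun k => by
    induction k with
    | zero => simp [hψ.map_one]
    | succ k ih => rw [pow_succ, pow_succ, hψ.map_mul, ih, hf]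
  induction k with
  | zero => simp
  | succ k ih =>
    rw [sum_choose_step hc, ← hL, pow_succ, hδ.leibniz, ih, hpow, LinearMap.add_apply]
    congr 1
    · have hc' : Commute (∑ i ∈ range (k + 1), ((k + 1).choose (i + 1) : Module.End ℚ (Ser Y)) *
          (ad (φ f) ^ i * R (φ f) ^ (k - i))) (R (φ f)) :=
        Commute.sum_left _ _ _ fun i _ => (Nat.cast_commute _ _).mul_left
          ((hc.pow_left _).mul_left ((Commute.refl _).pow_left _))
      rw [Nat.add_sub_cancel, hc'.eq]
      rfl
    · rw [L, LinearMap.pow_mulLeft]; rfl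

/-- The derivative of the exponential. -/
theorem map_exp (hφ : IsHom φ) (hψ : IsHom ψ) {f : Ser X} (hf1 : f ∈ Fil X 1) (hf : φ f = ψ f) :
    δ (exp f) = exp (φ f) * opS flowS (ad (φ f)) (δ f) := by
  have hf' : φ f ∈ Fil Y 1 := hφ.map_mem hf1
  have hA := raises_ad hf'
  have hR := raises_R hf'
  -- The coefficient `C(k+1, i+1) / (k+1)!` is `1/(i+1)! · 1/(k-i)!`, so the double sum factors into
  -- a series in `ad` and the exponential of right multiplication.
  have h1 : δ (exp f) = opS expShiftS (ad (φ f)) (opS expS (R (φ f)) (δ f)) := by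
    rw [exp, opS_apply, map_ser hδ.pres ((raises_L hf1).term_mem _ _), opS_apply expS,
      ser_succ fun k => hδ.pres _ _ ((raises_L hf1).term_mem _ _ k), opS_apply]
    rw [show (fun k => PowerSeries.coeff k expShiftS • (ad (φ f) ^ k)
        (ser fun k => PowerSeries.coeff k expS • (R (φ f) ^ k) (δ f)))
      = fun i => ser fun j => PowerSeries.coeff i expShiftS • (ad (φ f) ^ i)
        (PowerSeries.coeff j expS • (R (φ f) ^ j) (δ f)) from
      funext fun i => map_ser (T := PowerSeries.coeff i expShiftS • ad (φ f) ^ i)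
        (fun m y hy => (Fil Y m).smul_mem _ (Fil_mono (Nat.le_add_right _ _) (hA.pow_mem i hy)))
        (hR.term_mem expS (δ f))]
    rw [ser_ser fun i j => (Fil Y _).smul_mem _ (by
      rw [add_comm]; exact hA.pow_mem i (hR.term_mem expS _ j))]
    rw [pow_zero, Module.End.one_apply, map_smul, hδ.map_one hφ.map_one hψ.map_one, smul_zero,
      zero_add]
    congr 1
    funext k
    rw [L_pow_one, map_smul, hδ.map_pow hψ hf, LinearMap.sum_apply, Finset.smul_sum]
    refine Finset.sum_congr rfl fun i hi => ?_
    have hik : i ≤ k := Nat.le_of_lt_succ (Finset.mem_range.mp hi)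
    rw [Module.End.mul_apply, Module.End.natCast_apply, ← Nat.cast_smul_eq_nsmul ℚ, map_smul,
      smul_smul, smul_smul, Module.End.mul_apply]
    congr 1
    simp only [PowerSeries.coeff_exp, eq_ratCast, Rat.cast_eq_id, id_eq, expShiftS,
      PowerSeries.coeff_mk]
    have := Nat.choose_mul_factorial_mul_factorial (Nat.succ_le_succ hik)
    rw [Nat.succ_sub_succ] at this
    have h1 : ((k + 1).factorial : ℚ) ≠ 0 := by positivity
    have h2 : ((i + 1).factorial : ℚ) ≠ 0 := by positivity
    have h3 : ((k - i).factorial : ℚ) ≠ 0 := by positivity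
    rw [← Nat.succ_eq_add_one, ← Nat.succ_eq_add_one] at *
    field_simp
    exact_mod_cast by rw [← this]
  -- Moving the exponential from right to left costs a factor `e^{-ad}`, which turns `(e^t - 1)/t`
  -- into `(1 - e^{-t})/t`.
  have h2 : opS expS (R (φ f)) (δ f) = L (exp (φ f)) (opS expNegS (ad (φ f)) (δ f)) := by
    rw [opS_exp_R hf', opS_expNeg_ad hf', L_apply, ← mul_assoc, ← mul_assoc, exp_mul_exp_neg hf',
      one_mul]
  have h3 : Commute (L (exp (φ f))) (ad (φ f)) := by
    have := commute_exp hf'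
    refine LinearMap.ext fun z => ?_
    simp only [Module.End.mul_apply, L_apply, ad_apply, mul_sub, ← mul_assoc, this.eq]
  rw [h1, h2, ← expShiftS_mul_expNegS, opS_mul hA]
  exact (LinearMap.congr_fun (commute_opS (pres_L _) hA h3 expShiftS).eq _).symm

/-- On `x * tail x f` only the term `ψ(x) * δ(tail x f)` survives; it starts with an element of `Fil
Y 1`, so every unfolding gains a letter. -/
theorem eq_zero_of_letters [Fintype X] (hφ : IsHom φ) (hψ : IsHom ψ) (h : ∀ x, δ (letter x) = 0) :
    δ = 0 := by
  refine LinearMap.ext fun f => eq_zero_of_mem_Fil fun m => ?_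
  induction m generalizing f with
  | zero => exact mem_Fil_zero _
  | succ m ih =>
    rw [eq_sum_tail f, map_add, map_smul, hδ.map_one hφ.map_one hψ.map_one, smul_zero, zero_add,
      map_sum]
    refine (Fil Y _).sum_mem fun x _ => ?_
    rw [hδ.leibniz, h, zero_mul, zero_add, add_comm m]
    exact mul_mem_Fil (hψ.map_mem (letter_mem x)) (ih _)

end IsDer

theorem IsDer.sub {φ ψ δ δ' : Ser X →ₗ[ℚ] Ser Y} (h : IsDer φ ψ δ) (h' : IsDer φ ψ δ') :
    IsDer φ ψ (δ - δ') where
  pres := h.pres.sub h'.pres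
  leibniz f g := by
    simp only [LinearMap.sub_apply, h.leibniz, h'.leibniz]; noncomm_ring

theorem IsDer.ext [Fintype X] {φ ψ δ δ' : Ser X →ₗ[ℚ] Ser Y} (hφ : IsHom φ) (hψ : IsHom ψ)
    (h : IsDer φ ψ δ) (h' : IsDer φ ψ δ') (hl : ∀ x, δ (letter x) = δ' (letter x)) : δ = δ' :=
  sub_eq_zero.mp ((h.sub h').eq_zero_of_letters hφ hψ fun x => by simp [hl])

end Ser

/-! ### Degrees and signs, Lie series, and the Baker-Campbell-Hausdorff theorem. -/

namespace Ser

variable {X Y Z ι : Type}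

/-! ### Weights -/

/-- Series supported on the words of weight `k`, for letters of weights `wt`. -/
def WHom {M : Type*} [AddCommMonoid M] (wt : X → M) (k : M) : Submodule ℚ (Ser X) where
  carrier := {f | ∀ w : List X, coeff w f ≠ 0 → (w.map wt).sum = k}
  add_mem' {f g} hf hg w hw := by
    by_cases h : coeff w f = 0
    · exact hg w fun h' => hw (by rw [map_add, h, h', add_zero])
    · exact hf w h
  zero_mem' w hw := absurd rfl hw
  smul_mem' c f hf w hw := hf w fun h => hw (by rw [map_smul, h, smul_zero])

theorem letter_mem_WHom {M : Type*} [AddCommMonoid M] (wt : X → M) (x : X) :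
    letter x ∈ WHom wt (wt x) := by
  classical
  intro w hw
  rw [coeff_letter] at hw
  have : w = [x] := by by_contra h; exact hw (if_neg h)
  simp [this]

theorem one_mem_WHom {M : Type*} [AddCommMonoid M] (wt : X → M) : (1 : Ser X) ∈ WHom wt 0 := by
  intro w hw
  cases w with
  | nil => rfl
  | cons x w => exact absurd rfl hw

theorem sum_take_add_drop {M : Type*} [AddCommMonoid M] (wt : X → M) (w : List X) (k : ℕ) :
    (w.map wt).sum = ((w.take k).map wt).sum + ((w.drop k).map wt).sum := by
  rw [← List.sum_append, ← List.map_append, List.take_append_drop]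

theorem mul_mem_WHom {M : Type*} [AddCommMonoid M] {wt : X → M} {p q : M} {f g : Ser X}
    (hf : f ∈ WHom wt p) (hg : g ∈ WHom wt q) : f * g ∈ WHom wt (p + q) := by
  intro w hw
  rw [coeff_mul] at hw
  obtain ⟨k, _, hk⟩ := Finset.exists_ne_zero_of_sum_ne_zero hw
  rw [sum_take_add_drop wt w k, hf _ (left_ne_zero_of_mul hk), hg _ (right_ne_zero_of_mul hk)]

/-- A submodule that is closed for the topology given by the filtration. -/
def Closed (K : Submodule ℚ (Ser X)) : Prop :=
  ∀ z, (∀ m, ∃ z' ∈ K, z - z' ∈ Fil X m) → z ∈ K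

theorem Closed.inf {K K' : Submodule ℚ (Ser X)} (h : Closed K) (h' : Closed K') :
    Closed (K ⊓ K') := fun z hz =>
  ⟨h z fun m => (hz m).imp fun _ ⟨a, b⟩ => ⟨a.1, b⟩, h' z fun m => (hz m).imp fun _ ⟨a, b⟩ => ⟨a.2, b⟩⟩

theorem closed_WHom {M : Type*} [AddCommMonoid M] (wt : X → M) (k : M) : Closed (WHom wt k) := by
  intro z hz w hw
  obtain ⟨z', hz', h⟩ := hz (w.length + 1)
  refine hz' w ?_
  have := h w (Nat.lt_succ_self _)
  rw [map_sub, sub_eq_zero] at this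
  rwa [← this]

theorem closed_Fil (m : ℕ) : Closed (Fil X m) := by
  intro z hz
  obtain ⟨z', hz', h⟩ := hz m
  simpa using (Fil X m).add_mem h hz'

theorem Closed.ser_mem {K : Submodule ℚ (Ser X)} (hK : Closed K) {u : ℕ → Ser X}
    (hu : ∀ k, u k ∈ Fil X k) (h : ∀ k, u k ∈ K) : ser u ∈ K :=
  hK _ fun m => ⟨_, K.sum_mem fun k _ => h k, ser_sub_mem hu m⟩

theorem Closed.opS_mem {K : Submodule ℚ (Ser X)} (hK : Closed K) {T : Module.End ℚ (Ser X)}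
    (hT : Raises T) (h : ∀ z ∈ K, T z ∈ K) (p : PowerSeries ℚ) {z : Ser X} (hz : z ∈ K) :
    opS p T z ∈ K := by
  refine hK.ser_mem (hT.term_mem p z) fun k => K.smul_mem _ ?_
  induction k with
  | zero => exact hz
  | succ k ih => rw [pow_succ', Module.End.mul_apply]; exact h _ ih

theorem Closed.opW_mem [Fintype ι] {K : Submodule ℚ (Ser X)} (hK : Closed K)
    {T : ι → Module.End ℚ (Ser X)} (hT : ∀ i, Raises (T i)) (h : ∀ i, ∀ z ∈ K, T i z ∈ K)
    (P : Ser ι) {z : Ser X} (hz : z ∈ K) : opW P T z ∈ K := by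
  refine hK.ser_mem (level_mem' hT P z) fun k => ?_
  induction k generalizing P with
  | zero => exact K.smul_mem _ hz
  | succ k ih =>
    rw [level, LinearMap.sum_apply, LinearMap.sum_apply]
    exact K.sum_mem fun i _ => h i _ (ih _)

/-! ### Signs and the graded bracket -/

section
variable (deg : X → ℤ)

/-- Series that are homogeneous of degree `k`. -/
abbrev Hom (k : ℤ) : Submodule ℚ (Ser X) := WHom deg k

/-- The sign `(-1)^{p|f|} f`. -/
def sgn (p : ℤ) : Ser X →ₗ[ℚ] Ser X where
  toFun f := ofFun fun w => (-1 : ℚ) ^ (p * wdeg deg w) * coeff w f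
  map_add' f g := by ext w; simp [mul_add]
  map_smul' c f := by ext w; simp; ring

theorem coeff_sgn (p : ℤ) (f : Ser X) (w : List X) :
    coeff w (sgn deg p f) = (-1 : ℚ) ^ (p * wdeg deg w) * coeff w f := rfl

theorem wdeg_take_add_drop (w : List X) (k : ℕ) :
    wdeg deg w = wdeg deg (w.take k) + wdeg deg (w.drop k) := sum_take_add_drop deg w k

/-- Koszul signs are packed into this automorphism: derivations of odd degree become the twisted
derivations `IsDer LinearMap.id (sgn deg 1)`, with no homogeneity assumption in the Leibniz rule. -/
theorem isHom_sgn (p : ℤ) : IsHom (sgn deg p) where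
  pres m f hf w hw := by rw [coeff_sgn, hf w hw, mul_zero]
  map_one := by
    ext w
    cases w with
    | nil => simp [coeff_sgn, wdeg]
    | cons x w => simp [coeff_sgn]
  map_mul f g := by
    ext w
    simp only [coeff_sgn, coeff_mul, Finset.mul_sum]
    refine Finset.sum_congr rfl fun k _ => ?_
    rw [wdeg_take_add_drop deg w k, mul_add, zpow_add₀ (by norm_num)]
    ring

theorem neg_one_zpow_mul_self (k : ℤ) : (-1 : ℚ) ^ k * (-1 : ℚ) ^ k = 1 := by
  rw [← mul_zpow]; simp

theorem sgn_sgn (p : ℤ) (f : Ser X) : sgn deg p (sgn deg p f) = f := by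
  ext w
  rw [coeff_sgn, coeff_sgn, ← mul_assoc, neg_one_zpow_mul_self, one_mul]

variable {deg}

theorem sgn_of_mem {k : ℤ} {f : Ser X} (hf : f ∈ Hom deg k) (p : ℤ) :
    sgn deg p f = (-1 : ℚ) ^ (p * k) • f := by
  ext w
  rw [coeff_sgn, map_smul, smul_eq_mul]
  by_cases h : coeff w f = 0
  · rw [h, mul_zero, mul_zero]
  · rw [wdeg, hf w h]

theorem sgn_even {f : Ser X} (hf : f ∈ Hom deg 0) (p : ℤ) : sgn deg p f = f := by
  rw [sgn_of_mem hf, mul_zero, zpow_zero, one_smul]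

theorem sgn_zero (f : Ser X) : sgn deg 0 f = f := by
  ext w; simp [coeff_sgn]

variable (deg)

/-- The graded commutator. -/
def br : Ser X →ₗ[ℚ] Ser X →ₗ[ℚ] Ser X := NC.bracket deg

theorem coeff_br (f g : Ser X) (w : List X) : coeff w (br deg f g) =
    ∑ k ∈ range (w.length + 1), (coeff (w.take k) f * coeff (w.drop k) g
        - (-1 : ℚ) ^ (wdeg deg (w.take k) * wdeg deg (w.drop k)) *
          (coeff (w.take k) g * coeff (w.drop k) f)) := rfl

variable {deg}

theorem br_of_mem {p : ℤ} {f : Ser X} (hf : f ∈ Hom deg p) (g : Ser X) :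
    br deg f g = f * g - sgn deg p g * f := by
  ext w
  rw [coeff_br, map_sub, coeff_mul, coeff_mul, ← Finset.sum_sub_distrib]
  refine Finset.sum_congr rfl fun k _ => ?_
  rw [coeff_sgn]
  by_cases h : coeff (w.drop k) f = 0
  · simp [h]
  · rw [show wdeg deg (w.drop k) = p from hf _ h, mul_comm p]; ring

theorem br_of_mem_mem {p q : ℤ} {f g : Ser X} (hf : f ∈ Hom deg p) (hg : g ∈ Hom deg q) :
    br deg f g = f * g - (-1 : ℚ) ^ (p * q) • (g * f) := by
  rw [br_of_mem hf, sgn_of_mem hg, smul_mul_assoc]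

theorem br_even {f : Ser X} (hf : f ∈ Hom deg 0) (g : Ser X) : br deg f g = ad f g := by
  rw [br_of_mem hf, sgn_zero, ad_apply]

theorem br_even' {p : ℤ} {f g : Ser X} (hf : f ∈ Hom deg p) (hg : g ∈ Hom deg 0) :
    br deg f g = f * g - g * f := by
  rw [br_of_mem hf, sgn_even hg]

theorem br_mem_Fil {m k : ℕ} {f g : Ser X} (hf : f ∈ Fil X m) (hg : g ∈ Fil X k) :
    br deg f g ∈ Fil X (m + k) := by
  intro w hw
  rw [coeff_br]
  refine Finset.sum_eq_zero fun j hj => ?_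
  rw [Finset.mem_range] at hj
  have h1 : coeff (w.take j) f * coeff (w.drop j) g = 0 := by
    by_cases h : j < m
    · rw [hf _ (by rw [List.length_take]; omega), zero_mul]
    · rw [hg _ (by rw [List.length_drop]; omega), mul_zero]
  have h2 : coeff (w.take j) g * coeff (w.drop j) f = 0 := by
    by_cases h : j < k
    · rw [hg _ (by rw [List.length_take]; omega), zero_mul]
    · rw [hf _ (by rw [List.length_drop]; omega), mul_zero]
  rw [h1, h2, mul_zero, sub_zero]

theorem br_mem_WHom {M : Type*} [AddCommMonoid M] {wt : X → M} {p q : M} {f g : Ser X}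
    (hf : f ∈ WHom wt p) (hg : g ∈ WHom wt q) : br deg f g ∈ WHom wt (p + q) := by
  intro w hw
  rw [coeff_br] at hw
  obtain ⟨k, _, hk⟩ := Finset.exists_ne_zero_of_sum_ne_zero hw
  rw [sum_take_add_drop wt w k]
  by_cases h : coeff (w.take k) f * coeff (w.drop k) g = 0
  · rw [h, zero_sub, neg_ne_zero] at hk
    have hk := right_ne_zero_of_mul hk
    rw [hg _ (left_ne_zero_of_mul hk), hf _ (right_ne_zero_of_mul hk), add_comm]
  · rw [hf _ (left_ne_zero_of_mul h), hg _ (right_ne_zero_of_mul h)]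

/-! ### Lie series -/

variable (deg)

/-- Linear combinations of iterated commutators of letters in `S`. -/
def LieSpan (S : Set X) : Submodule ℚ (Ser X) :=
  Submodule.span ℚ {f : Ser X | IsLieMonomial deg S f}

/-- Multiplication of the words of length `m` by `c m`. -/
def scale (c : ℕ → ℚ) : Ser X →ₗ[ℚ] Ser X where
  toFun f := ofFun fun w => c w.length * coeff w f
  map_add' f g := by ext w; simp [mul_add]
  map_smul' c f := by ext w; simp; ring

theorem coeff_scale (c : ℕ → ℚ) (f : Ser X) (w : List X) :
    coeff w (scale c f) = c w.length * coeff w f := rfl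

/-- The words of length `m` in a series. -/
def part (m : ℕ) : Ser X →ₗ[ℚ] Ser X := scale fun k => if k = m then 1 else 0

theorem coeff_part (m : ℕ) (f : Ser X) (w : List X) :
    coeff w (part m f) = if w.length = m then coeff w f else 0 := by
  rw [part, coeff_scale]; split_ifs <;> simp

theorem pres_scale (c : ℕ → ℚ) : Pres (scale c : Ser X →ₗ[ℚ] Ser X) := fun m f hf w hw => by
  rw [coeff_scale, hf w hw, mul_zero]

theorem scale_mem_WHom {M : Type*} [AddCommMonoid M] {wt : X → M} {k : M} (c : ℕ → ℚ) {f : Ser X}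
    (hf : f ∈ WHom wt k) : scale c f ∈ WHom wt k := fun w hw =>
  hf w fun h => hw (by rw [coeff_scale, h, mul_zero])

/-- The completed Lie algebra generated by the letters in `S`. -/
def Lie (S : Set X) : Submodule ℚ (Ser X) where
  carrier := {z | ∀ m, part m z ∈ LieSpan deg S}
  add_mem' hf hg m := by rw [map_add]; exact Submodule.add_mem _ (hf m) (hg m)
  zero_mem' m := by rw [map_zero]; exact Submodule.zero_mem _
  smul_mem' c f hf m := by rw [map_smul]; exact Submodule.smul_mem _ c (hf m)

variable {deg} {S : Set X}

/-- The weights are arbitrary because two choices matter: the degree, and the constant weight `1`,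
for which the weight of a word is its length. -/
theorem IsLieMonomial.exists_mem_WHom {M : Type*} [AddCommMonoid M] (wt : X → M) {f : Ser X}
    (hf : IsLieMonomial deg S f) : ∃ k, f ∈ WHom wt k := by
  induction hf with
  | gen x hx => exact ⟨_, letter_mem_WHom wt x⟩
  | bracket f g _ _ ihf ihg =>
    obtain ⟨p, hp⟩ := ihf
    obtain ⟨q, hq⟩ := ihg
    exact ⟨p + q, br_mem_WHom (f := f) (g := g) hp hq⟩

theorem part_mem_LieSpan (m : ℕ) {z : Ser X} (hz : z ∈ LieSpan deg S) :
    part m z ∈ LieSpan deg S := by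
  refine Submodule.span_induction (p := fun z _ => part m z ∈ LieSpan deg S) ?_ ?_ ?_ ?_ hz
  · intro f hf
    obtain ⟨k, hk⟩ := IsLieMonomial.exists_mem_WHom (fun _ => (1 : ℕ)) hf
    have hlen : ∀ w, coeff w f ≠ 0 → w.length = k := fun w hw => by simpa using hk w hw
    by_cases h : k = m
    · have : part m f = f := by
        ext w
        rw [coeff_part, ite_eq_left_iff]
        intro hw
        by_contra h'
        exact hw ((hlen w (Ne.symm h')).trans h)
      rw [this]; exact Submodule.subset_span hf
    · have : part m f = 0 := by
        ext w
        rw [coeff_part, map_zero, ite_eq_right_iff]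
        intro hw
        by_contra h'
        exact h ((hlen w h').symm.trans hw)
      rw [this]; exact Submodule.zero_mem _
  · rw [map_zero]; exact Submodule.zero_mem _
  · intro x y _ _ hx hy; rw [map_add]; exact Submodule.add_mem _ hx hy
  · intro c x _ hx; rw [map_smul]; exact Submodule.smul_mem _ c hx

theorem LieSpan_le_Lie : LieSpan deg S ≤ Lie deg S := fun _ hz m => part_mem_LieSpan m hz

theorem sub_sum_part_mem (z : Ser X) (m : ℕ) : z - ∑ k ∈ range m, part k z ∈ Fil X m := by
  intro w hw
  rw [map_sub, map_sum, Finset.sum_eq_single w.length]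
  · rw [coeff_part, if_pos rfl, sub_self]
  · intro k _ hk; rw [coeff_part, if_neg (Ne.symm hk)]
  · intro h; exact absurd (Finset.mem_range.mpr hw) h

theorem exists_LieSpan {z : Ser X} (hz : z ∈ Lie deg S) (m : ℕ) :
    ∃ z' ∈ LieSpan deg S, z - z' ∈ Fil X m :=
  ⟨_, Submodule.sum_mem _ fun k _ => hz k, sub_sum_part_mem z m⟩

theorem closed_Lie : Closed (Lie deg S) := by
  intro z hz m
  obtain ⟨z', hz', h⟩ := hz (m + 1)
  have : part m z = part m z' := by
    ext w
    rw [coeff_part, coeff_part]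
    split_ifs with hw
    · have := h w (by omega)
      rwa [map_sub, sub_eq_zero] at this
    · rfl
  rw [this]; exact hz' m

/-- Membership in a closed submodule may be checked on iterated commutators. -/
theorem Lie_induction {T : Ser X →ₗ[ℚ] Ser Y} (hT : Pres T) {K : Submodule ℚ (Ser Y)}
    (hK : Closed K) (h : ∀ f : Ser X, IsLieMonomial deg S f → T f ∈ K) {z : Ser X}
    (hz : z ∈ Lie deg S) : T z ∈ K := by
  refine hK _ fun m => ?_
  obtain ⟨z', hz', hm⟩ := exists_LieSpan hz m
  refine ⟨T z', ?_, by rw [← map_sub]; exact hT m _ hm⟩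
  have : LieSpan deg S ≤ K.comap T := Submodule.span_le.mpr fun f hf => h f hf
  exact this hz'

theorem letter_mem_Lie {x : X} (hx : x ∈ S) : letter x ∈ Lie deg S :=
  LieSpan_le_Lie (Submodule.subset_span (IsLieMonomial.gen x hx))

theorem br_mem_Lie {f g : Ser X} (hf : f ∈ Lie deg S) (hg : g ∈ Lie deg S) :
    br deg f g ∈ Lie deg S := by
  have pres1 : ∀ f : Ser X, Pres (br deg f) := fun f m z hz => by
    simpa using br_mem_Fil (mem_Fil_zero f) hz
  have pres2 : ∀ g : Ser X, Pres ((br deg).flip g) := fun g m z hz => by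
    simpa using br_mem_Fil (deg := deg) hz (mem_Fil_zero g)
  refine Lie_induction (pres2 g) closed_Lie (fun f hf => ?_) hf
  exact Lie_induction (pres1 f) closed_Lie
    (fun g hg => LieSpan_le_Lie (Submodule.subset_span (IsLieMonomial.bracket f g hf hg))) hg

theorem Lie_le_Fil_one : Lie deg S ≤ Fil X 1 := fun z hz => by
  refine Lie_induction (T := LinearMap.id) Pres.id (closed_Fil 1) (fun f hf => ?_) hz
  induction hf with
  | gen x _ => exact letter_mem x
  | bracket f g _ _ ihf ihg =>
    exact Fil_mono (by omega) (br_mem_Fil (f := f) (g := g) (m := 1) (k := 1) ihf ihg)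

theorem Lie_mono {S' : Set X} (h : S ⊆ S') : Lie deg S ≤ Lie deg S' := fun z hz => by
  refine Lie_induction (T := LinearMap.id) Pres.id closed_Lie (fun f hf => ?_) hz
  refine LieSpan_le_Lie (Submodule.subset_span ?_)
  show IsLieMonomial deg S' f
  induction hf with
  | gen x hx => exact IsLieMonomial.gen x (h hx)
  | bracket f g _ _ ihf ihg => exact IsLieMonomial.bracket f g ihf ihg

theorem scale_mem_Lie (c : ℕ → ℚ) {z : Ser X} (hz : z ∈ Lie deg S) : scale c z ∈ Lie deg S := by
  intro m
  have : part m (scale c z) = c m • part m z := by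
    ext w
    rw [map_smul, coeff_part, coeff_part, coeff_scale]
    split_ifs with h
    · rw [h, smul_eq_mul]
    · simp
  rw [this]; exact Submodule.smul_mem _ _ (hz m)

variable (deg S)

/-- The Lie series in the letters in `S` of degree `k`. -/
def A (k : ℤ) : Submodule ℚ (Ser X) := Hom deg k ⊓ Lie deg S

variable {deg S} {k : ℤ}

theorem closed_A : Closed (A deg S k) := (closed_WHom deg k).inf closed_Lie

theorem A_mem_Fil {z : Ser X} (hz : z ∈ A deg S k) : z ∈ Fil X 1 := Lie_le_Fil_one hz.2

theorem A_mono {S' : Set X} (h : S ⊆ S') : A deg S k ≤ A deg S' k :=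
  inf_le_inf_left _ (Lie_mono h)

theorem letter_mem_A {x : X} (hx : x ∈ S) : letter x ∈ A deg S (deg x) :=
  ⟨letter_mem_WHom deg x, letter_mem_Lie hx⟩

theorem br_mem_A {p q : ℤ} {f g : Ser X} (hf : f ∈ A deg S p) (hg : g ∈ A deg S q) :
    br deg f g ∈ A deg S (p + q) :=
  ⟨br_mem_WHom hf.1 hg.1, br_mem_Lie hf.2 hg.2⟩

theorem ad_mem_A {f g : Ser X} (hf : f ∈ A deg S 0) (hg : g ∈ A deg S k) : ad f g ∈ A deg S k := by
  have := br_mem_A hf hg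
  rwa [zero_add, br_even hf.1] at this

theorem scale_mem_A (c : ℕ → ℚ) {z : Ser X} (hz : z ∈ A deg S k) : scale c z ∈ A deg S k :=
  ⟨scale_mem_WHom c hz.1, scale_mem_Lie c hz.2⟩

theorem opS_ad_mem_A {f g : Ser X} (hf : f ∈ A deg S 0) (hg : g ∈ A deg S k) (p : PowerSeries ℚ) :
    opS p (ad f) g ∈ A deg S k :=
  closed_A.opS_mem (raises_ad (A_mem_Fil hf)) (fun _ hz => ad_mem_A hf hz) p hg

theorem opW_ad_mem_A [Fintype ι] {y : ι → Ser X} (hy : ∀ i, y i ∈ A deg S 0) {g : Ser X}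
    (hg : g ∈ A deg S k) (P : Ser ι) : opW P (fun i => ad (y i)) g ∈ A deg S k :=
  closed_A.opW_mem (fun i => raises_ad (A_mem_Fil (hy i))) (fun i _ hz => ad_mem_A (hy i) hz) P hg

/-! ### The Baker-Campbell-Hausdorff theorem -/

/-- The derivation that multiplies words by their length. -/
def euler : Ser X →ₗ[ℚ] Ser X := scale fun k => k

theorem isDer_euler : IsDer LinearMap.id LinearMap.id (euler : Ser X →ₗ[ℚ] Ser X) where
  pres := pres_scale _
  leibniz f g := by
    ext w
    simp only [euler, coeff_scale, LinearMap.id_apply, map_add, coeff_mul, Finset.mul_sum,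
      ← Finset.sum_add_distrib]
    refine Finset.sum_congr rfl fun k hk => ?_
    have : (w.length : ℚ) = (w.take k).length + (w.drop k).length := by
      rw [← Nat.cast_add, ← List.length_append, List.take_append_drop]
    rw [this]; ring

/-- A change of `f` in `Fil X m` changes `p(ad f) z` only in `Fil X (m + 1)`, because `z` itself has
no constant term. This is the contraction behind `bch_mem_A`. -/
theorem opS_ad_sub_mem {f g z : Ser X} {m : ℕ} (hf : f ∈ Fil X 1) (hg : g ∈ Fil X 1)
    (h : f - g ∈ Fil X m) (hz : z ∈ Fil X 1) (p : PowerSeries ℚ) :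
    opS p (ad f) z - opS p (ad g) z ∈ Fil X (m + 1) := by
  rw [opS_apply, opS_apply, ← ser_sub]
  refine ser_mem fun k => ?_
  rw [← smul_sub]
  refine (Fil X _).smul_mem _ ?_
  induction k with
  | zero => simp
  | succ k ih =>
    have : (ad f ^ (k + 1)) z - (ad g ^ (k + 1)) z
        = ad f ((ad f ^ k) z - (ad g ^ k) z) + ((f - g) * (ad g ^ k) z - (ad g ^ k) z * (f - g)) := by
      rw [pow_succ', pow_succ', Module.End.mul_apply, Module.End.mul_apply]
      simp only [ad_apply]
      noncomm_ring
    rw [this]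
    have hw : (ad g ^ k) z ∈ Fil X 1 := Fil_mono (by omega) ((raises_ad hg).pow_mem k hz)
    refine (Fil X _).add_mem ((raises_ad hf).pres _ _ ih) ((Fil X _).sub_mem (mul_mem_Fil h hw) ?_)
    rw [add_comm]; exact mul_mem_Fil hw h

/-- The series `t / (1 - e^{-t})`. -/
abbrev bernS : PowerSeries ℚ := bernoulli'PowerSeries ℚ

theorem bernS_mul_flowS : bernS * flowS = 1 := by
  have h := bernoulli'PowerSeries_mul_exp_sub_one ℚ
  refine mul_left_cancel₀ (PowerSeries.X_ne_zero (R := ℚ)) ?_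
  have h2 : PowerSeries.X * flowS = (expS - 1) * expNegS := by
    rw [X_mul_flowS, sub_mul, expS_mul_expNegS, one_mul]
  calc PowerSeries.X * (bernS * flowS) = bernS * (PowerSeries.X * flowS) := by ring
    _ = bernS * (expS - 1) * expNegS := by rw [h2, mul_assoc]
    _ = PowerSeries.X * (expS * expNegS) := by rw [h, mul_assoc]
    _ = PowerSeries.X * 1 := by rw [expS_mul_expNegS]

/-- The two Bernoulli series in the formula for the edges are `bernS` and `bernS * expNegS`.
Multiplied by `flowS` they give `1` and `expNegS`, which makes the edge formula a flow equation. -/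
theorem bernoulliPowerSeries_eq : bernoulliPowerSeries ℚ = bernS * expNegS := by
  have h := bernoulliPowerSeries_mul_exp_sub_one ℚ
  have h' := bernoulli'PowerSeries_mul_exp_sub_one ℚ
  have hne : (expS - 1 : PowerSeries ℚ) ≠ 0 := by
    intro h0
    rw [h0, mul_zero] at h
    exact PowerSeries.X_ne_zero h.symm
  refine mul_right_cancel₀ hne ?_
  rw [h, mul_right_comm, h', mul_assoc, expS_mul_expNegS, mul_one]

theorem opS_bern_flow {T : Module.End ℚ (Ser X)} (hT : Raises T) (z : Ser X) :
    opS bernS T (opS flowS T z) = z := by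
  rw [← Module.End.mul_apply, ← opS_mul hT, bernS_mul_flowS, opS_one, Module.End.one_apply]

theorem opS_flow_bern {T : Module.End ℚ (Ser X)} (hT : Raises T) (z : Ser X) :
    opS flowS T (opS bernS T z) = z := by
  rw [← Module.End.mul_apply, ← opS_mul hT, mul_comm, bernS_mul_flowS, opS_one,
    Module.End.one_apply]

theorem exp_mem_Hom {f : Ser X} (hf1 : f ∈ Fil X 1) (hf : f ∈ Hom deg 0) : exp f ∈ Hom deg 0 := by
  refine (closed_WHom deg 0).opS_mem (raises_L hf1) (fun z hz => ?_) expS (one_mem_WHom deg)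
  simpa using mul_mem_WHom hf hz

/-- The Baker-Campbell-Hausdorff theorem. -/
theorem bch_mem_A {f g : Ser X} (hf : f ∈ A deg S 0) (hg : g ∈ A deg S 0) :
    bch f g ∈ A deg S 0 := by
  have hf1 := A_mem_Fil hf
  have hg1 := A_mem_Fil hg
  have hZ1 : bch f g ∈ Fil X 1 := bch_mem hf1 hg1
  have hde : ∀ {h : Ser X}, h ∈ Fil X 1 → euler (exp h) = exp h * opS flowS (ad h) (euler h) :=
    fun hh => isDer_euler.map_exp isHom_id isHom_id hh rfl
  -- With `Z = bch f g`, this is `exp (-Z) * euler (exp Z)`, computed from `exp Z = exp f * exp g`.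
  -- It is visibly a Lie series.
  set r := opS expNegS (ad g) (opS flowS (ad f) (euler f)) + opS flowS (ad g) (euler g) with hr
  have hrA : r ∈ A deg S 0 := (A deg S 0).add_mem
    (opS_ad_mem_A hg (opS_ad_mem_A hf (scale_mem_A _ hf) _) _)
    (opS_ad_mem_A hg (scale_mem_A _ hg) _)
  have key : euler (bch f g) = opS bernS (ad (bch f g)) r := by
    have h1 : exp (bch f g) * opS flowS (ad (bch f g)) (euler (bch f g)) = exp (bch f g) * r := by
      rw [← hde hZ1, exp_bch hf1 hg1, isDer_euler.leibniz, hde hf1, hde hg1, hr,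
        opS_expNeg_ad hg1, LinearMap.id_apply, LinearMap.id_apply]
      have : exp g * exp (-g) = 1 := exp_mul_exp_neg hg1
      have e : ∀ z, exp f * exp g * (exp (-g) * z * exp g)
          = exp f * (exp g * exp (-g)) * z * exp g := fun z => by noncomm_ring
      rw [_root_.mul_add, e, this, mul_one, mul_assoc (exp f) (exp g)]
    have h2 := congrArg (fun z => exp (-bch f g) * z) h1
    simp only [← mul_assoc, exp_neg_mul_exp hZ1, one_mul] at h2
    rw [← h2, opS_bern_flow (raises_ad hZ1)]
  -- The identity `key` is a fixed-point equation: inserting a Lie series that agrees with `bch f g`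
  -- up to `Fil X m` into its right side gives one that agrees up to `Fil X (m + 1)`.
  refine closed_A _ fun m => ?_
  induction m with
  | zero => exact ⟨0, (A deg S 0).zero_mem, mem_Fil_zero _⟩
  | succ m ih =>
    obtain ⟨Z, hZ, hm⟩ := ih
    -- Division by the length inverts `euler`. The value `0⁻¹ = 0` only concerns the empty word,
    -- which is absent from `bch f g`.
    refine ⟨scale (fun k => (k : ℚ)⁻¹) (opS bernS (ad Z) r),
      scale_mem_A _ (opS_ad_mem_A hZ hrA _), ?_⟩
    have h1 : scale (fun k => (k : ℚ)⁻¹) (euler (bch f g)) = bch f g := by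
      ext w
      rw [coeff_scale, euler, coeff_scale]
      by_cases hw : w.length = 0
      · rw [mem_Fil.mp hZ1 w (by omega)]; simp
      · have : (w.length : ℚ) ≠ 0 := by exact_mod_cast hw
        field_simp
    rw [← h1, ← map_sub, key]
    exact pres_scale _ _ _ (opS_ad_sub_mem hZ1 (A_mem_Fil hZ) hm (A_mem_Fil hrA) bernS)

end

/-! ### Homomorphisms and Lie series -/

/-- A homomorphism that maps letters to homogeneous series of the same degree is compatible with
signs. -/
theorem IsHom.map_sgn [Fintype X] {deg : X → ℤ} {deg' : Y → ℤ} {g : Ser X →ₗ[ℚ] Ser Y}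
    (hg : IsHom g) (h : ∀ x, g (letter x) ∈ Hom deg' (deg x)) (p : ℤ) (f : Ser X) :
    g (sgn deg p f) = sgn deg' p (g f) := by
  have h1 : IsHom (g ∘ₗ sgn deg p) :=
    ⟨hg.pres.comp (isHom_sgn deg p).pres, by simp [(isHom_sgn deg p).map_one, hg.map_one],
      fun f f' => by simp [(isHom_sgn deg p).map_mul, hg.map_mul]⟩
  have h2 : IsHom (sgn deg' p ∘ₗ g) :=
    ⟨(isHom_sgn deg' p).pres.comp hg.pres, by simp [(isHom_sgn deg' p).map_one, hg.map_one],
      fun f f' => by simp [(isHom_sgn deg' p).map_mul, hg.map_mul]⟩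
  have e1 := h1.eq_subst f
  have e2 := h2.eq_subst f
  simp only [LinearMap.comp_apply] at e1 e2
  rw [e1, e2]
  congr 1
  funext x
  rw [sgn_of_mem (letter_mem_WHom deg x), map_smul, sgn_of_mem (h x)]

theorem IsHom.map_Hom [Fintype X] {deg : X → ℤ} {deg' : Y → ℤ} {g : Ser X →ₗ[ℚ] Ser Y}
    (hg : IsHom g) (h : ∀ x, g (letter x) ∈ Hom deg' (deg x)) {k : ℤ} {f : Ser X}
    (hf : f ∈ Hom deg k) : g f ∈ Hom deg' k := by
  refine closed_WHom deg' k _ fun m => ?_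
  induction m generalizing f k with
  | zero => exact ⟨0, Submodule.zero_mem _, mem_Fil_zero _⟩
  | succ m ih =>
    have htail : ∀ x, tail x f ∈ Hom deg (k - deg x) := fun x w hw => by
      have := hf (x :: w) hw
      rw [List.map_cons, List.sum_cons] at this
      omega
    choose t ht htm using fun x => ih (htail x)
    refine ⟨coeff [] f • 1 + ∑ x, g (letter x) * t x, Submodule.add_mem _ ?_
      (Submodule.sum_mem _ fun x _ => ?_), ?_⟩
    · by_cases h0 : coeff [] f = 0
      · rw [h0, zero_smul]; exact Submodule.zero_mem _
      · have : k = 0 := by simpa using (hf [] h0).symm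
        subst this
        exact Submodule.smul_mem _ _ (one_mem_WHom deg')
    · simpa using mul_mem_WHom (h x) (ht x)
    · have e : g f = coeff [] f • 1 + ∑ x, g (letter x) * g (tail x f) := by
        conv_lhs => rw [eq_sum_tail f]
        simp only [map_add, map_smul, map_sum, hg.map_mul, hg.map_one]
      rw [e, add_sub_add_left_eq_sub, ← Finset.sum_sub_distrib]
      refine (Fil Y _).sum_mem fun x _ => ?_
      rw [← mul_sub, add_comm]
      exact mul_mem_Fil (hg.map_mem (letter_mem x)) (htm x)

theorem IsHom.map_br [Fintype X] {deg : X → ℤ} {deg' : Y → ℤ} {g : Ser X →ₗ[ℚ] Ser Y}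
    (hg : IsHom g) (h : ∀ x, g (letter x) ∈ Hom deg' (deg x)) {p : ℤ} {f : Ser X}
    (hf : f ∈ Hom deg p) (f' : Ser X) : g (br deg f f') = br deg' (g f) (g f') := by
  rw [br_of_mem hf, br_of_mem (hg.map_Hom h hf), map_sub, hg.map_mul, hg.map_mul, hg.map_sgn h]

theorem IsHom.map_A [Fintype X] {deg : X → ℤ} {deg' : Y → ℤ} {g : Ser X →ₗ[ℚ] Ser Y}
    (hg : IsHom g) (h : ∀ x, g (letter x) ∈ Hom deg' (deg x)) {S : Set X} {S' : Set Y}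
    (hS : ∀ x ∈ S, g (letter x) ∈ Lie deg' S') {k : ℤ} {f : Ser X} (hf : f ∈ A deg S k) :
    g f ∈ A deg' S' k := by
  refine ⟨hg.map_Hom h hf.1, Lie_induction hg.pres closed_Lie (fun f hf => ?_) hf.2⟩
  induction hf with
  | gen x hx => exact hS x hx
  | bracket f f' hf _ ihf ihf' =>
    obtain ⟨p, hp⟩ := IsLieMonomial.exists_mem_WHom deg hf
    have := hg.map_br h (f := f) hp f'
    rw [show NC.bracket deg f f' = br deg f f' from rfl, this]
    exact br_mem_Lie ihf ihf'

theorem subst_mem_A [Fintype ι] {deg : X → ℤ} {S : Set X} {y : ι → Ser X}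
    (hy : ∀ i, y i ∈ A deg S 0) {k : ℤ} {P : Ser ι} (hP : P ∈ A (fun _ => 0) Set.univ k) :
    subst P y ∈ A deg S k := by
  have hy1 : ∀ i, y i ∈ Fil X 1 := fun i => A_mem_Fil (hy i)
  refine (isHom_subst hy1).map_A (fun i => ?_) (fun i _ => ?_) hP
  · rw [substL_apply, subst_letter hy1]; exact (hy i).1
  · rw [substL_apply, subst_letter hy1]; exact (hy i).2

end Ser

/-! ### Odd derivations of the associative algebra, and flows. -/

namespace Ser

variable {X Y Z ι : Type}

/-! ### The graded Lie algebra of Lie series -/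

theorem neg_one_zpow_eq_or (k : ℤ) : (-1 : ℚ) ^ k = 1 ∨ (-1 : ℚ) ^ k = -1 :=
  mul_self_eq_one_iff.mp (neg_one_zpow_mul_self k)

theorem isGradedLieAlgebra (deg : X → ℤ) :
    IsGradedLieAlgebra (V := Ser X) (fun k => A deg Set.univ k) (br deg) where
  independent := by
    intro i
    rw [Submodule.disjoint_def]
    intro x hx hx'
    -- `K` consists of the series without words of degree `i`. It contains all the other graded
    -- pieces and meets the piece of degree `i` only in zero.
    let K : Submodule ℚ (Ser X) :=
      { carrier := {f | ∀ w : List X, (w.map deg).sum = i → coeff w f = 0}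
        add_mem' := fun hf hg w hw => by rw [map_add, hf w hw, hg w hw, add_zero]
        zero_mem' := fun _ _ => rfl
        smul_mem' := fun c f hf w hw => by rw [map_smul, hf w hw, smul_zero] }
    have hK : (⨆ j, ⨆ (_ : j ≠ i), A deg Set.univ j) ≤ K := by
      refine iSup_le fun j => iSup_le fun hj f hf w hw => ?_
      by_contra h
      exact hj ((hf.1 w h).symm.trans hw)
    ext w
    by_contra h
    exact h (hK hx' w (hx.1 w h))
  bracket_mem p q x hx y hy := br_mem_A hx hy
  symmetry p q x hx y hy := by
    rw [br_of_mem_mem hx.1 hy.1, br_of_mem_mem hy.1 hx.1, mul_comm q p]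
    rcases neg_one_zpow_eq_or (p * q) with h | h <;> rw [h] <;> simp
  jacobi p q r x hx y hy z hz := by
    rw [br_of_mem_mem (br_mem_A hy hz).1 hx.1, br_of_mem_mem (br_mem_A hz hx).1 hy.1,
      br_of_mem_mem (br_mem_A hx hy).1 hz.1, br_of_mem_mem hy.1 hz.1, br_of_mem_mem hz.1 hx.1,
      br_of_mem_mem hx.1 hy.1]
    simp only [add_mul, zpow_add₀ (show (-1 : ℚ) ≠ 0 by norm_num)]
    rw [mul_comm q p, mul_comm r q, mul_comm p r]
    -- Only the parities of the three products of degrees enter; each of the eight cases is an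
    -- identity of associative rings.
    rcases neg_one_zpow_eq_or (p * q) with h | h <;>
    rcases neg_one_zpow_eq_or (q * r) with h' | h' <;>
    rcases neg_one_zpow_eq_or (r * p) with h'' | h'' <;>
    rw [h, h', h''] <;> simp <;> noncomm_ring

/-! ### Extension of maps on letters to odd derivations -/

section
variable [Fintype X] (deg : X → ℤ) (d : X → Ser X)

/-- The coefficients of `derivExt`. -/
def derivAux : List X → Ser X → ℚ
  | [], f => ∑ x, coeff [] (d x * tail x f)
  | y :: u, f => ∑ x, coeff (y :: u) (d x * tail x f) + (-1 : ℚ) ^ deg y * derivAux u (tail y f)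

theorem derivAux_add (w : List X) (f g : Ser X) :
    derivAux deg d w (f + g) = derivAux deg d w f + derivAux deg d w g := by
  induction w generalizing f g with
  | nil => simp [derivAux, mul_add, Finset.sum_add_distrib]
  | cons y u ih =>
    simp only [derivAux, map_add, mul_add, Finset.sum_add_distrib, ih]
    ring

theorem derivAux_smul (w : List X) (c : ℚ) (f : Ser X) :
    derivAux deg d w (c • f) = c * derivAux deg d w f := by
  induction w generalizing f with
  | nil => simp [derivAux, Finset.mul_sum]
  | cons y u ih =>
    simp only [derivAux, map_smul, mul_smul_comm, smul_eq_mul, ih, mul_add, Finset.mul_sum]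
    ring

/-- The odd derivation with given values on the letters. -/
def derivExt : Ser X →ₗ[ℚ] Ser X where
  toFun f := ofFun fun w => derivAux deg d w f
  map_add' f g := by ext w; exact derivAux_add deg d w f g
  map_smul' c f := by ext w; exact derivAux_smul deg d w c f

theorem coeff_derivExt (f : Ser X) (w : List X) :
    coeff w (derivExt deg d f) = derivAux deg d w f := rfl

/-- The graded Leibniz rule for `x * tail x f`, summed over `x`; `derivAux` is this rule read off
coefficient by coefficient. -/
theorem derivExt_rec (f : Ser X) : derivExt deg d f
    = ∑ x, d x * tail x f + ∑ x, (-1 : ℚ) ^ deg x • (letter x * derivExt deg d (tail x f)) := by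
  classical
  have h0 : ∀ (x : X), coeff [] (letter x) = 0 := fun x => mem_Fil_one.mp (letter_mem x)
  ext w
  rw [map_add, map_sum, map_sum, coeff_derivExt]
  cases w with
  | nil => simp [derivAux, h0]
  | cons y u =>
    rw [derivAux]
    congr 1
    rw [Finset.sum_eq_single y]
    · rw [map_smul, coeff_mul_cons, h0, zero_mul, zero_add, tail_letter, if_pos rfl, one_mul]
      rfl
    · intro x _ hx
      rw [map_smul, coeff_mul_cons, h0, zero_mul, zero_add, tail_letter, if_neg hx.symm]
      simp
    · simp

theorem derivExt_one : derivExt deg d 1 = 0 := by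
  rw [derivExt_rec]; simp

theorem derivExt_letter (x : X) : derivExt deg d (letter x) = d x := by
  classical
  rw [derivExt_rec, Finset.sum_eq_single x, Finset.sum_eq_zero]
  · rw [tail_letter, if_pos rfl, mul_one, add_zero]
  · intro y _
    rw [tail_letter]
    split_ifs
    · rw [derivExt_one]; simp
    · simp
  · intro y _ hy; rw [tail_letter, if_neg hy, mul_zero]
  · simp

variable {deg d}

/-- Derivations of degree `-1` of the graded algebra of series. -/
structure OddDer (deg : X → ℤ) (δ : Ser X →ₗ[ℚ] Ser X) : Prop where
  der : IsDer LinearMap.id (sgn deg 1) δ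
  lower : ∀ k, ∀ f ∈ Hom deg k, δ f ∈ Hom deg (k - 1)

omit [Fintype X] in
theorem tail_mem_Hom {f : Ser X} {k : ℤ} (hf : f ∈ Hom deg k) (x : X) :
    tail x f ∈ Hom deg (k - deg x) := fun w hw => by
  have := hf (x :: w) hw
  rw [List.map_cons, List.sum_cons] at this
  omega

/-- All three properties follow from `derivExt_rec` by induction on the filtration. -/
theorem oddDer_derivExt (h1 : ∀ x, d x ∈ Fil X 1) (h2 : ∀ x, d x ∈ Hom deg (deg x - 1)) :
    OddDer deg (derivExt deg d) where
  der :=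
  { pres := by
      intro m f hf
      induction m generalizing f with
      | zero => exact mem_Fil_zero _
      | succ m ih =>
        rw [derivExt_rec, add_comm m]
        refine (Fil X _).add_mem ((Fil X _).sum_mem fun x _ => ?_)
          ((Fil X _).sum_mem fun x _ => (Fil X _).smul_mem _ ?_)
        · exact mul_mem_Fil (h1 x) (tail_mem_Fil hf x)
        · exact mul_mem_Fil (letter_mem x) (ih _ (tail_mem_Fil hf x))
    leibniz := by
      intro f g
      rw [LinearMap.id_apply]
      refine eq_of_sub_mem_Fil fun m => ?_
      induction m generalizing f with
      | zero => exact mem_Fil_zero _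
      | succ m ih =>
        have e1 : derivExt deg d (f * g) = coeff [] f • derivExt deg d g
            + (∑ x, d x * tail x f) * g
            + ∑ x, (-1 : ℚ) ^ deg x • (letter x * derivExt deg d (tail x f * g)) := by
          rw [derivExt_rec, derivExt_rec deg d g]
          simp only [tail_mul, map_add, map_smul, _root_.mul_add, Finset.sum_add_distrib, smul_add,
            Finset.sum_mul, mul_assoc, Finset.smul_sum, mul_smul_comm, smul_smul, mul_comm (coeff [] f)]
          abel
        have e2 : sgn deg 1 f = coeff [] f • (1 : Ser X)
            + ∑ x, (-1 : ℚ) ^ deg x • (letter x * sgn deg 1 (tail x f)) := by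
          conv_lhs => rw [eq_sum_tail f]
          simp only [map_add, map_smul, map_sum, (isHom_sgn deg 1).map_mul,
            (isHom_sgn deg 1).map_one, sgn_of_mem (letter_mem_WHom deg _), one_mul, smul_mul_assoc]
        -- The failure of the Leibniz rule for `f` is a combination of letters times its failure for
        -- the tails of `f`, hence lies one step deeper in the filtration.
        have e3 : derivExt deg d (f * g) - (derivExt deg d f * g
            + sgn deg 1 f * derivExt deg d g)
            = ∑ x, (-1 : ℚ) ^ deg x • (letter x * (derivExt deg d (tail x f * g)
              - (derivExt deg d (tail x f) * g
                + sgn deg 1 (tail x f) * derivExt deg d g))) := by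
          rw [e1, e2, derivExt_rec deg d f]
          simp only [mul_sub, _root_.mul_add, _root_.add_mul, smul_sub,
            smul_add, Finset.sum_sub_distrib, Finset.sum_add_distrib, Finset.sum_mul,
            smul_mul_assoc, one_mul, mul_assoc]
          abel
        rw [e3]
        refine (Fil X _).sum_mem fun x _ => (Fil X _).smul_mem _ ?_
        rw [add_comm m]
        exact mul_mem_Fil (letter_mem x) (ih _) }
  lower := by
    intro k f hf
    refine closed_WHom deg _ _ fun m => ?_
    induction m generalizing f k with
    | zero => exact ⟨0, Submodule.zero_mem _, mem_Fil_zero _⟩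
    | succ m ih =>
      choose t ht htm using fun x => ih _ _ (tail_mem_Hom hf x)
      refine ⟨∑ x, d x * tail x f + ∑ x, (-1 : ℚ) ^ deg x • (letter x * t x),
        Submodule.add_mem _ (Submodule.sum_mem _ fun x _ => ?_)
          (Submodule.sum_mem _ fun x _ => Submodule.smul_mem _ _ ?_), ?_⟩
      · have := mul_mem_WHom (h2 x) (tail_mem_Hom hf x)
        rwa [show deg x - 1 + (k - deg x) = k - 1 by ring] at this
      · have := mul_mem_WHom (letter_mem_WHom deg x) (ht x)
        rwa [show deg x + (k - deg x - 1) = k - 1 by ring] at this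
      · rw [derivExt_rec, add_sub_add_left_eq_sub, ← Finset.sum_sub_distrib]
        refine (Fil X _).sum_mem fun x _ => ?_
        rw [← smul_sub, ← mul_sub, add_comm]
        exact (Fil X _).smul_mem _ (mul_mem_Fil (letter_mem x) (htm x))

namespace OddDer

variable {δ : Ser X →ₗ[ℚ] Ser X} (hδ : OddDer deg δ)
include hδ

omit [Fintype X] in
theorem leibniz_of_mem {p : ℤ} {f : Ser X} (hf : f ∈ Hom deg p) (g : Ser X) :
    δ (f * g) = δ f * g + (-1 : ℚ) ^ p • (f * δ g) := by
  rw [hδ.der.leibniz, sgn_of_mem hf, one_mul, smul_mul_assoc]; rfl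

omit [Fintype X] in
theorem leibniz_br {p q : ℤ} {f g : Ser X} (hf : f ∈ Hom deg p) (hg : g ∈ Hom deg q) :
    δ (br deg f g) = br deg (δ f) g + (-1 : ℚ) ^ p • br deg f (δ g) := by
  rw [br_of_mem_mem hf hg, br_of_mem_mem (hδ.lower _ _ hf) hg,
    br_of_mem_mem hf (hδ.lower _ _ hg), map_sub, map_smul, hδ.leibniz_of_mem hf,
    hδ.leibniz_of_mem hg, mul_sub, sub_mul, mul_one, one_mul, zpow_sub₀ (by norm_num),
    zpow_sub₀ (by norm_num)]
  rcases neg_one_zpow_eq_or (p * q) with h | h <;>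
  rcases neg_one_zpow_eq_or p with h' | h' <;>
  rcases neg_one_zpow_eq_or q with h'' | h'' <;>
  rw [h, h', h''] <;> simp <;> noncomm_ring

omit [Fintype X] in
theorem map_A {S S' : Set X} (hSS' : S ⊆ S') (h : ∀ x ∈ S, δ (letter x) ∈ Lie deg S') {k : ℤ}
    {f : Ser X} (hf : f ∈ A deg S k) : δ f ∈ A deg S' (k - 1) := by
  refine ⟨hδ.lower _ _ hf.1, Lie_induction hδ.der.pres closed_Lie (fun f hf => ?_) hf.2⟩
  induction hf with
  | gen x hx => exact h x hx
  | bracket f g hf hg ihf ihg =>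
    obtain ⟨p, hp⟩ := IsLieMonomial.exists_mem_WHom deg hf
    obtain ⟨q, hq⟩ := IsLieMonomial.exists_mem_WHom deg hg
    have hf' : (f : Ser X) ∈ Lie deg S' :=
      Lie_mono hSS' (LieSpan_le_Lie (Submodule.subset_span hf))
    have hg' : (g : Ser X) ∈ Lie deg S' :=
      Lie_mono hSS' (LieSpan_le_Lie (Submodule.subset_span hg))
    rw [show NC.bracket deg f g = br deg f g from rfl, hδ.leibniz_br hp hq]
    exact Submodule.add_mem _ (br_mem_Lie ihf hg') (Submodule.smul_mem _ _ (br_mem_Lie hf' ihg))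

/-- Odd derivations anticommute with the sign. -/
theorem sgn_comm (f : Ser X) : sgn deg 1 (δ f) = -δ (sgn deg 1 f) := by
  have hs := isHom_sgn deg 1
  -- The anticommutator is again a twisted derivation, with the two twists exchanged, so it may be
  -- tested on letters.
  have h : IsDer (sgn deg 1) LinearMap.id (sgn deg 1 ∘ₗ δ + δ ∘ₗ sgn deg 1) :=
    { pres := (hs.pres.comp hδ.der.pres).add (hδ.der.pres.comp hs.pres)
      leibniz := fun f g => by
        simp only [LinearMap.add_apply, LinearMap.comp_apply, hδ.der.leibniz, map_add, hs.map_mul,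
          sgn_sgn, LinearMap.id_apply]
        noncomm_ring }
  have h0 := h.eq_zero_of_letters hs isHom_id fun x => by
    have hx := letter_mem_WHom deg x
    rw [LinearMap.add_apply, LinearMap.comp_apply, LinearMap.comp_apply,
      sgn_of_mem (hδ.lower _ _ hx), sgn_of_mem hx, map_smul, one_mul, one_mul,
      zpow_sub₀ (by norm_num)]
    rcases neg_one_zpow_eq_or (deg x) with h | h <;> rw [h] <;> simp
  exact eq_neg_of_add_eq_zero_left (LinearMap.congr_fun h0 f)

/-- The mixed terms cancel by `sgn_comm`, so the square is an ordinary derivation. This reduces `∂²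
= 0` to the generators. -/
theorem isDer_sq : IsDer LinearMap.id LinearMap.id (δ ∘ₗ δ) where
  pres := hδ.der.pres.comp hδ.der.pres
  leibniz f g := by
    simp only [LinearMap.comp_apply, hδ.der.leibniz, map_add, LinearMap.id_apply, sgn_sgn,
      hδ.sgn_comm]
    noncomm_ring

end OddDer

/-- A derivation of the Lie algebra of Lie series is the restriction of the odd derivation of the
algebra of series with the same values on the letters. -/
theorem eq_derivExt {D : Ser X →ₗ[ℚ] Ser X}
    (hD : IsGradedDerivation (fun k => A deg Set.univ k) (br deg) D)
    (hfil : ∀ k : ℤ, ∀ z ∈ A deg Set.univ k, ∀ m, z ∈ Fil X m → D z ∈ Fil X m) :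
    OddDer deg (derivExt deg fun x => D (letter x)) ∧
    ∀ k, ∀ z ∈ A deg Set.univ k, D z = derivExt deg (fun x => D (letter x)) z := by
  have hl : ∀ x, D (letter x) ∈ A deg Set.univ (deg x - 1) := fun x =>
    hD.mem _ _ (letter_mem_A (Set.mem_univ x))
  have hE := oddDer_derivExt (d := fun x => D (letter x)) (fun x => A_mem_Fil (hl x))
    fun x => (hl x).1
  refine ⟨hE, fun k z hz => ?_⟩
  have hmon : ∀ f : Ser X, IsLieMonomial deg Set.univ f →
      D f = derivExt deg (fun x => D (letter x)) f := by
    intro f hf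
    induction hf with
    | gen x hx => exact (derivExt_letter deg (fun x => D (letter x)) x).symm
    | bracket f g hf hg ihf ihg =>
      obtain ⟨p, hp⟩ := IsLieMonomial.exists_mem_WHom deg hf
      obtain ⟨q, hq⟩ := IsLieMonomial.exists_mem_WHom deg hg
      have hfA : (f : Ser X) ∈ A deg Set.univ p :=
        ⟨hp, LieSpan_le_Lie (Submodule.subset_span hf)⟩
      have hgA : (g : Ser X) ∈ A deg Set.univ q :=
        ⟨hq, LieSpan_le_Lie (Submodule.subset_span hg)⟩
      rw [show NC.bracket deg f g = br deg f g from rfl, hE.leibniz_br hp hq, ← ihf, ← ihg]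
      exact hD.leibniz p q f hfA g hgA
  have hspan : ∀ z ∈ LieSpan deg Set.univ, D z = derivExt deg (fun x => D (letter x)) z := by
    have h : LieSpan deg Set.univ ≤
        LinearMap.ker (D - derivExt deg fun x => D (letter x)) :=
      Submodule.span_le.mpr fun f hf => by
        rw [SetLike.mem_coe, LinearMap.mem_ker, LinearMap.sub_apply, hmon f hf, sub_self]
    intro z hz
    have := h hz
    rwa [LinearMap.mem_ker, LinearMap.sub_apply, sub_eq_zero] at this
  refine eq_of_sub_mem_Fil fun m => ?_
  -- Agreement is known on finite combinations of monomials. The hypothesis that `D` does not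
  -- decrease the number of brackets controls the remainder, which is still a Lie series.
  have hs : ∑ j ∈ range m, part j z ∈ LieSpan deg Set.univ :=
    Submodule.sum_mem _ fun j _ => hz.2 j
  have hr := sub_sum_part_mem z m
  have hrA : z - ∑ j ∈ range m, part j z ∈ A deg Set.univ k :=
    Submodule.sub_mem _ hz (Submodule.sum_mem _ fun j _ => scale_mem_A _ hz)
  have e : D z - derivExt deg (fun x => D (letter x)) z
      = D (z - ∑ j ∈ range m, part j z)
        - derivExt deg (fun x => D (letter x)) (z - ∑ j ∈ range m, part j z) := by
    rw [map_sub, map_sub, hspan _ hs]; abel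
  rw [e]
  exact (Fil X m).sub_mem (hfil k _ hrA m hr) (hE.der.pres m _ hr)

end

/-! ### Flows -/

section
variable {deg : X → ℤ} {δ : Ser X →ₗ[ℚ] Ser X}

/-- The result of flowing from `a` by `e`. -/
def flow (δ : Ser X →ₗ[ℚ] Ser X) (e a : Ser X) : Ser X :=
  opS expNegS (ad e) a + opS flowS (ad e) (δ e)

theorem IsDer.map_exp_even (hδ : IsDer LinearMap.id (sgn deg 1) δ) {e : Ser X}
    (he1 : e ∈ Fil X 1) (he : e ∈ Hom deg 0) :
    δ (exp e) = exp e * opS flowS (ad e) (δ e) :=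
  hδ.map_exp isHom_id (isHom_sgn deg 1) he1 (sgn_even he 1).symm

theorem IsDer.map_exp_eq_zero (hδ : IsDer LinearMap.id (sgn deg 1) δ) {e : Ser X}
    (he1 : e ∈ Fil X 1) (he : e ∈ Hom deg 0) : δ (exp e) = 0 ↔ δ e = 0 := by
  rw [hδ.map_exp_even he1 he]
  refine ⟨fun h => ?_, fun h => by rw [h, map_zero, mul_zero]⟩
  have := congrArg (fun z => opS bernS (ad e) (exp (-e) * z)) h
  simpa [← mul_assoc, exp_neg_mul_exp he1, opS_bern_flow (raises_ad he1)] using this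

theorem flow_eq (hδ : IsDer LinearMap.id (sgn deg 1) δ) {e : Ser X} (he1 : e ∈ Fil X 1)
    (he : e ∈ Hom deg 0) (a : Ser X) :
    flow δ e a = exp (-e) * a * exp e + exp (-e) * δ (exp e) := by
  rw [flow, opS_expNeg_ad he1, hδ.map_exp_even he1 he, ← mul_assoc (exp (-e)),
    exp_neg_mul_exp he1, one_mul]

/-- The gauge action in multiplicative form. It contains no series in `ad`, so that composing and
reversing flows becomes the Leibniz rule for products of exponentials. -/
theorem flow_eq_iff (hδ : IsDer LinearMap.id (sgn deg 1) δ) {e : Ser X} (he1 : e ∈ Fil X 1)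
    (he : e ∈ Hom deg 0) {a b : Ser X} :
    flow δ e a = b ↔ δ (exp e) = exp e * b - a * exp e := by
  rw [flow_eq hδ he1 he]
  constructor
  · rintro rfl
    rw [mul_add, ← mul_assoc, ← mul_assoc, ← mul_assoc, exp_mul_exp_neg he1, one_mul, one_mul,
      add_sub_cancel_left]
  · intro h
    rw [h, mul_sub, ← mul_assoc, exp_neg_mul_exp he1, one_mul, ← mul_assoc, add_sub_cancel]

theorem flow_bch (hδ : IsDer LinearMap.id (sgn deg 1) δ) {S : Set X} {e e' : Ser X}
    (he : e ∈ A deg S 0) (he' : e' ∈ A deg S 0) (a : Ser X) :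
    flow δ (bch e e') a = flow δ e' (flow δ e a) := by
  have h1 := A_mem_Fil he
  have h1' := A_mem_Fil he'
  have hb := bch_mem_A he he'
  have E := (flow_eq_iff hδ h1 he.1 (a := a)).mp rfl
  have E' := (flow_eq_iff hδ h1' he'.1 (a := flow δ e a)).mp rfl
  rw [flow_eq_iff hδ (A_mem_Fil hb) hb.1, exp_bch h1 h1', hδ.leibniz, E, E',
    sgn_even (exp_mem_Hom h1 he.1), LinearMap.id_apply]
  noncomm_ring

/-- Apply `δ` to `exp (-e) * exp e = 1` and solve for `δ (exp (-e))`. -/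
theorem flow_neg (hδ : IsDer LinearMap.id (sgn deg 1) δ) {e : Ser X} (he1 : e ∈ Fil X 1)
    (he : e ∈ Hom deg 0) (a : Ser X) : flow δ (-e) (flow δ e a) = a := by
  have E := (flow_eq_iff hδ he1 he (a := a)).mp rfl
  have h1 : δ 1 = 0 := hδ.map_one isHom_id.map_one (isHom_sgn deg 1).map_one
  have h2 := congrArg δ (exp_neg_mul_exp he1)
  have hne := (Hom deg 0).neg_mem he
  rw [hδ.leibniz, sgn_even (exp_mem_Hom ((Fil X 1).neg_mem he1) hne), LinearMap.id_apply, h1, E]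
    at h2
  rw [flow_eq_iff hδ ((Fil X 1).neg_mem he1) hne]
  have h3 := congrArg (fun z => z * exp (-e)) h2
  simp only [add_mul, mul_sub, sub_mul, zero_mul, mul_assoc, exp_mul_exp_neg he1, mul_one] at h3
  rw [← mul_assoc (exp (-e)) (exp e), exp_neg_mul_exp he1, one_mul] at h3
  rw [eq_sub_iff_add_eq]
  rw [← sub_eq_zero, ← h3]
  abel

/-- `ad_a` for `a` of degree `-1`. -/
theorem isDer_br {a : Ser X} (ha : a ∈ Hom deg (-1)) :
    IsDer LinearMap.id (sgn deg 1) (br deg a) where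
  pres m z hz := by simpa using br_mem_Fil (mem_Fil_zero a) hz
  leibniz f g := by
    have : ∀ f : Ser X, sgn deg (-1) f = sgn deg 1 f := fun f => by
      ext w; rw [coeff_sgn, coeff_sgn]; congr 1
      rw [neg_one_mul, one_mul, zpow_neg]
      rcases neg_one_zpow_eq_or (wdeg deg w) with h | h <;> rw [h] <;> norm_num
    simp only [br_of_mem ha, this, (isHom_sgn deg 1).map_mul, LinearMap.id_apply]
    noncomm_ring

theorem IsDer.add {φ ψ δ δ' : Ser X →ₗ[ℚ] Ser Y} (h : IsDer φ ψ δ) (h' : IsDer φ ψ δ') :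
    IsDer φ ψ (δ + δ') where
  pres := h.pres.add h'.pres
  leibniz f g := by
    simp only [LinearMap.add_apply, h.leibniz, h'.leibniz]; noncomm_ring

theorem br_exp_of_even {a e : Ser X} (ha : a ∈ Hom deg (-1)) (he1 : e ∈ Fil X 1)
    (he : e ∈ Hom deg 0) : br deg a (exp e) = a * exp e - exp e * a :=
  br_even' ha (exp_mem_Hom he1 he)

theorem IsDer.map_ad (hδ : IsDer LinearMap.id (sgn deg 1) δ) {y : Ser X} (hy : y ∈ Hom deg 0)
    (h0 : δ y = 0) (z : Ser X) : δ (ad y z) = ad y (δ z) := by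
  rw [ad_apply, ad_apply, map_sub, hδ.leibniz, hδ.leibniz, h0, sgn_even hy]
  simp

theorem IsDer.map_opW_ad [Fintype ι] (hδ : IsDer LinearMap.id (sgn deg 1) δ) {y : ι → Ser X}
    (hy : ∀ i, y i ∈ Hom deg 0) (hy1 : ∀ i, y i ∈ Fil X 1) (h0 : ∀ i, δ (y i) = 0) (P : Ser ι)
    (z : Ser X) : δ (opW P (fun i => ad (y i)) z) = opW P (fun i => ad (y i)) (δ z) :=
  map_opW (fun i => raises_ad (hy1 i)) (fun i => raises_ad (hy1 i))
    (fun i z => hδ.map_ad (hy i) (h0 i) z) P z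

end

end Ser

/-! ### Dictionary between the operations on coefficient families and those of the ring. -/

namespace Ser

variable {X Y Z ι : Type}

/-! ### Comparison with the operations on families of coefficients -/

/-- A family of coefficients, as an element of the algebra of series. -/
def toSer : NC X →ₗ[ℚ] Ser X where
  toFun f := f
  map_add' _ _ := rfl
  map_smul' _ _ := rfl

theorem coeff_toSer (f : NC X) (w : List X) : coeff w (toSer f) = f w := rfl

theorem toSer_injective : Function.Injective (toSer : NC X → Ser X) := fun _ _ h => h

theorem toSer_mul (f g : NC X) : toSer (NC.mul f g) = toSer f * toSer g := rfl

theorem toSer_var (x : X) : toSer (NC.var x) = letter x := rfl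

theorem toSer_bracket (deg : X → ℤ) (f g : NC X) :
    toSer (NC.bracket deg f g) = br deg (toSer f) (toSer g) := rfl

/-- A linear map on families of coefficients, as a linear map on series. -/
def serMap (D : NC X →ₗ[ℚ] NC Y) : Ser X →ₗ[ℚ] Ser Y where
  toFun f := toSer (D f)
  map_add' f g := D.map_add f g
  map_smul' c f := D.map_smul c f

theorem toSer_map (D : NC X →ₗ[ℚ] NC Y) (f : NC X) : toSer (D f) = serMap D (toSer f) := rfl

theorem toSer_pow (f : NC X) (k : ℕ) : toSer (NC.pow f k) = toSer f ^ k := by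
  induction k with
  | zero => rfl
  | succ k ih => rw [pow_succ', ← ih]; rfl

theorem toSer_exp (f : NC X) : toSer (NC.exp f) = exp (toSer f) := by
  ext w
  rw [exp, opS_apply, coeff_ser, coeff_toSer, NC.exp]
  refine Finset.sum_congr rfl fun k _ => ?_
  rw [L_pow_one, ← toSer_pow, map_smul, PowerSeries.coeff_exp, smul_eq_mul, div_eq_mul_inv,
    mul_comm, coeff_toSer]
  simp

theorem toSer_log (f : NC X) : toSer (NC.log f) = log (toSer f) := by
  ext w
  rw [log, opS_apply, coeff_ser, coeff_toSer, NC.log, Finset.range_eq_Ico,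
    Finset.sum_eq_sum_Ico_succ_bot (by omega)]
  simp only [L_pow_one, map_smul, PowerSeries.coeff_log]
  rw [if_pos trivial, zero_smul, zero_add]
  refine Finset.sum_congr rfl fun k hk => ?_
  rw [Finset.mem_Ico] at hk
  rw [if_neg (by omega), show toSer f - 1 = toSer (f - NC.one) from rfl, ← toSer_pow, coeff_toSer]
  rfl

theorem toSer_bch (f g : NC X) : toSer (NC.bch f g) = bch (toSer f) (toSer g) := by
  rw [bch, NC.bch, toSer_log, toSer_mul, toSer_exp, toSer_exp]

/-- The sum over the words of length `k`. -/
def wsum [Fintype ι] : ℕ → (List ι → ℚ) → ℚ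
  | 0, F => F []
  | k + 1, F => ∑ i, wsum k fun w => F (i :: w)

/-- A word is empty or consists of a first letter and a word. -/
def optionEquivList : Option (ι × List ι) ≃ List ι where
  toFun | none => [] | some (i, w) => i :: w
  invFun | [] => none | i :: w => some (i, w)
  left_inv o := by rcases o with _ | ⟨i, w⟩ <;> rfl
  right_inv w := by cases w <;> rfl

/-- The vanishing on long words makes the support finite, since there are finitely many words of
bounded length; otherwise `finsum` would take its default value `0`. -/
theorem finsum_eq_wsum [Fintype ι] (N : ℕ) (F : List ι → ℚ) (hF : ∀ w, N ≤ w.length → F w = 0) :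
    ∑ᶠ w, F w = ∑ k ∈ range N, wsum k F := by
  induction N generalizing F with
  | zero => simp [hF]
  | succ N ih =>
    have hfin : F.support.Finite := (List.finite_length_lt ι (N + 1)).subset fun w hw => by
      by_contra h
      exact hw (hF w (by simpa using h))
    have h2 : Function.HasFiniteSupport fun p : ι × List ι => F (p.1 :: p.2) :=
      Set.Finite.preimage (f := fun p : ι × List ι => p.1 :: p.2) (fun p _ q _ h => by
        simp only [List.cons.injEq] at h; exact Prod.ext h.1 h.2) hfin
    rw [← finsum_comp_equiv optionEquivList, finsum_option h2, Finset.sum_range_succ', add_comm]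
    congr 1
    rw [show (∑ᶠ p : ι × List ι, F (optionEquivList (some p)))
      = ∑ᶠ i, ∑ᶠ w, F (i :: w) from finsum_curry _ h2, finsum_eq_sum_of_fintype]
    simp only [wsum]
    rw [Finset.sum_comm]
    exact Finset.sum_congr rfl fun i _ => ih _ fun w hw => hF _ (by simpa using hw)

/-- The product of operators along a word. -/
def wordOp (T : ι → Module.End ℚ (Ser X)) : List ι → Module.End ℚ (Ser X)
  | [] => 1
  | i :: w => T i * wordOp T w

theorem level_eq_wsum [Fintype ι] (T : ι → Module.End ℚ (Ser X)) (k : ℕ) (P : Ser ι) (z : Ser X)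
    (g : Ser X →ₗ[ℚ] ℚ) : g (level T k P z) = wsum k fun w => coeff w P * g (wordOp T w z) := by
  induction k generalizing P g with
  | zero => simp [level, wsum, wordOp]
  | succ k ih =>
    simp only [level, wsum, wordOp, LinearMap.sum_apply, map_sum]
    refine Finset.sum_congr rfl fun i _ => ?_
    exact ih (tail i P) (g ∘ₗ T i)

theorem wordOp_mem {T : ι → Module.End ℚ (Ser X)} (hT : ∀ i, Raises (T i)) (w : List ι)
    (z : Ser X) : wordOp T w z ∈ Fil X w.length := by
  induction w with
  | nil => exact mem_Fil_zero _
  | cons i w ih => exact hT i _ _ ih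

theorem coeff_opW_eq_finsum [Fintype ι] {T : ι → Module.End ℚ (Ser X)} (hT : ∀ i, Raises (T i))
    (P : Ser ι) (z : Ser X) (u : List X) :
    coeff u (opW P T z) = ∑ᶠ w : List ι, coeff w P * coeff u (wordOp T w z) := by
  rw [finsum_eq_wsum (u.length + 1), opW_apply, coeff_ser]
  · exact Finset.sum_congr rfl fun k _ => level_eq_wsum T k P z (coeff u)
  · intro w hw
    rw [wordOp_mem hT w z u (by omega), mul_zero]

theorem toSer_subst [Fintype ι] (P : NC ι) {y : ι → NC X} (hy : ∀ i, toSer (y i) ∈ Fil X 1) :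
    toSer (NC.subst P y) = subst (toSer P) fun i => toSer (y i) := by
  ext u
  rw [subst, coeff_opW_eq_finsum fun i => raises_L (hy i), coeff_toSer, NC.subst]
  refine finsum_congr fun w => ?_
  have : wordOp (fun i => L (toSer (y i))) w 1 = toSer (NC.prodWord y w) := by
    induction w with
    | nil => rfl
    | cons i w ih => rw [wordOp, Module.End.mul_apply, ih]; rfl
  rw [this, coeff_toSer]; rfl

section
variable {deg : X → ℤ}

theorem toSer_iterate {e : NC X} (he : toSer e ∈ Hom deg 0) (k : ℕ) (z : NC X) :
    toSer ((NC.bracket deg e)^[k] z) = (ad (toSer e) ^ k) (toSer z) := by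
  rw [Module.End.pow_apply]
  induction k with
  | zero => rfl
  | succ k ih =>
    rw [Function.iterate_succ_apply', Function.iterate_succ_apply', ← ih, ← br_even he]; rfl

theorem toSer_adSeries (c : ℕ → ℚ) {e : NC X} (he : toSer e ∈ Hom deg 0) (z : NC X) :
    toSer (NC.adSeries deg c e z) = opS (PowerSeries.mk c) (ad (toSer e)) (toSer z) := by
  ext w
  rw [opS_apply, coeff_ser, coeff_toSer, NC.adSeries]
  refine Finset.sum_congr rfl fun k _ => ?_
  rw [PowerSeries.coeff_mk, ← toSer_iterate he]
  rfl

theorem toSer_expAd {e : NC X} (he1 : toSer e ∈ Fil X 1) (he : toSer e ∈ Hom deg 0) (z : NC X) :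
    toSer (NC.expAd deg e z) = exp (toSer e) * toSer z * exp (-toSer e) := by
  rw [← opS_exp_ad he1, NC.expAd, toSer_adSeries _ he]
  congr 3

theorem toSer_act [Fintype ι] (P : NC ι) {y : ι → NC X} (hy1 : ∀ i, toSer (y i) ∈ Fil X 1)
    (hy : ∀ i, toSer (y i) ∈ Hom deg 0) (z : NC X) :
    toSer (NC.act deg P y z) = opW (toSer P) (fun i => ad (toSer (y i))) (toSer z) := by
  ext u
  rw [coeff_opW_eq_finsum fun i => raises_ad (hy1 i), coeff_toSer, NC.act]
  refine finsum_congr fun w => ?_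
  have : wordOp (fun i => ad (toSer (y i))) w (toSer z) = toSer (NC.adWord deg y z w) := by
    induction w with
    | nil => rfl
    | cons i w ih => rw [wordOp, Module.End.mul_apply, ih, ← br_even (hy i)]; rfl
  rw [this]; rfl

theorem toSer_flow (D : NC X →ₗ[ℚ] NC X) {e : NC X} (he : toSer e ∈ Hom deg 0) (a : NC X) :
    toSer (NC.flow deg D e a) = flow (serMap D) (toSer e) (toSer a) := by
  rw [flow, show expNegS = PowerSeries.mk fun k => (-1 : ℚ) ^ k / (k.factorial : ℚ) from
    PowerSeries.ext fun k => by rw [coeff_expNegS, PowerSeries.coeff_mk], flowS,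
    ← toSer_adSeries _ he, ← toSer_map, ← toSer_adSeries _ he]
  rfl

theorem mem_lieSeriesOn {S : Set X} {k : ℤ} {z : NC X} :
    z ∈ NC.lieSeriesOn deg S k ↔ toSer z ∈ A deg S k := by
  have h : ∀ m, toSer (NC.lengthPart m z) = part m (toSer z) := fun m => by
    ext w
    rw [coeff_part]; rfl
  refine and_congr Iff.rfl (forall_congr' fun m => ?_)
  rw [← h]
  rfl

theorem mem_lieSeries {k : ℤ} {z : NC X} :
    z ∈ NC.lieSeries deg k ↔ toSer z ∈ A deg Set.univ k := mem_lieSeriesOn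

end

/-- The iterated Baker-Campbell-Hausdorff series. -/
def bchList : List (Ser X) → Ser X
  | [] => 0
  | f :: l => bch f (bchList l)

theorem toSer_bchList (l : List (NC X)) : toSer (NC.bchList l) = bchList (l.map toSer) := by
  induction l with
  | nil => rfl
  | cons f l ih => rw [NC.bchList, toSer_bch, ih]; rfl

theorem bchList_mem {l : List (Ser X)} (h : ∀ f ∈ l, f ∈ Fil X 1) : bchList l ∈ Fil X 1 := by
  induction l with
  | nil => exact (Fil X 1).zero_mem
  | cons f l ih => exact bch_mem (h f (by simp)) (ih fun g hg => h g (by simp [hg]))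

theorem exp_bchList {l : List (Ser X)} (h : ∀ f ∈ l, f ∈ Fil X 1) :
    exp (bchList l) = (l.map exp).prod := by
  induction l with
  | nil => exact exp_zero
  | cons f l ih =>
    have hl : ∀ g ∈ l, g ∈ Fil X 1 := fun g hg => h g (by simp [hg])
    rw [bchList, exp_bch (h f (by simp)) (bchList_mem hl), ih hl, List.map_cons, List.prod_cons]

theorem bchList_mem_A {deg : X → ℤ} {S : Set X} {l : List (Ser X)} (h : ∀ f ∈ l, f ∈ A deg S 0) :
    bchList l ∈ A deg S 0 := by
  induction l with
  | nil => exact (A deg S 0).zero_mem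
  | cons f l ih => exact bch_mem_A (h f (by simp)) (ih fun g hg => h g (by simp [hg]))

theorem IsHom.map_bchList {g : Ser X →ₗ[ℚ] Ser Y} (hg : IsHom g) {l : List (Ser X)}
    (h : ∀ f ∈ l, f ∈ Fil X 1) : g (bchList l) = bchList (l.map g) := by
  induction l with
  | nil => exact map_zero g
  | cons f l ih =>
    have hl : ∀ g ∈ l, g ∈ Fil X 1 := fun g hg => h g (by simp [hg])
    rw [bchList, hg.map_bch (h f (by simp)) (bchList_mem hl), ih hl, List.map_cons, bchList]

end Ser

/-! ### Extension of derivations of Lie series; the barycentre is a universal average. -/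

namespace Ser

variable {X Y Z ι : Type}

/-! ### Restriction of derivations -/

section
variable {deg : X → ℤ}

theorem isGradedDerivation_serMap {D : NC X →ₗ[ℚ] NC X}
    (h : IsGradedDerivation (NC.lieSeries deg) (NC.bracket deg) D) :
    IsGradedDerivation (fun k => A deg Set.univ k) (br deg) (serMap D) where
  mem p x hx := mem_lieSeries.mp (h.mem p x (mem_lieSeries.mpr hx))
  leibniz p q x hx y hy := h.leibniz p q x (mem_lieSeries.mpr hx) y (mem_lieSeries.mpr hy)

/-- The odd derivation of the algebra of series that extends a derivation of Lie series. -/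
def extend [Fintype X] (deg : X → ℤ) (D : NC X →ₗ[ℚ] NC X) : Ser X →ₗ[ℚ] Ser X :=
  derivExt deg fun x => toSer (D (NC.var x))

theorem extend_spec [Fintype X] {D : NC X →ₗ[ℚ] NC X}
    (h : IsGradedDerivation (NC.lieSeries deg) (NC.bracket deg) D)
    (hfil : PreservesBracketFiltration deg D) :
    OddDer deg (extend deg D) ∧
      ∀ k, ∀ z : NC X, toSer z ∈ A deg Set.univ k → toSer (D z) = extend deg D (toSer z) := by
  obtain ⟨h1, h2⟩ := eq_derivExt (isGradedDerivation_serMap h) fun k z hz m hm w hw =>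
    hfil k z (mem_lieSeries.mpr hz) m hm w hw
  exact ⟨h1, fun k z hz => h2 k (toSer z) hz⟩

theorem toSer_flow_extend [Fintype X] {D : NC X →ₗ[ℚ] NC X}
    (h : IsGradedDerivation (NC.lieSeries deg) (NC.bracket deg) D)
    (hfil : PreservesBracketFiltration deg D) {e : NC X} (he : toSer e ∈ A deg Set.univ 0)
    (a : NC X) : toSer (NC.flow deg D e a) = flow (extend deg D) (toSer e) (toSer a) := by
  rw [toSer_flow D he.1, flow, flow, ← (extend_spec h hfil).2 0 e he]; rfl

end

/-! ### The barycentre -/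

/-- To first order, `bch` is addition. This estimate gives both the contraction property of
`baryStep` and the linear parts of the boundary formulae. -/
theorem bch_sub_bch_mem {f f' g g' : Ser X} {m : ℕ} (hf : f ∈ Fil X 1) (hf' : f' ∈ Fil X 1)
    (hg : g ∈ Fil X 1) (hg' : g' ∈ Fil X 1) (h : f - f' ∈ Fil X m) (h' : g - g' ∈ Fil X m) :
    bch f g - bch f' g' - ((f - f') + (g - g')) ∈ Fil X (m + 1) := by
  have e1 := exp_sub_exp_mem hf hf' h
  have e2 := exp_sub_exp_mem hg hg' h'
  have key : exp f * exp g - exp f' * exp g' - ((f - f') + (g - g')) ∈ Fil X (m + 1) := by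
    have : exp f * exp g - exp f' * exp g' - ((f - f') + (g - g'))
        = (exp f - exp f' - (f - f')) * exp g + (f - f') * (exp g - 1)
          + exp f' * (exp g - exp g' - (g - g')) + (exp f' - 1) * (g - g') := by noncomm_ring
    rw [this]
    refine (Fil X _).add_mem ((Fil X _).add_mem ((Fil X _).add_mem (mul_mem_Fil_left _ e1)
      (mul_mem_Fil h (exp_sub_mem hg))) (mul_mem_Fil_right _ e2)) ?_
    rw [add_comm]; exact mul_mem_Fil (exp_sub_mem hf') h'
  have hd : exp f * exp g - exp f' * exp g' ∈ Fil X m := by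
    have := (Fil X m).add_mem (Fil_mono (Nat.le_succ m) key) ((Fil X m).add_mem h h')
    simpa using this
  have hl := log_sub_log_mem (mul_sub_one_mem (exp_sub_mem hf) (exp_sub_mem hg))
    (mul_sub_one_mem (exp_sub_mem hf') (exp_sub_mem hg')) hd
  simpa [bch] using (Fil X _).add_mem hl key

theorem bch_zero {f : Ser X} (hf : f ∈ Fil X 1) : bch f 0 = f := by
  rw [bch, exp_zero, mul_one, log_exp hf]

theorem neg_bch {f g : Ser X} (hf : f ∈ Fil X 1) (hg : g ∈ Fil X 1) :
    -bch f g = bch (-g) (-f) := by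
  have hf' := (Fil X 1).neg_mem hf
  have hg' := (Fil X 1).neg_mem hg
  have hb := bch_mem hf hg
  refine exp_injective ((Fil X 1).neg_mem hb) (bch_mem hg' hf') ?_
  have h : exp f * exp g * (exp (-g) * exp (-f)) = 1 := by
    rw [show exp f * exp g * (exp (-g) * exp (-f)) = exp f * (exp g * exp (-g)) * exp (-f) by
      noncomm_ring, exp_mul_exp_neg hg, mul_one, exp_mul_exp_neg hf]
  rw [exp_bch hg' hf']
  calc exp (-bch f g) = exp (-bch f g) * (exp f * exp g * (exp (-g) * exp (-f))) := by
        rw [h, mul_one]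
    _ = exp (-bch f g) * exp (bch f g) * (exp (-g) * exp (-f)) := by
        rw [exp_bch hf hg]; noncomm_ring
    _ = exp (-g) * exp (-f) := by rw [exp_neg_mul_exp hb, one_mul]

/-- Exponentials are compatible with conjugation. -/
theorem exp_conj {u v f : Ser X} (h : v * u = 1) (h' : u * v = 1) (hf : f ∈ Fil X 1) :
    exp (u * f * v) = u * exp f * v := by
  have := (isHom_conj h h').map_exp hf
  simpa [Module.End.mul_apply, ← mul_assoc] using this.symm

theorem conj_mem (u v : Ser X) {f : Ser X} {m : ℕ} (hf : f ∈ Fil X m) : u * f * v ∈ Fil X m :=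
  mul_mem_Fil_left v (mul_mem_Fil_right u hf)

/-- `exp g * exp f` is the conjugate of `exp f * exp g` by `exp g`. -/
theorem bch_comm_conj {f g : Ser X} (hf : f ∈ Fil X 1) (hg : g ∈ Fil X 1) :
    bch g f = exp g * bch f g * exp (-g) := by
  have hb := bch_mem hf hg
  refine exp_injective (bch_mem hg hf) (conj_mem _ _ hb) ?_
  rw [exp_conj (exp_neg_mul_exp hg) (exp_mul_exp_neg hg) hb, exp_bch hf hg, exp_bch hg hf,
    mul_assoc (exp g), mul_assoc (exp f), exp_mul_exp_neg hg, mul_one]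

section
variable [Fintype ι]

/-- The map of which the barycentre is a fixed point. -/
def baryStep (y : Ser ι) : Ser ι :=
  bch y ((1 / (Fintype.card ι : ℚ)) • ∑ i : ι, bch (-y) (letter i))

theorem baryStep_aux_mem {y : Ser ι} (hy : y ∈ Fil ι 1) :
    (1 / (Fintype.card ι : ℚ)) • ∑ i : ι, bch (-y) (letter i) ∈ Fil ι 1 :=
  (Fil ι 1).smul_mem _ ((Fil ι 1).sum_mem fun i _ =>
    bch_mem ((Fil ι 1).neg_mem hy) (letter_mem i))

/-- A change of `y` changes the mean of the `BCH(-y, tᵢ)` by the opposite amount to first order. In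
the BCH product of `y` with this mean the two changes cancel, which makes the step a contraction. -/
theorem baryStep_sub_mem [Nonempty ι] {y y' : Ser ι} {m : ℕ} (hy : y ∈ Fil ι 1) (hy' : y' ∈ Fil ι 1)
    (h : y - y' ∈ Fil ι m) : baryStep y - baryStep y' ∈ Fil ι (m + 1) := by
  have hc : (Fintype.card ι : ℚ) ≠ 0 := by exact_mod_cast Fintype.card_ne_zero
  have h1 : ∀ i, bch (-y) (letter i) - bch (-y') (letter i) + (y - y') ∈ Fil ι (m + 1) := fun i => by
    have := bch_sub_bch_mem ((Fil ι 1).neg_mem hy) ((Fil ι 1).neg_mem hy') (letter_mem i)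
      (letter_mem i) (m := m) (by
        rw [show -y - -y' = -(y - y') by abel]; exact (Fil ι m).neg_mem h) (by simp)
    convert this using 1; abel
  set s := (1 / (Fintype.card ι : ℚ)) • ∑ i : ι, bch (-y) (letter i) with hs
  set s' := (1 / (Fintype.card ι : ℚ)) • ∑ i : ι, bch (-y') (letter i) with hs'
  have h2 : s - s' + (y - y') ∈ Fil ι (m + 1) := by
    have : s - s' + (y - y') = (1 / (Fintype.card ι : ℚ)) •
        ∑ i : ι, (bch (-y) (letter i) - bch (-y') (letter i) + (y - y')) := by
      rw [Finset.sum_add_distrib, Finset.sum_sub_distrib, Finset.sum_const, Finset.card_univ,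
        smul_add, smul_sub, ← Nat.cast_smul_eq_nsmul ℚ, smul_smul, one_div_mul_cancel hc, one_smul]
    rw [this]
    exact (Fil ι _).smul_mem _ ((Fil ι _).sum_mem fun i _ => h1 i)
  have h3 : s - s' ∈ Fil ι m := by
    simpa using (Fil ι m).sub_mem (Fil_mono (Nat.le_succ m) h2) h
  have h4 := bch_sub_bch_mem hy hy' (baryStep_aux_mem hy) (baryStep_aux_mem hy') h h3
  have h5 := (Fil ι _).add_mem h4 h2
  rw [baryStep, baryStep]
  convert h5 using 1
  abel

theorem baryStep_eq_of_sum {y : Ser ι} (hy : y ∈ Fil ι 1)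
    (h : ∑ i : ι, bch (-y) (letter i) = 0) : baryStep y = y := by
  rw [baryStep, h, smul_zero, bch_zero hy]

theorem baryStep_unique [Nonempty ι] {y y' : Ser ι} (hy : y ∈ Fil ι 1) (hy' : y' ∈ Fil ι 1)
    (h : baryStep y = y) (h' : baryStep y' = y') : y = y' := by
  refine eq_of_sub_mem_Fil fun m => ?_
  induction m with
  | zero => exact mem_Fil_zero _
  | succ m ih =>
    have := baryStep_sub_mem hy hy' ih
    rwa [h, h'] at this

/-- The approximations of the barycentre, as series. -/
theorem toSer_barycentreApprox_succ (k : ℕ) :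
    toSer (barycentreApprox ι (k + 1)) = baryStep (toSer (barycentreApprox ι k)) := by
  rw [barycentreApprox, toSer_bch, baryStep, map_smul, map_sum]
  congr 2
  refine Finset.sum_congr rfl fun i _ => ?_
  rw [toSer_bch, map_neg, toSer_var]

theorem barycentreApprox_mem_A (k : ℕ) :
    toSer (barycentreApprox ι k) ∈ A (fun _ => 0) Set.univ 0 := by
  induction k with
  | zero => exact Submodule.zero_mem _
  | succ k ih =>
    rw [toSer_barycentreApprox_succ]
    exact bch_mem_A ih (Submodule.smul_mem _ _ (Submodule.sum_mem _ fun i _ =>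
      bch_mem_A (Submodule.neg_mem _ ih) (letter_mem_A (deg := fun _ => 0) (Set.mem_univ i))))

variable [Nonempty ι]

theorem barycentreApprox_succ_sub_mem (k : ℕ) :
    toSer (barycentreApprox ι (k + 1)) - toSer (barycentreApprox ι k) ∈ Fil ι (k + 1) := by
  induction k with
  | zero =>
    exact (Fil ι 1).sub_mem (A_mem_Fil (barycentreApprox_mem_A 1))
      (A_mem_Fil (barycentreApprox_mem_A 0))
  | succ k ih =>
    have := baryStep_sub_mem (A_mem_Fil (barycentreApprox_mem_A (k + 1)))
      (A_mem_Fil (barycentreApprox_mem_A k)) ih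
    rwa [← toSer_barycentreApprox_succ, ← toSer_barycentreApprox_succ] at this

theorem barycentreApprox_sub_mem {j k : ℕ} (h : j ≤ k) :
    toSer (barycentreApprox ι k) - toSer (barycentreApprox ι j) ∈ Fil ι (j + 1) := by
  induction k, h using Nat.le_induction with
  | base => simp
  | succ k hk ih =>
    have := (Fil ι _).add_mem
      (Fil_mono (Nat.succ_le_succ hk) (barycentreApprox_succ_sub_mem (ι := ι) k)) ih
    simpa using this

/-- The coefficient of `w` is taken from approximation number `w.length`; later approximations no
longer change it. -/
theorem barycentre_sub_mem (k : ℕ) :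
    toSer (barycentre ι) - toSer (barycentreApprox ι k) ∈ Fil ι (k + 1) := by
  intro w hw
  have := barycentreApprox_sub_mem (ι := ι) (j := w.length) (k := k) (by omega) w (by omega)
  rw [map_sub, sub_eq_zero] at this ⊢
  rw [this]; rfl

theorem barycentre_mem_A : toSer (barycentre ι) ∈ A (fun _ => 0) Set.univ 0 :=
  closed_A _ fun m => ⟨_, barycentreApprox_mem_A m, Fil_mono (Nat.le_succ m) (barycentre_sub_mem m)⟩

theorem baryStep_barycentre : baryStep (toSer (barycentre ι)) = toSer (barycentre ι) := by
  refine eq_of_sub_mem_Fil fun k => Fil_mono (show k ≤ k + 1 + 1 by omega) ?_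
  have h1 := baryStep_sub_mem (A_mem_Fil barycentre_mem_A)
    (A_mem_Fil (barycentreApprox_mem_A k)) (barycentre_sub_mem (ι := ι) k)
  rw [← toSer_barycentreApprox_succ] at h1
  simpa using (Fil ι _).sub_mem h1 (barycentre_sub_mem (ι := ι) (k + 1))

/-- At a fixed point `exp y * exp s = exp y` for the mean `s`, which forces `s = 0`. -/
theorem sum_bch_barycentre : ∑ i : ι, bch (-toSer (barycentre ι)) (letter i) = 0 := by
  have hy := A_mem_Fil (barycentre_mem_A (ι := ι))
  have hs := baryStep_aux_mem hy
  have h := congrArg exp (baryStep_barycentre (ι := ι))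
  rw [baryStep, exp_bch hy hs] at h
  have h2 := congrArg (fun z => exp (-toSer (barycentre ι)) * z) h
  simp only [← mul_assoc, exp_neg_mul_exp hy, one_mul] at h2
  rw [← exp_zero] at h2
  have h3 := exp_injective hs (Fil ι 1).zero_mem h2
  have hc : (1 / (Fintype.card ι : ℚ)) ≠ 0 :=
    one_div_ne_zero (by exact_mod_cast Fintype.card_ne_zero)
  exact (smul_eq_zero.mp h3).resolve_left hc

theorem eq_barycentre {y : Ser ι} (hy : y ∈ Fil ι 1) (h : ∑ i : ι, bch (-y) (letter i) = 0) :
    y = toSer (barycentre ι) :=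
  baryStep_unique hy (A_mem_Fil barycentre_mem_A) (baryStep_eq_of_sum hy h) baryStep_barycentre

theorem sum_bch_subst_barycentre {x : ι → Ser X} (hx : ∀ i, x i ∈ Fil X 1) :
    ∑ i : ι, bch (-subst (toSer (barycentre ι)) x) (x i) = 0 := by
  have hg := isHom_subst hx
  have h := congrArg (substL x) (sum_bch_barycentre (ι := ι))
  rw [map_zero, map_sum] at h
  rw [← h]
  refine Finset.sum_congr rfl fun i _ => ?_
  rw [hg.map_bch ((Fil ι 1).neg_mem (A_mem_Fil barycentre_mem_A)) (letter_mem i), map_neg,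
    substL_apply, substL_apply, subst_letter hx]

/-- The defining equation is symmetric in the variables and has only one solution. -/
theorem subst_perm_barycentre (π : Equiv.Perm ι) :
    subst (toSer (barycentre ι)) (fun i => letter (π i)) = toSer (barycentre ι) := by
  refine eq_barycentre
    (subst_mem (fun i => letter_mem (π i)) (A_mem_Fil barycentre_mem_A)) ?_
  have := sum_bch_subst_barycentre (x := fun i => letter (π i)) fun i => letter_mem (π i)
  rwa [Equiv.sum_comp π fun i => bch (-subst (toSer (barycentre ι)) fun i => letter (π i))
    (letter i)] at this

theorem subst_neg_barycentre :
    subst (toSer (barycentre ι)) (fun i => -letter i) = -toSer (barycentre ι) := by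
  have hl : ∀ i : ι, -letter i ∈ Fil ι 1 := fun i => (Fil ι 1).neg_mem (letter_mem i)
  set w := subst (toSer (barycentre ι)) fun i => -letter i with hw
  have hw1 : w ∈ Fil ι 1 := subst_mem hl (A_mem_Fil barycentre_mem_A)
  rw [← eq_barycentre ((Fil ι 1).neg_mem hw1), neg_neg]
  have h := sum_bch_subst_barycentre hl
  rw [← hw] at h
  -- The terms of `h` are `-BCH(tᵢ, w)`. The required equation has the factors in the other order;
  -- reversing them is conjugation by the same `exp w` for all `i`, hence passes through the sum.
  have h2 : ∑ i, bch (letter i) w = 0 := by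
    rw [← neg_eq_zero, ← Finset.sum_neg_distrib, ← h]
    exact Finset.sum_congr rfl fun i _ => neg_bch (letter_mem i) hw1
  rw [neg_neg, Finset.sum_congr rfl fun i _ => bch_comm_conj (letter_mem i) hw1,
    ← Finset.sum_mul, ← Finset.mul_sum, h2, mul_zero, zero_mul]

/-- If `xᵢ` flows from `a` to `b` for all `i`, then so does their barycentre. -/
theorem flow_barycentre {deg : X → ℤ} {δ : Ser X →ₗ[ℚ] Ser X}
    (hδ : IsDer LinearMap.id (sgn deg 1) δ) {S : Set X} {x : ι → Ser X}
    (hx : ∀ i, x i ∈ A deg S 0) {a b : Ser X} (h : ∀ i, flow δ (x i) a = b) :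
    flow δ (subst (toSer (barycentre ι)) x) a = b := by
  have hx1 : ∀ i, x i ∈ Fil X 1 := fun i => A_mem_Fil (hx i)
  have hyA : subst (toSer (barycentre ι)) x ∈ A deg S 0 := subst_mem_A hx barycentre_mem_A
  set y := subst (toSer (barycentre ι)) x with hy
  have hy1 := A_mem_Fil hyA
  have hny := (A deg S 0).neg_mem hyA
  set c := flow δ y a with hc
  -- The `z i` sum to zero by the choice of `y`, and each flows from `c = u_y(a)` to `b`. It remains
  -- to see that `b = c`.
  set z := fun i => bch (-y) (x i) with hz
  have hzA : ∀ i, z i ∈ A deg S 0 := fun i => bch_mem_A hny (hx i)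
  have hz1 : ∀ i, z i ∈ Fil X 1 := fun i => A_mem_Fil (hzA i)
  have hsum : ∑ i, z i = 0 := sum_bch_subst_barycentre hx1
  have hflow : ∀ i, flow δ (z i) c = b := fun i => by
    rw [hz, flow_bch hδ hny (hx i), hc, flow_neg hδ hy1 hyA.1, h]
  -- The flow equation solved for `δ (z i)` by inverting `flowS`. The second term is linear in `z
  -- i`, so it disappears in the sum over `i`.
  have hder : ∀ i, δ (z i) = opS bernS (ad (z i)) (b - c) + ad (z i) c := fun i => by
    have hT := raises_ad (hz1 i)
    have e1 : opS flowS (ad (z i)) (δ (z i)) = (b - c) + opS flowS (ad (z i)) (ad (z i) c) := by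
      have e2 : opS (PowerSeries.X * flowS) (ad (z i)) c = c - opS expNegS (ad (z i)) c := by
        rw [X_mul_flowS, opS_sub, opS_one]; rfl
      rw [mul_comm, opS_mul hT, opS_X hT, Module.End.mul_apply] at e2
      rw [e2, ← hflow i, flow]
      abel
    rw [← opS_bern_flow hT (δ (z i)), e1, map_add, opS_bern_flow hT]
  have hzero : ∑ i, opS bernS (ad (z i)) (b - c) = 0 := by
    have e := congrArg δ hsum
    rw [map_sum, map_zero, Finset.sum_congr rfl fun i _ => hder i, Finset.sum_add_distrib] at e
    have : ∑ i, ad (z i) c = 0 := by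
      simp only [ad_apply]
      rw [Finset.sum_sub_distrib, ← Finset.sum_mul, ← Finset.mul_sum, hsum, zero_mul, mul_zero,
        sub_zero]
    rwa [this, add_zero] at e
  symm
  -- Since `bernS` has constant term `1`, the vanishing sum `hzero` is the number of variables times
  -- `b - c` to leading order, so `b - c` lies ever deeper in the filtration.
  refine eq_of_sub_mem_Fil fun m => ?_
  induction m with
  | zero => exact mem_Fil_zero _
  | succ m ih =>
    have h0 : PowerSeries.constantCoeff bernS = 1 := by
      rw [← PowerSeries.coeff_zero_eq_constantCoeff_apply, bernS, bernoulli'PowerSeries]; simp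
    have h1 : ∑ i, (opS bernS (ad (z i)) (b - c) - (b - c)) ∈ Fil X (m + 1) :=
      (Fil X _).sum_mem fun i _ => by
        simpa [h0] using opS_sub_mem (raises_ad (hz1 i)) bernS ih
    rw [Finset.sum_sub_distrib, hzero, zero_sub, Finset.sum_const, Finset.card_univ,
      ← Nat.cast_smul_eq_nsmul ℚ] at h1
    have hcard : (Fintype.card ι : ℚ) ≠ 0 := by exact_mod_cast Fintype.card_ne_zero
    have h2 := (Fil X _).smul_mem (-(Fintype.card ι : ℚ)⁻¹) h1
    rwa [smul_neg, neg_smul, neg_neg, smul_smul, inv_mul_cancel₀ hcard, one_smul] at h2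

theorem isUniversalAverage_barycentre : IsUniversalAverage (barycentre ι) where
  lie := mem_lieSeries.mpr barycentre_mem_A
  symm π := toSer_injective (by
    rw [toSer_subst (y := fun i => NC.var (π i)) _ fun i => letter_mem (π i)]
    exact subst_perm_barycentre π)
  flow Y _ deg D hD hfil a _ b _ x hx _ _ h := by
    have := Fintype.ofFinite Y
    have hxA : ∀ i, toSer (x i) ∈ A deg Set.univ 0 := fun i => mem_lieSeries.mp (hx i)
    have hs : toSer (NC.subst (barycentre ι) x) = subst (toSer (barycentre ι)) fun i => toSer (x i) :=
      toSer_subst _ fun i => A_mem_Fil (hxA i)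
    have hsA : toSer (NC.subst (barycentre ι) x) ∈ A deg Set.univ 0 := by
      rw [hs]; exact subst_mem_A hxA barycentre_mem_A
    refine toSer_injective ?_
    rw [toSer_flow_extend hD.derivation hfil hsA, hs]
    refine flow_barycentre (extend_spec hD.derivation hfil).1.der hxA fun i => ?_
    rw [← toSer_flow_extend hD.derivation hfil (hxA i), h]

theorem isOddAverage_barycentre : IsOddAverage (barycentre ι) := toSer_injective (by
  rw [toSer_subst (y := fun i => -NC.var i) _ fun i => (Fil ι 1).neg_mem (letter_mem i)]
  exact subst_neg_barycentre)

end

end Ser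

/-! ### Twisted differentials, and the average of two variables. -/

namespace Ser

variable {X Y Z ι : Type}

/-! ### Kernels of derivations -/

theorem Pres.closed_ker {T : Ser X →ₗ[ℚ] Ser Y} (hT : Pres T) : Closed (LinearMap.ker T) := by
  intro z hz
  refine eq_zero_of_mem_Fil fun m => ?_
  obtain ⟨z', hz', h⟩ := hz m
  have := hT m _ h
  rwa [map_sub, LinearMap.mem_ker.mp hz', sub_zero] at this

namespace IsDer

variable {φ ψ δ : Ser X →ₗ[ℚ] Ser Y} (hδ : IsDer φ ψ δ)
include hδ

theorem eq_zero_of_mem_Lie {deg : X → ℤ} {S : Set X} (h : ∀ x ∈ S, δ (letter x) = 0) {z : Ser X}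
    (hz : z ∈ Lie deg S) : δ z = 0 := by
  have key : ∀ f g : Ser X, ∀ p q, f ∈ Hom deg p → g ∈ Hom deg q → δ f = 0 → δ g = 0 →
      δ (br deg f g) = 0 := fun f g p q hp hq hf hg => by
    rw [br_of_mem_mem hp hq, map_sub, map_smul, hδ.leibniz, hδ.leibniz, hf, hg]
    simp
  refine Lie_induction (T := LinearMap.id) (K := LinearMap.ker δ) Pres.id hδ.pres.closed_ker
    (fun f hf => ?_) hz
  show δ f = 0
  induction hf with
  | gen x hx => exact h x hx
  | bracket f g hf hg ihf ihg =>
    obtain ⟨p, hp⟩ := IsLieMonomial.exists_mem_WHom deg hf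
    obtain ⟨q, hq⟩ := IsLieMonomial.exists_mem_WHom deg hg
    exact key f g p q hp hq ihf ihg

theorem exp_eq_zero (h1 : δ 1 = 0) {w : Ser X} (hw1 : w ∈ Fil X 1) (hw : δ w = 0) :
    δ (exp w) = 0 := by
  refine hδ.pres.closed_ker.opS_mem (raises_L hw1) (fun z hz => ?_) expS h1
  rw [LinearMap.mem_ker] at *
  rw [L_apply, hδ.leibniz, hw, hz, zero_mul, mul_zero, add_zero]

/-- A derivation that annihilates `w` and `e^w z e^{-w}` annihilates `z`. -/
theorem eq_zero_of_conj (hφ : IsHom φ) (hψ : IsHom ψ) {w : Ser X} (hw1 : w ∈ Fil X 1)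
    (hw : δ w = 0) {z : Ser X} (h : δ (exp w * z * exp (-w)) = 0) : δ z = 0 := by
  have h1 := hδ.map_one hφ.map_one hψ.map_one
  have e1 := hδ.exp_eq_zero h1 hw1 hw
  have e2 := hδ.exp_eq_zero h1 ((Fil X 1).neg_mem hw1) (by rw [map_neg, hw, neg_zero])
  rw [hδ.leibniz, hδ.leibniz, e1, e2, mul_zero, add_zero, zero_mul, zero_add] at h
  have h2 : ψ (exp (-w)) * (ψ (exp w) * δ z * φ (exp (-w))) * φ (exp w)
      = ψ (exp (-w) * exp w) * δ z * φ (exp (-w) * exp w) := by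
    rw [hφ.map_mul, hψ.map_mul]; noncomm_ring
  rw [h, exp_neg_mul_exp hw1, hφ.map_one, hψ.map_one] at h2
  simpa using h2.symm

end IsDer

/-! ### Twisted differentials -/

section
variable {deg : X → ℤ} {δ : Ser X →ₗ[ℚ] Ser X} {S : Set X}

/-- An element `e` flows from `a` to `a` if and only if it is closed for the differential
twisted by `a`. -/
theorem flow_self_iff (hδ : IsDer LinearMap.id (sgn deg 1) δ) {a : Ser X} (ha : a ∈ Hom deg (-1))
    {e : Ser X} (he1 : e ∈ Fil X 1) (he : e ∈ Hom deg 0) :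
    flow δ e a = a ↔ (δ + br deg a) e = 0 := by
  rw [← (hδ.add (isDer_br ha)).map_exp_eq_zero he1 he, flow_eq_iff hδ he1 he, LinearMap.add_apply,
    br_exp_of_even ha he1 he, ← sub_eq_zero]
  rw [show δ (exp e) - (exp e * a - a * exp e) = δ (exp e) + (a * exp e - exp e * a) by abel]

theorem sgn_neg_one (f : Ser X) : sgn deg (-1) f = sgn deg 1 f := by
  ext w
  rw [coeff_sgn, coeff_sgn]
  congr 1
  rw [neg_one_mul, one_mul, zpow_neg]
  rcases neg_one_zpow_eq_or (wdeg deg w) with h | h <;> rw [h] <;> norm_num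

theorem br_odd {a : Ser X} (ha : a ∈ Hom deg (-1)) (z : Ser X) :
    br deg a z = a * z - sgn deg 1 z * a := by
  rw [br_of_mem ha, sgn_neg_one]


theorem flow_mem_A {e a : Ser X} (he : e ∈ A deg S 0) (ha : a ∈ A deg S (-1))
    (hδ : δ e ∈ A deg S (-1)) : flow δ e a ∈ A deg S (-1) :=
  (A deg S (-1)).add_mem (opS_ad_mem_A he ha _) (opS_ad_mem_A he hδ _)

theorem flow_mem_Hom (hδ : OddDer deg δ) {e a : Ser X} (he1 : e ∈ Fil X 1) (he : e ∈ Hom deg 0)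
    (ha : a ∈ Hom deg (-1)) : flow δ e a ∈ Hom deg (-1) := by
  have hT : ∀ z ∈ Hom deg (-1), ad e z ∈ Hom deg (-1) := fun z hz => by
    have := br_mem_WHom (deg := deg) he hz
    rwa [zero_add, br_even he] at this
  exact (Hom deg (-1)).add_mem ((closed_WHom deg _).opS_mem (raises_ad he1) hT _ ha)
    ((closed_WHom deg _).opS_mem (raises_ad he1) hT _ (hδ.lower 0 e he))

/-- Conjugation intertwines the differentials twisted by `a` and by `u_w(a)`. -/
theorem twist_conj (hδ : OddDer deg δ) {a w : Ser X} (ha : a ∈ Hom deg (-1)) (hw1 : w ∈ Fil X 1)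
    (hw : w ∈ Hom deg 0) (z : Ser X) :
    (δ + br deg a) (exp w * z * exp (-w))
      = exp w * (δ z + br deg (flow δ w a) z) * exp (-w) := by
  have hx := flow_mem_Hom hδ hw1 hw ha
  have hnw1 := (Fil X 1).neg_mem hw1
  have hnw := (Hom deg 0).neg_mem hw
  have e1 := (flow_eq_iff hδ.der hw1 hw (a := a)).mp rfl
  have e2 := (flow_eq_iff hδ.der hnw1 hnw).mp (flow_neg hδ.der hw1 hw a)
  set x := flow δ w a
  have hs : ∀ f g, sgn deg 1 (f * g) = sgn deg 1 f * sgn deg 1 g := (isHom_sgn deg 1).map_mul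
  simp only [LinearMap.add_apply, br_odd ha, br_odd hx, hδ.der.leibniz, e1, e2, hs,
    sgn_even (exp_mem_Hom hw1 hw), sgn_even (exp_mem_Hom hnw1 hnw), LinearMap.id_apply]
  noncomm_ring

/-- The difference of the two squares is the bracket with `δ a + a * a`, which vanishes by the
Maurer-Cartan equation. -/
theorem twist_sq [Fintype X] (hδ : OddDer deg δ) {a : Ser X} (ha : a ∈ Hom deg (-1))
    (h : δ a = -(a * a)) (z : Ser X) : (δ + br deg a) ((δ + br deg a) z) = δ (δ z) := by
  have hs : ∀ f g, sgn deg 1 (f * g) = sgn deg 1 f * sgn deg 1 g := (isHom_sgn deg 1).map_mul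
  have hsa : sgn deg 1 a = -a := by
    rw [sgn_of_mem ha]; norm_num
  simp only [LinearMap.add_apply, br_odd ha, map_add, map_sub, hδ.der.leibniz, hs, sgn_sgn, hsa,
    hδ.sgn_comm, h, LinearMap.id_apply]
  noncomm_ring

end

/-! ### The adjoint action of Lie series -/

/-- `ad` is a representation of Lie algebras, so `Q(ad y) = ad Q(y)` when `Q` is a Lie series. This
identifies BCH of adjoint operators with `ad` of BCH. -/
theorem opW_ad_of_mem_Lie [Fintype ι] {y : ι → Ser X} (hy : ∀ i, y i ∈ Fil X 1) {Q : Ser ι}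
    {S : Set ι} (hQ : Q ∈ Lie (fun _ => 0) S) (z : Ser X) :
    opW Q (fun i => ad (y i)) z = ad (subst Q y) z := by
  have hT : ∀ i, Raises (ad (y i)) := fun i => raises_ad (hy i)
  -- `T z` measures the failure of the identity at `z`. The induction must run over all `z` at once,
  -- because for a commutator one factor is applied to the result of the other.
  let T : Ser X → (Ser ι →ₗ[ℚ] Ser X) := fun z =>
    evalW (fun i => ad (y i)) z - (R z - L z) ∘ₗ substL y
  have hpres : ∀ z, Pres (T z) := fun z =>
    (pres_evalW hT z).sub (((pres_R z).sub (pres_L z)).comp (isHom_subst hy).pres)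
  have hTz : ∀ z f, T z f = opW f (fun i => ad (y i)) z - (subst f y * z - z * subst f y) :=
    fun _ _ => rfl
  have hbr : ∀ f g : Ser ι, (∀ z, T z f = 0) → (∀ z, T z g = 0) →
      ∀ z, T z (br (fun _ => 0) f g) = 0 := by
    intro f g hf hg z
    have h0 : ∀ f : Ser ι, f ∈ Hom (fun _ : ι => (0 : ℤ)) 0 := fun f w _ => by simp
    have hm : T z (f * g - g * f) = T z (f * g) - T z (g * f) := map_sub _ _ _
    have e : ∀ f : Ser ι, (∀ z, T z f = 0) →
        ∀ z, opW f (fun i => ad (y i)) z = subst f y * z - z * subst f y :=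
      fun f h z => sub_eq_zero.mp (h z)
    rw [br_even (h0 f), ad_apply, hm, hTz, hTz, opW_mul hT, opW_mul hT, subst_mul hy, subst_mul hy,
      e f hf, e g hg, e f hf, e g hg]
    noncomm_ring
  have key : ∀ f : Ser ι, IsLieMonomial (fun _ => 0) S f → ∀ z, T z f = 0 := by
    intro f hf
    induction hf with
    | gen i hi =>
      intro z
      show T z (letter i) = 0
      rw [hTz, opW_letter hT, subst_letter hy, ad_apply, sub_self]
    | bracket f g _ _ ihf ihg => exact hbr f g ihf ihg
  have := Lie_induction (hpres z) (K := ⊥) (fun z hz => by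
    refine eq_zero_of_mem_Fil fun m => ?_
    obtain ⟨z', hz', h⟩ := hz m
    rw [Submodule.mem_bot] at hz'
    rwa [hz', sub_zero] at h) (fun f hf => (Submodule.mem_bot ℚ).mpr (key f hf z)) hQ
  exact sub_eq_zero.mp ((Submodule.mem_bot ℚ).mp this)

/-! ### The average of two variables -/

/-- `BCH(x, ½ BCH(-x, y))`. -/
def mu2 (x y : Ser X) : Ser X := bch x ((1 / 2 : ℚ) • bch (-x) y)

theorem toSer_mu2 (x y : NC X) : toSer (_root_.mu2 x y) = mu2 (toSer x) (toSer y) := by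
  rw [_root_.mu2, toSer_bch, map_smul, toSer_bch, map_neg, mu2]

theorem IsHom.map_mu2 {g : Ser X →ₗ[ℚ] Ser Y} (hg : IsHom g) {x y : Ser X} (hx : x ∈ Fil X 1)
    (hy : y ∈ Fil X 1) : g (mu2 x y) = mu2 (g x) (g y) := by
  have hx' := (Fil X 1).neg_mem hx
  rw [mu2, hg.map_bch hx ((Fil X 1).smul_mem _ (bch_mem hx' hy)), map_smul, hg.map_bch hx' hy,
    map_neg, mu2]

theorem mu2_mem_A {deg : X → ℤ} {S : Set X} {x y : Ser X} (hx : x ∈ A deg S 0)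
    (hy : y ∈ A deg S 0) : mu2 x y ∈ A deg S 0 :=
  bch_mem_A hx (Submodule.smul_mem _ _ (bch_mem_A (Submodule.neg_mem _ hx) hy))

theorem exp_half_mul_self {f : Ser X} (hf : f ∈ Fil X 1) :
    exp ((1 / 2 : ℚ) • f) * exp ((1 / 2 : ℚ) • f) = exp f := by
  have h := (Fil X 1).smul_mem (1 / 2 : ℚ) hf
  rw [← exp_add h h (Commute.refl _), ← add_smul]
  norm_num

section
variable {x y : Ser X} (hx : x ∈ Fil X 1) (hy : y ∈ Fil X 1)
include hx hy

theorem mu2_mem : mu2 x y ∈ Fil X 1 :=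
  bch_mem hx ((Fil X 1).smul_mem _ (bch_mem ((Fil X 1).neg_mem hx) hy))

theorem exp_mu2 : exp (mu2 x y) = exp x * exp ((1 / 2 : ℚ) • bch (-x) y) :=
  exp_bch hx ((Fil X 1).smul_mem _ (bch_mem ((Fil X 1).neg_mem hx) hy))

theorem exp_half_bch_mul_self :
    exp ((1 / 2 : ℚ) • bch (-x) y) * exp ((1 / 2 : ℚ) • bch (-x) y) = exp (-x) * exp y := by
  rw [exp_half_mul_self (bch_mem ((Fil X 1).neg_mem hx) hy), exp_bch ((Fil X 1).neg_mem hx) hy]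

/-- If `l` is half of `BCH(-x, y)`, then `exp l * exp l = exp (-x) * exp y`, and so `exp x * exp l =
exp y * exp (-l)`: the midpoint between `x` and `y` is the same from either end. -/
theorem mu2_comm : mu2 y x = mu2 x y := by
  have hx' := (Fil X 1).neg_mem hx
  have hl := (Fil X 1).smul_mem (1 / 2 : ℚ) (bch_mem hx' hy)
  refine exp_injective (mu2_mem hy hx) (mu2_mem hx hy) ?_
  rw [exp_mu2 hy hx, exp_mu2 hx hy, show bch (-y) x = -bch (-x) y by
    rw [neg_bch hx' hy, neg_neg], smul_neg]
  have h := exp_half_bch_mul_self hx hy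
  set l := (1 / 2 : ℚ) • bch (-x) y
  calc exp y * exp (-l) = exp x * (exp (-x) * exp y) * exp (-l) := by
        rw [← mul_assoc (exp x), exp_mul_exp_neg hx, one_mul]
    _ = exp x * exp l * (exp l * exp (-l)) := by rw [← h]; noncomm_ring
    _ = exp x * exp l := by rw [exp_mul_exp_neg hl, mul_one]

/-- `BCH(x, -y)` is the conjugate by `exp x` of `-BCH(-x, y)`, and halving commutes with
conjugation. -/
theorem mu2_neg_neg : mu2 (-x) (-y) = -mu2 x y := by
  have hx' := (Fil X 1).neg_mem hx
  have hy' := (Fil X 1).neg_mem hy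
  have hb := bch_mem hx' hy
  have hl := (Fil X 1).smul_mem (1 / 2 : ℚ) hb
  have hl' := (Fil X 1).neg_mem hl
  have e : bch (-(-x)) (-y) = exp x * -bch (-x) y * exp (-x) := by
    rw [neg_neg]
    refine exp_injective (bch_mem hx hy') (conj_mem _ _ ((Fil X 1).neg_mem hb)) ?_
    rw [exp_conj (exp_neg_mul_exp hx) (exp_mul_exp_neg hx) ((Fil X 1).neg_mem hb), exp_bch hx hy',
      neg_bch hx' hy, neg_neg, exp_bch hy' hx, mul_assoc, mul_assoc, exp_mul_exp_neg hx, mul_one]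
  rw [mu2, mu2, neg_bch hx hl, e]
  have e2 : (1 / 2 : ℚ) • (exp x * -bch (-x) y * exp (-x))
      = exp x * -((1 / 2 : ℚ) • bch (-x) y) * exp (-x) := by
    rw [← smul_neg]; simp only [mul_smul_comm, smul_mul_assoc]
  rw [e2]
  have hc := conj_mem (exp x) (exp (-x)) hl'
  refine exp_injective (bch_mem hx' hc) (bch_mem hl' hx') ?_
  rw [exp_bch hx' hc, exp_bch hl' hx', exp_conj (exp_neg_mul_exp hx) (exp_mul_exp_neg hx) hl',
    mul_assoc, ← mul_assoc (exp (-x)), exp_neg_mul_exp hx, one_mul]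

/-- Conjugation by `e^{μ₂(x, y)}` maps `e^{-x} e^y` to `e^y e^{-x}`. -/
theorem exp_mu2_conj :
    exp (mu2 x y) * (exp (-x) * exp y) * exp (-mu2 x y) = exp y * exp (-x) := by
  have hl := (Fil X 1).smul_mem (1 / 2 : ℚ) (bch_mem ((Fil X 1).neg_mem hx) hy)
  have h := exp_half_bch_mul_self hx hy
  have hm := mu2_mem hx hy
  have h2 : exp (mu2 x y) * (exp (-x) * exp y) = exp y * exp (-x) * exp (mu2 x y) := by
    rw [exp_mu2 hx hy, ← h]
    set l := (1 / 2 : ℚ) • bch (-x) y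
    have e : exp y = exp x * (exp l * exp l) := by
      rw [h, ← mul_assoc, exp_mul_exp_neg hx, one_mul]
    rw [e, show exp x * (exp l * exp l) * exp (-x) * (exp x * exp l)
      = exp x * (exp l * exp l) * (exp (-x) * exp x) * exp l by noncomm_ring, exp_neg_mul_exp hx]
    noncomm_ring
  rw [h2, mul_assoc, exp_mul_exp_neg hm, mul_one]

end

section
variable {deg : X → ℤ} {δ : Ser X →ₗ[ℚ] Ser X} {S : Set X}

/-- The average of two elements that flow from `a` to `b` flows from `a` to `b`. -/
theorem flow_mu2 (hδ : IsDer LinearMap.id (sgn deg 1) δ) {x y a b : Ser X} (hx : x ∈ A deg S 0)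
    (hy : y ∈ A deg S 0) (hb : b ∈ Hom deg (-1)) (h : flow δ x a = b) (h' : flow δ y a = b) :
    flow δ (mu2 x y) a = b := by
  have hx' := (A deg S 0).neg_mem hx
  have hl := bch_mem_A hx' hy
  have hl2 := (A deg S 0).smul_mem (1 / 2 : ℚ) hl
  -- Flowing back along `x` and forth along `y` returns to `b`. By `flow_self_iff` this is a linear
  -- condition, so it survives the factor `1 / 2`.
  have h1 : flow δ (bch (-x) y) b = b := by
    rw [flow_bch hδ hx' hy]
    conv_lhs => rw [← h, flow_neg hδ (A_mem_Fil hx) hx.1, h']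
  rw [mu2, flow_bch hδ hx hl2, h, flow_self_iff hδ hb (A_mem_Fil hl2) hl2.1, map_smul,
    (flow_self_iff hδ hb (A_mem_Fil hl) hl.1).mp h1, smul_zero]

/-- The midpoint of a flow from `a` to `b`. -/
theorem flow_half (hδ : IsDer LinearMap.id (sgn deg 1) δ) {e a b : Ser X} (he : e ∈ A deg S 0)
    (h : flow δ e a = b) : flow δ (-((1 / 2 : ℚ) • e)) b = flow δ ((1 / 2 : ℚ) • e) a := by
  have h2 := (A deg S 0).smul_mem (1 / 2 : ℚ) he
  have e1 : bch ((1 / 2 : ℚ) • e) ((1 / 2 : ℚ) • e) = e := by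
    rw [bch, exp_half_mul_self (A_mem_Fil he), log_exp (A_mem_Fil he)]
  rw [← h]
  conv_lhs => rw [← e1, flow_bch hδ h2 h2, e1]
  exact flow_neg hδ (A_mem_Fil h2) h2.1 _

end

end Ser

instance {n : ℕ} [NeZero n] : Finite (BananaCell n) :=
  Finite.of_surjective
    (fun x : Fin 3 ⊕ ZMod n ⊕ ZMod n => (match x with
      | .inl 0 => .a
      | .inl 1 => .b
      | .inl 2 => .h
      | .inr (.inl i) => .e i
      | .inr (.inr i) => .f i : BananaCell n))
    (by
      rintro (_ | _ | i | i | _)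
      exacts [⟨.inl 0, rfl⟩, ⟨.inl 1, rfl⟩, ⟨.inr (.inl i), rfl⟩, ⟨.inr (.inr i), rfl⟩,
        ⟨.inl 2, rfl⟩])

instance {n : ℕ} [NeZero n] : Fintype (BananaCell n) := Fintype.ofFinite _

/-! ### The elements of the banana model, its closed loops, and `∂² = 0`. -/

namespace Ser

theorem IsDer.eq_zero_of_exp {X Y : Type} {φ ψ δ : Ser X →ₗ[ℚ] Ser Y} (hδ : IsDer φ ψ δ)
    (hφ : IsHom φ) (hψ : IsHom ψ) {f : Ser X} (hf1 : f ∈ Fil X 1) (hf : φ f = ψ f)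
    (h : δ (exp f) = 0) : δ f = 0 := by
  rw [hδ.map_exp hφ hψ hf1 hf] at h
  have hf' := hφ.map_mem hf1
  have := congrArg (fun z => opS bernS (ad (φ f)) (exp (-φ f) * z)) h
  simpa [← mul_assoc, exp_neg_mul_exp hf', opS_bern_flow (raises_ad hf')] using this

theorem prod_ofFn_telescope {M : Type*} [Monoid M] (u v : ℕ → M) (h : ∀ k, v k * u k = 1) (m : ℕ)
    (s : ℕ) : (List.ofFn fun j : Fin m => u (j + s) * v (j + s + 1)).prod * u (s + m) = u s := by
  induction m generalizing s with
  | zero => simp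
  | succ m ih =>
    have e := ih (s + 1)
    rw [List.ofFn_succ, List.prod_cons, mul_assoc]
    have e1 : ∀ j : Fin m, (u ((j.succ : Fin (m + 1)) + s) * v ((j.succ : Fin (m + 1)) + s + 1))
        = u (j + (s + 1)) * v (j + (s + 1) + 1) := fun j => by
      rw [Fin.val_succ, show (j : ℕ) + 1 + s = j + (s + 1) by omega]
    simp only [e1]
    rw [show s + (m + 1) = s + 1 + m by omega, e]
    simp [mul_assoc, h]

theorem sum_zmod {n : ℕ} [NeZero n] {M : Type*} [AddCommMonoid M] (g : ZMod n → M) :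
    ∑ i, g i = g 0 + ∑ j : Fin (n - 1), g ((j + 1 : ℕ) : ZMod n) := by
  obtain ⟨m, rfl⟩ : ∃ m, n = m + 1 := ⟨n - 1, (Nat.succ_pred (NeZero.ne n)).symm⟩
  refine (Fin.sum_univ_succ (n := m) g).trans ?_
  congr 1
  refine Finset.sum_congr rfl fun j _ => congrArg g ?_
  exact (Fin.cast_val_eq_self j.succ).symm

variable {n : ℕ}

/-! ### Elements of the model of the banana -/

/-- The edge `eᵢ`. -/
def le (i : ZMod n) : Ser (BananaCell n) := letter (.e i)

/-- `BCH(eᵢ, -eᵢ₊₁)`. -/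
def loop (i : ZMod n) : Ser (BananaCell n) := bch (le i) (-le (i + 1))

/-- The `n - 1` loops that follow `BCH(eₖ, -eₖ₊₁)`. -/
def loopsFrom (k : ZMod n) (j : Fin (n - 1)) : Ser (BananaCell n) :=
  loop (((j + 1 : ℕ) : ZMod n) + k)

/-- `½ vᵢ`. -/
def halfFace (i : ZMod n) : Ser (BananaCell n) := (1 / 2 : ℚ) • mu2 (le i) (le (i + 1))

/-- `f'ᵢ`. -/
def face' (i : ZMod n) : Ser (BananaCell n) :=
  exp (halfFace i) * letter (.f i) * exp (-halfFace i)

variable [NeZero n]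

/-- `½ v`. -/
def halfMain (μ : Ser (ZMod n)) : Ser (BananaCell n) := (1 / 2 : ℚ) • subst μ le

/-- `h'`. -/
def solid' (μ : Ser (ZMod n)) : Ser (BananaCell n) :=
  exp (halfMain μ) * letter .h * exp (-halfMain μ)

/-- `∑ᵢ Pᵢ(BCH(E₁, -E₂), …) f'ᵢ`. -/
def bdrySum (P : ZMod n → Ser (Fin (n - 1))) : Ser (BananaCell n) :=
  ∑ i, opW (P i) (fun j => ad (loopsFrom 0 j)) (face' i)

/-- The formulae for the differential of the symmetric model. -/
structure SerModel (P : ZMod n → Ser (Fin (n - 1))) (μ : Ser (ZMod n))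
    (δ : Ser (BananaCell n) →ₗ[ℚ] Ser (BananaCell n)) : Prop where
  odd : OddDer deg δ
  vertex_a : δ (letter .a) = -(letter .a * letter .a)
  vertex_b : δ (letter .b) = -(letter .b * letter .b)
  edge : ∀ i, δ (le i) =
    opS bernS (ad (le i)) (letter .b) - opS (bernS * expNegS) (ad (le i)) (letter .a)
  face : ∀ i, δ (letter (.f i)) = bchList [-halfFace i, le i, -le (i + 1), halfFace i]
    - br deg (flow δ (halfFace i) (letter .a)) (letter (.f i))
  solid : δ (letter .h) + br deg (flow δ (halfMain μ) (letter .a)) (letter .h)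
    = exp (-halfMain μ) * bdrySum P * exp (halfMain μ)

section
variable {S : Set (BananaCell n)}

theorem a_mem_Hom : (letter .a : Ser (BananaCell n)) ∈ Hom deg (-1) := letter_mem_WHom deg _
theorem b_mem_Hom : (letter .b : Ser (BananaCell n)) ∈ Hom deg (-1) := letter_mem_WHom deg _

theorem le_mem_A {i : ZMod n} (h : .e i ∈ S) : le i ∈ A deg S 0 := letter_mem_A (deg := deg) h

omit [NeZero n] in
theorem le_mem (i : ZMod n) : le i ∈ Fil (BananaCell n) 1 := letter_mem _

theorem loop_mem_A {i : ZMod n} (h : .e i ∈ S) (h' : .e (i + 1) ∈ S) : loop i ∈ A deg S 0 :=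
  bch_mem_A (le_mem_A h) ((A deg S 0).neg_mem (le_mem_A h'))

theorem halfFace_mem_A {i : ZMod n} (h : .e i ∈ S) (h' : .e (i + 1) ∈ S) :
    halfFace i ∈ A deg S 0 :=
  (A deg S 0).smul_mem _ (mu2_mem_A (le_mem_A h) (le_mem_A h'))

theorem halfMain_mem_A {μ : Ser (ZMod n)} (hμ : μ ∈ A (fun _ => 0) Set.univ 0)
    (h : ∀ i, .e i ∈ S) : halfMain μ ∈ A deg S 0 :=
  (A deg S 0).smul_mem _ (subst_mem_A (fun i => le_mem_A (h i)) hμ)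

omit [NeZero n] in
theorem loop_mem (i : ZMod n) : loop i ∈ Fil (BananaCell n) 1 :=
  bch_mem (le_mem _) ((Fil _ 1).neg_mem (le_mem _))

omit [NeZero n] in
theorem loopsFrom_mem (k : ZMod n) (j : Fin (n - 1)) : loopsFrom k j ∈ Fil (BananaCell n) 1 :=
  loop_mem _

theorem halfFace_mem (i : ZMod n) : halfFace i ∈ Fil (BananaCell n) 1 :=
  A_mem_Fil (halfFace_mem_A (S := Set.univ) trivial trivial)

omit [NeZero n] in
theorem exp_loop (i : ZMod n) : exp (loop i) = exp (le i) * exp (-le (i + 1)) :=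
  exp_bch (le_mem _) ((Fil _ 1).neg_mem (le_mem _))

omit [NeZero n] in
theorem neg_loop_eq (k : ZMod n) : -loop k = bch (le (k + 1)) (-le k) := by
  rw [loop, neg_bch (le_mem _) ((Fil _ 1).neg_mem (le_mem _)), neg_neg]

/-- The product of the exponentials telescopes to `exp eₖ₊₁ * exp (-eₖ)`: going round all `n` loops
is trivial, so the other `n - 1` compose to the inverse of loop `k`. -/
theorem bchList_loopsFrom (k : ZMod n) : bchList (List.ofFn (loopsFrom k)) = -loop k := by
  have hl : ∀ f ∈ List.ofFn (loopsFrom k), f ∈ Fil (BananaCell n) 1 := fun f hf => by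
    obtain ⟨j, rfl⟩ := (List.mem_ofFn' _ _).mp hf
    exact loopsFrom_mem k j
  rw [neg_loop_eq]
  have hn := (Fil (BananaCell n) 1).neg_mem (le_mem k)
  refine exp_injective (bchList_mem hl) (bch_mem (le_mem _) hn) ?_
  rw [exp_bchList hl, exp_bch (le_mem _) hn, List.map_ofFn]
  have := prod_ofFn_telescope (fun t => exp (le (((t + 1 : ℕ) : ZMod n) + k)))
    (fun t => exp (-le (((t + 1 : ℕ) : ZMod n) + k))) (fun t => exp_neg_mul_exp (le_mem _)) (n - 1) 0
  have e : (fun j : Fin (n - 1) => exp (le (((j + 0 + 1 : ℕ) : ZMod n) + k))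
      * exp (-le (((j + 0 + 1 + 1 : ℕ) : ZMod n) + k))) = exp ∘ loopsFrom k := by
    funext j
    rw [Function.comp_apply, loopsFrom, exp_loop]
    push_cast
    rw [show (j : ZMod n) + 0 + 1 + 1 + k = (j : ZMod n) + 1 + k + 1 by ring, add_zero]
  rw [e] at this
  have h0 : ((0 + (n - 1) + 1 : ℕ) : ZMod n) + k = k := by
    rw [zero_add, Nat.sub_add_cancel (NeZero.one_le), ZMod.natCast_self, zero_add]
  rw [h0, zero_add, Nat.cast_one, add_comm 1 k] at this
  rw [← this, mul_assoc, exp_mul_exp_neg (le_mem k), mul_one]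

/-- Conjugation by the exponential of half of `vᵢ` carries the boundary loop of a face from its
centre to the vertex `a`. -/
theorem conj_bchList (i : ZMod n) :
    exp (halfFace i) * bchList [-halfFace i, le i, -le (i + 1), halfFace i] * exp (-halfFace i)
      = loop i := by
  have hw := halfFace_mem i
  have hl : ∀ f ∈ [-halfFace i, le i, -le (i + 1), halfFace i], f ∈ Fil (BananaCell n) 1 := by
    simp [hw, le_mem]
  refine exp_injective (conj_mem _ _ (bchList_mem hl)) (loop_mem i) ?_
  rw [exp_conj (exp_neg_mul_exp hw) (exp_mul_exp_neg hw) (bchList_mem hl), exp_bchList hl, exp_loop]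
  have e : ∀ u v p q : Ser (BananaCell n), u * v = 1 →
      u * ([v, p, q, u].prod) * v = p * q := fun u v p q h => by
    rw [List.prod_cons, List.prod_cons, List.prod_cons, List.prod_cons, List.prod_nil, mul_one,
      ← mul_assoc, h, one_mul, mul_assoc, mul_assoc, h, mul_one]
  exact e _ _ _ _ (exp_mul_exp_neg hw)

end

/-- The differential twisted by `a`. -/
abbrev twist (δ : Ser (BananaCell n) →ₗ[ℚ] Ser (BananaCell n)) :
    Ser (BananaCell n) →ₗ[ℚ] Ser (BananaCell n) := δ + br deg (letter .a)

/-- The equation relating the series `Pᵢ` to the boundaries of faces. -/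
theorem sum_loop_eq_zero {P : ZMod n → Ser (Fin (n - 1))}
    (h : ∑ j : Fin (n - 1), opW (P ((j + 1 : ℕ) : ZMod n)) (fun j => ad (letter j)) (letter j)
      = opW (P 0) (fun j => ad (letter j)) (bchList (List.ofFn letter))) :
    ∑ i, opW (P i) (fun j => ad (loopsFrom 0 j)) (loop i) = 0 := by
  have hom := isHom_subst (loopsFrom_mem (n := n) 0)
  have hm : ∀ (Q z : Ser (Fin (n - 1))), substL (loopsFrom 0) (opW Q (fun j => ad (letter j)) z)
      = opW Q (fun j => ad (loopsFrom 0 j)) (substL (loopsFrom 0) z) := fun Q z =>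
    map_opW (fun j => raises_ad (letter_mem j)) (fun j => raises_ad (loopsFrom_mem 0 j))
      (fun j z => by
        rw [ad_apply, ad_apply, map_sub, hom.map_mul, hom.map_mul, substL_apply (loopsFrom 0)
          (letter j), subst_letter (loopsFrom_mem 0)]) Q z
  have h' := congrArg (substL (loopsFrom (n := n) 0)) h
  rw [map_sum, hm, hom.map_bchList (fun f hf => by
    obtain ⟨j, rfl⟩ := (List.mem_ofFn' _ _).mp hf
    exact letter_mem j), List.map_ofFn] at h'
  have e : (substL (loopsFrom (n := n) 0)) ∘ letter = loopsFrom 0 :=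
    funext fun j => subst_letter (loopsFrom_mem 0) j
  rw [e, bchList_loopsFrom, map_neg] at h'
  -- The term of index `0 = n` comes from the right side of the boundary condition, where BCH of the
  -- other loops is `-loop 0`.
  rw [sum_zmod, add_comm, ← eq_neg_iff_add_eq_zero, ← h']
  refine Finset.sum_congr rfl fun j _ => ?_
  rw [hm, substL_apply, subst_letter (loopsFrom_mem 0), loopsFrom, add_zero]

namespace SerModel

variable {P : ZMod n → Ser (Fin (n - 1))} {μ : Ser (ZMod n)}
  {δ : Ser (BananaCell n) →ₗ[ℚ] Ser (BananaCell n)} (hδ : SerModel P μ δ)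
include hδ

/-- The edge formula is the flow equation solved for `∂eᵢ`: applying `flowS` cancels the Bernoulli
series and leaves `b - e^{-ad} a`. -/
theorem flow_le (i : ZMod n) : flow δ (le i) (letter .a) = letter .b := by
  have hT := raises_ad (le_mem i)
  rw [flow, hδ.edge, map_sub, opS_flow_bern hT, opS_mul hT, Module.End.mul_apply,
    opS_flow_bern hT]
  abel

theorem edge_mem_A {S : Set (BananaCell n)} {i : ZMod n} (ha : .a ∈ S) (hb : .b ∈ S)
    (hi : .e i ∈ S) : δ (le i) ∈ A deg S (-1) := by
  rw [hδ.edge]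
  exact (A deg S (-1)).sub_mem (opS_ad_mem_A (le_mem_A hi) (letter_mem_A (deg := deg) hb) _)
    (opS_ad_mem_A (le_mem_A hi) (letter_mem_A (deg := deg) ha) _)

theorem isDer_twist : IsDer LinearMap.id (sgn deg 1) (twist δ) :=
  hδ.odd.der.add (isDer_br a_mem_Hom)

/-- The loop goes from `a` to `b` along one edge and back along the next; an element flowing from
`a` to itself is closed for the differential twisted at `a`. -/
theorem twist_loop (i : ZMod n) : twist δ (loop i) = 0 := by
  have h := le_mem_A (n := n) (S := Set.univ) (i := i) trivial
  have h' := le_mem_A (n := n) (S := Set.univ) (i := i + 1) trivial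
  have hl := loop_mem_A (n := n) (S := Set.univ) (i := i) trivial trivial
  rw [← flow_self_iff hδ.odd.der a_mem_Hom (A_mem_Fil hl) hl.1, loop,
    flow_bch hδ.odd.der h ((A deg Set.univ 0).neg_mem h'), hδ.flow_le, ← hδ.flow_le (i + 1),
    flow_neg hδ.odd.der (A_mem_Fil h') h'.1]

theorem twist_face' (i : ZMod n) : twist δ (face' i) = loop i := by
  have hw := halfFace_mem_A (n := n) (S := Set.univ) (i := i) trivial trivial
  rw [face', twist_conj hδ.odd a_mem_Hom (A_mem_Fil hw) hw.1, hδ.face, sub_add_cancel,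
    conj_bchList]

theorem twist_solid' (hμ : μ ∈ A (fun _ => 0) Set.univ 0) :
    twist δ (solid' μ) = bdrySum P := by
  have hw := halfMain_mem_A (n := n) (S := Set.univ) hμ fun _ => trivial
  have h1 := exp_mul_exp_neg (A_mem_Fil hw)
  rw [solid', twist_conj hδ.odd a_mem_Hom (A_mem_Fil hw) hw.1, hδ.solid, ← mul_assoc, ← mul_assoc,
    h1, one_mul, mul_assoc, h1, mul_one]

/-- The loops are even and closed, so their adjoint operators commute with the twisted differential.
-/
theorem twist_opW (Q : Ser (Fin (n - 1))) (z : Ser (BananaCell n)) :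
    twist δ (opW Q (fun j => ad (loopsFrom 0 j)) z)
      = opW Q (fun j => ad (loopsFrom 0 j)) (twist δ z) :=
  hδ.isDer_twist.map_opW_ad
    (fun _ => (loop_mem_A (n := n) (S := Set.univ) trivial trivial).1)
    (fun j => loopsFrom_mem 0 j) (fun _ => hδ.twist_loop _) Q z

theorem sq_vertex {x : Ser (BananaCell n)} (hx : x ∈ Hom deg (-1)) (h : δ x = -(x * x)) :
    δ (δ x) = 0 := by
  have hs : sgn deg 1 x = -x := by rw [sgn_of_mem hx]; norm_num
  rw [h, map_neg, hδ.odd.der.leibniz, hs, h, LinearMap.id_apply]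
  noncomm_ring

/-- Applying `δ` to `exp e * b - a * exp e` and using the Maurer-Cartan equations gives zero. A
derivation that kills `exp e` kills `e`. -/
theorem sq_edge (i : ZMod n) : δ (δ (le i)) = 0 := by
  have he := le_mem_A (n := n) (S := Set.univ) (i := i) trivial
  refine hδ.odd.isDer_sq.eq_zero_of_exp isHom_id isHom_id (A_mem_Fil he) rfl ?_
  have h := (flow_eq_iff hδ.odd.der (A_mem_Fil he) he.1).mp (hδ.flow_le i)
  have hs : sgn deg 1 (letter .a : Ser (BananaCell n)) = -letter .a := by
    rw [sgn_of_mem a_mem_Hom]; norm_num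
  rw [LinearMap.comp_apply, h, map_sub, hδ.odd.der.leibniz, hδ.odd.der.leibniz, h, hs,
    sgn_even (exp_mem_Hom (A_mem_Fil he) he.1), hδ.vertex_a, hδ.vertex_b, LinearMap.id_apply,
    LinearMap.id_apply]
  noncomm_ring

theorem sq_of_mem_edges {S : Set (BananaCell n)} (hS : ∀ x ∈ S, ∃ i, x = .e i) {z : Ser _}
    (hz : z ∈ Lie deg S) : (δ ∘ₗ δ) z = 0 :=
  hδ.odd.isDer_sq.eq_zero_of_mem_Lie (deg := deg) (fun x hx => by
    obtain ⟨i, rfl⟩ := hS x hx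
    exact hδ.sq_edge i) hz

/-- The elements `vᵢ` and `v` are Lie series in the edges, hence killed by `δ²`, so `f i` and `h`
may be replaced by `f'ᵢ` and `h'`. There `δ²` is the square of the twisted differential, whose
values are explicit. -/
theorem sq_eq_zero (hμ : μ ∈ A (fun _ => 0) Set.univ 0)
    (h : ∑ i, opW (P i) (fun j => ad (loopsFrom 0 j)) (loop i) = 0) : δ ∘ₗ δ = 0 := by
  have tw := fun z => twist_sq hδ.odd a_mem_Hom hδ.vertex_a z
  refine hδ.odd.isDer_sq.eq_zero_of_letters isHom_id isHom_id fun x => ?_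
  match x with
  | .a => exact hδ.sq_vertex a_mem_Hom hδ.vertex_a
  | .b => exact hδ.sq_vertex b_mem_Hom hδ.vertex_b
  | .e i => exact hδ.sq_edge i
  | .f i =>
    have hw := halfFace_mem_A (n := n) (S := Set.range fun i => .e i) (i := i) ⟨_, rfl⟩ ⟨_, rfl⟩
    refine hδ.odd.isDer_sq.eq_zero_of_conj isHom_id isHom_id (halfFace_mem i)
      (hδ.sq_of_mem_edges (by rintro _ ⟨i, rfl⟩; exact ⟨i, rfl⟩) hw.2) ?_
    show δ (δ (face' i)) = 0
    rw [← tw, hδ.twist_face', hδ.twist_loop]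
  | .h =>
    have hw := halfMain_mem_A (n := n) (S := Set.range fun i => .e i) hμ fun i => ⟨i, rfl⟩
    refine hδ.odd.isDer_sq.eq_zero_of_conj isHom_id isHom_id (A_mem_Fil hw)
      (hδ.sq_of_mem_edges (by rintro _ ⟨i, rfl⟩; exact ⟨i, rfl⟩) hw.2) ?_
    show δ (δ (solid' μ)) = 0
    rw [← tw, hδ.twist_solid' hμ, bdrySum, map_sum, ← h]
    exact Finset.sum_congr rfl fun i _ => by rw [hδ.twist_opW, hδ.twist_face']

end SerModel

end Ser

/-! ### Existence, uniqueness and locality of the differential; translation of its formulae. -/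

namespace Ser

theorem conj_mem_A {X : Type} {deg : X → ℤ} {S : Set X} {k : ℤ} {w z : Ser X}
    (hw : w ∈ A deg S 0) (hz : z ∈ A deg S k) : exp w * z * exp (-w) ∈ A deg S k := by
  rw [← opS_exp_ad (A_mem_Fil hw)]
  exact opS_ad_mem_A hw hz _

/-- A linear map on series, as a map on families of coefficients. -/
def ofSerMap {X Y : Type} (δ : Ser X →ₗ[ℚ] Ser Y) : NC X →ₗ[ℚ] NC Y where
  toFun f := δ (toSer f)
  map_add' f g := map_add δ (toSer f) (toSer g)
  map_smul' c f := map_smul δ c (toSer f)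

theorem br_mem_A_of_eq {X : Type} {deg : X → ℤ} {S : Set X} {p q r : ℤ} {f g : Ser X}
    (h : p + q = r) (hf : f ∈ A deg S p) (hg : g ∈ A deg S q) : br deg f g ∈ A deg S r :=
  h ▸ br_mem_A hf hg

variable {n : ℕ} [NeZero n]

section
variable {S : Set (BananaCell n)}

theorem a_mem_A (h : .a ∈ S) : letter .a ∈ A deg S (-1) := letter_mem_A (deg := deg) h
theorem b_mem_A (h : .b ∈ S) : letter .b ∈ A deg S (-1) := letter_mem_A (deg := deg) h
theorem f_mem_A {i : ZMod n} (h : .f i ∈ S) : letter (.f i) ∈ A deg S 1 :=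
  letter_mem_A (deg := deg) h
theorem h_mem_A (h : .h ∈ S) : letter .h ∈ A deg S 2 := letter_mem_A (deg := deg) h

end

/-- The edges of the banana. -/
def edges (n : ℕ) : Set (BananaCell n) := Set.range fun i => .e i

omit [NeZero n] in
theorem e_mem_edges (i : ZMod n) : .e i ∈ edges n := ⟨i, rfl⟩

section
variable {P : ZMod n → Ser (Fin (n - 1))} {μ : Ser (ZMod n)}

theorem bdrySum_mem_A : bdrySum P ∈ A deg Set.univ 1 :=
  Submodule.sum_mem _ fun _ _ => opW_ad_mem_A
    (fun _ => loop_mem_A (S := Set.univ) (Set.mem_univ _) (Set.mem_univ _))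
    (conj_mem_A (S := Set.univ) (halfFace_mem_A (Set.mem_univ _) (Set.mem_univ _))
      (f_mem_A (Set.mem_univ _))) _

theorem solidTerm_mem_A (hμ : μ ∈ A (fun _ => 0) Set.univ 0) :
    exp (-halfMain μ) * bdrySum P * exp (halfMain μ) ∈ A deg Set.univ 1 := by
  have := conj_mem_A ((A deg Set.univ 0).neg_mem
    (halfMain_mem_A (n := n) hμ fun _ => trivial)) (bdrySum_mem_A (P := P))
  rwa [neg_neg] at this

theorem faceTerm_mem_A {S : Set (BananaCell n)} {i : ZMod n} (h : .e i ∈ S) (h' : .e (i + 1) ∈ S) :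
    bchList [-halfFace i, le i, -le (i + 1), halfFace i] ∈ A deg S 0 :=
  bchList_mem_A (by
    simp only [List.mem_cons, List.not_mem_nil, or_false, forall_eq_or_imp, forall_eq]
    exact ⟨Submodule.neg_mem _ (halfFace_mem_A h h'), le_mem_A h,
      Submodule.neg_mem _ (le_mem_A h'), halfFace_mem_A h h'⟩)

theorem edgeTerm_mem_A {S : Set (BananaCell n)} {i : ZMod n} (ha : .a ∈ S) (hb : .b ∈ S)
    (hi : .e i ∈ S) : opS bernS (ad (le i)) (letter .b)
      - opS (bernS * expNegS) (ad (le i)) (letter .a) ∈ A deg S (-1) :=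
  (A deg S (-1)).sub_mem (opS_ad_mem_A (le_mem_A hi) (b_mem_A hb) _)
    (opS_ad_mem_A (le_mem_A hi) (a_mem_A ha) _)

theorem vertexTerm_eq {x : Ser (BananaCell n)} (hx : x ∈ Hom deg (-1)) :
    -(x * x) = -((1 / 2 : ℚ) • br deg x x) := by
  rw [br_of_mem_mem hx hx, show (-1 : ℚ) ^ ((-1 : ℤ) * -1) = -1 by norm_num, neg_one_smul,
    sub_neg_eq_add, ← two_smul ℚ (x * x), smul_smul]
  norm_num

theorem vertexTerm_mem_A {S : Set (BananaCell n)} {x : Ser (BananaCell n)} (hx : x ∈ A deg S (-1)) :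
    -(x * x) ∈ A deg S (-2) := by
  rw [vertexTerm_eq hx.1]
  exact Submodule.neg_mem _ (Submodule.smul_mem _ _ (br_mem_A_of_eq rfl hx hx))

/-- A flow along a Lie series in the edges depends on the differential only through its values on
edges. Hence the centres in the formulae for faces and solid are already determined by the edge
formula. -/
theorem flow_congr_edges {δ δ' : Ser (BananaCell n) →ₗ[ℚ] Ser (BananaCell n)} (hδ : OddDer deg δ)
    (hδ' : OddDer deg δ') (h : ∀ i, δ (le i) = δ' (le i)) {w : Ser (BananaCell n)}
    (hw : w ∈ A deg (edges n) 0) (a : Ser (BananaCell n)) : flow δ w a = flow δ' w a := by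
  rw [flow, flow, sub_eq_zero.mp ((hδ.der.sub hδ'.der).eq_zero_of_mem_Lie (deg := deg) (fun x hx => by
    obtain ⟨i, rfl⟩ := hx
    exact sub_eq_zero.mpr (h i)) hw.2)]

namespace SerModel

variable {δ : Ser (BananaCell n) →ₗ[ℚ] Ser (BananaCell n)} (hδ : SerModel P μ δ)
include hδ

theorem locality (hμ : μ ∈ A (fun _ => 0) Set.univ 0) (c : BananaCell n) :
    δ (letter c) ∈ A deg (Banana.closure c) (deg c - 1) := by
  -- A flow from `a` along `w` only involves `a`, `w` and `∂w`, so it stays in the Lie algebra of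
  -- the vertices and of the edges `S'` occurring in `w`.
  have hfl : ∀ {S : Set (BananaCell n)} {w S'}, .a ∈ S → .b ∈ S → S' ⊆ S → S' ⊆ edges n →
      w ∈ A deg S' 0 → flow δ w (letter .a) ∈ A deg S (-1) := fun {S w S'} ha hb hS hS' hw =>
    flow_mem_A (A_mono hS hw) (a_mem_A ha) (hδ.odd.map_A hS (fun x hx => by
      obtain ⟨i, rfl⟩ := hS' hx
      exact (hδ.edge_mem_A ha hb (hS hx)).2) hw)
  match c with
  | .a =>
    rw [hδ.vertex_a]
    exact vertexTerm_mem_A (a_mem_A rfl)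
  | .b =>
    rw [hδ.vertex_b]
    exact vertexTerm_mem_A (b_mem_A rfl)
  | .e i => exact hδ.edge_mem_A (Or.inl rfl) (Or.inr (Or.inl rfl)) (Or.inr (Or.inr rfl))
  | .f i =>
    rw [hδ.face]
    have h1 : .e i ∈ Banana.closure (.f i : BananaCell n) := Or.inr (Or.inr (Or.inl rfl))
    have h2 : .e (i + 1) ∈ Banana.closure (.f i : BananaCell n) :=
      Or.inr (Or.inr (Or.inr (Or.inl rfl)))
    have h3 : .f i ∈ Banana.closure (.f i : BananaCell n) :=
      Or.inr (Or.inr (Or.inr (Or.inr rfl)))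
    exact (A deg (Banana.closure (.f i)) 0).sub_mem (faceTerm_mem_A h1 h2) (br_mem_A_of_eq (by norm_num)
      (hfl (S' := {.e i, .e (i + 1)}) (Or.inl rfl) (Or.inr (Or.inl rfl))
        (by rintro x (rfl | rfl); exacts [h1, h2])
        (by rintro x (rfl | rfl); exacts [⟨_, rfl⟩, ⟨_, rfl⟩])
        (halfFace_mem_A (Or.inl rfl) (Or.inr rfl))) (f_mem_A h3))
  | .h =>
    rw [eq_sub_of_add_eq hδ.solid]
    exact (A deg Set.univ 1).sub_mem (solidTerm_mem_A hμ) (br_mem_A_of_eq (by norm_num)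
      (hfl (S' := edges n) trivial trivial (Set.subset_univ _) le_rfl
        (halfMain_mem_A hμ e_mem_edges))
      (h_mem_A trivial))

theorem map_A (hμ : μ ∈ A (fun _ => 0) Set.univ 0) {k : ℤ} {z : Ser (BananaCell n)}
    (hz : z ∈ A deg Set.univ k) : δ z ∈ A deg Set.univ (k - 1) :=
  hδ.odd.map_A le_rfl (fun x _ => (A_mono (Set.subset_univ _) (hδ.locality hμ x)).2) hz

theorem unique (hμ : μ ∈ A (fun _ => 0) Set.univ 0)
    {δ' : Ser (BananaCell n) →ₗ[ℚ] Ser (BananaCell n)} (hδ' : SerModel P μ δ') : δ = δ' := by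
  have he : ∀ i, δ (le i) = δ' (le i) := fun i => by rw [hδ.edge, hδ'.edge]
  have hfl := fun {w} hw a => flow_congr_edges hδ.odd hδ'.odd he (w := w) hw a
  refine hδ.odd.der.ext isHom_id (isHom_sgn _ _) hδ'.odd.der fun x => ?_
  match x with
  | .a => rw [hδ.vertex_a, hδ'.vertex_a]
  | .b => rw [hδ.vertex_b, hδ'.vertex_b]
  | .e i => exact he i
  | .f i =>
    rw [hδ.face, hδ'.face, hfl (halfFace_mem_A (e_mem_edges _) (e_mem_edges _))]
  | .h =>
    rw [eq_sub_of_add_eq hδ.solid, eq_sub_of_add_eq hδ'.solid, hfl (halfMain_mem_A hμ e_mem_edges)]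

end SerModel

/-- The values of the differential on vertices and edges. -/
def edgeData : BananaCell n → Ser (BananaCell n)
  | .a => -(letter .a * letter .a)
  | .b => -(letter .b * letter .b)
  | .e i => opS bernS (ad (le i)) (letter .b) - opS (bernS * expNegS) (ad (le i)) (letter .a)
  | .f _ => 0
  | .h => 0

/-- The values of the differential on all cells. -/
def cellData (P : ZMod n → Ser (Fin (n - 1))) (μ : Ser (ZMod n)) :
    BananaCell n → Ser (BananaCell n)
  | .f i => bchList [-halfFace i, le i, -le (i + 1), halfFace i]
      - br deg (flow (derivExt deg edgeData) (halfFace i) (letter .a)) (letter (.f i))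
  | .h => exp (-halfMain μ) * bdrySum P * exp (halfMain μ)
      - br deg (flow (derivExt deg edgeData) (halfMain μ) (letter .a)) (letter .h)
  | c => edgeData c

theorem edgeData_mem_A (c : BananaCell n) : edgeData c ∈ A deg Set.univ (deg c - 1) :=
  match c with
  | .a => vertexTerm_mem_A (a_mem_A trivial)
  | .b => vertexTerm_mem_A (b_mem_A trivial)
  | .e _ => edgeTerm_mem_A trivial trivial trivial
  | .f _ => Submodule.zero_mem _
  | .h => Submodule.zero_mem _

theorem oddDer_edgeData : OddDer deg (derivExt deg (edgeData (n := n))) :=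
  oddDer_derivExt (fun c => A_mem_Fil (edgeData_mem_A c)) fun c => (edgeData_mem_A c).1

theorem cellData_mem_A (hμ : μ ∈ A (fun _ => 0) Set.univ 0) (c : BananaCell n) :
    cellData P μ c ∈ A deg Set.univ (deg c - 1) := by
  have hfl : ∀ {w : Ser (BananaCell n)}, w ∈ A deg Set.univ 0 →
      flow (derivExt deg edgeData) w (letter .a) ∈ A deg Set.univ (-1) := fun hw =>
    flow_mem_A hw (a_mem_A trivial) (oddDer_edgeData.map_A le_rfl (fun x _ => by
      rw [derivExt_letter]
      exact (edgeData_mem_A x).2) hw)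
  match c with
  | .a => exact edgeData_mem_A .a
  | .b => exact edgeData_mem_A .b
  | .e i => exact edgeData_mem_A (.e i)
  | .f i =>
    exact (A deg Set.univ 0).sub_mem (faceTerm_mem_A trivial trivial) (br_mem_A_of_eq (by norm_num)
      (hfl (halfFace_mem_A trivial trivial)) (f_mem_A trivial))
  | .h =>
    exact (A deg Set.univ 1).sub_mem (solidTerm_mem_A hμ) (br_mem_A_of_eq (by norm_num)
      (hfl (halfMain_mem_A hμ fun _ => trivial)) (h_mem_A trivial))

theorem exists_serModel (P : ZMod n → Ser (Fin (n - 1))) (hμ : μ ∈ A (fun _ => 0) Set.univ 0) :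
    ∃ δ, SerModel P μ δ := by
  have odd : OddDer deg (derivExt deg (cellData P μ)) :=
    oddDer_derivExt (fun c => A_mem_Fil (cellData_mem_A hμ c)) fun c => (cellData_mem_A hμ c).1
  -- The values on faces and solid were built from the flows of the derivation given by `edgeData`.
  -- The final derivation has the same values on edges, hence the same flows, and so satisfies its
  -- own formulae.
  have hfl := fun {w} hw a => flow_congr_edges odd oddDer_edgeData
    (fun i => (derivExt_letter _ _ (BananaCell.e i)).trans
      (derivExt_letter deg edgeData (BananaCell.e i)).symm) (w := w) hw a
  refine ⟨derivExt deg (cellData P μ), odd, derivExt_letter _ _ _, derivExt_letter _ _ _,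
    fun i => derivExt_letter _ _ _, fun i => ?_, ?_⟩
  · rw [hfl (halfFace_mem_A (e_mem_edges _) (e_mem_edges _)), derivExt_letter]
    rfl
  · rw [hfl (halfMain_mem_A hμ e_mem_edges), derivExt_letter]
    exact sub_add_cancel _ _

end

/-! ### Translation of the formulae -/

section
variable {P : ZMod n → NC (Fin (n - 1))} {μ : NC (ZMod n)}
  {D : NC (BananaCell n) →ₗ[ℚ] NC (BananaCell n)}
  {δ : Ser (BananaCell n) →ₗ[ℚ] Ser (BananaCell n)}

omit [NeZero n] in
theorem toSer_halfFace (i : ZMod n) : toSer ((1 / 2 : ℚ) • vFace i) = halfFace i := by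
  rw [map_smul, vFace, toSer_mu2]; rfl

theorem toSer_halfMain (μ : NC (ZMod n)) :
    toSer ((1 / 2 : ℚ) • vMain μ) = halfMain (toSer μ) := by
  rw [map_smul, vMain, toSer_subst (y := fun i => gen (.e i)) μ fun i => letter_mem _]; rfl

theorem toSer_expAd_halfFace (i : ZMod n) (z : NC (BananaCell n)) :
    toSer (NC.expAd deg ((1 / 2 : ℚ) • vFace i) z)
      = exp (halfFace i) * toSer z * exp (-halfFace i) := by
  have h : toSer ((1 / 2 : ℚ) • vFace i) ∈ A deg Set.univ 0 := by
    rw [toSer_halfFace]; exact halfFace_mem_A trivial trivial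
  rw [toSer_expAd (A_mem_Fil h) h.1, toSer_halfFace]

theorem toSer_expAd_neg_halfFace (i : ZMod n) (z : NC (BananaCell n)) :
    toSer (NC.expAd deg (-((1 / 2 : ℚ) • vFace i)) z)
      = exp (-halfFace i) * toSer z * exp (halfFace i) := by
  have h : toSer (-((1 / 2 : ℚ) • vFace i)) ∈ A deg Set.univ 0 := by
    rw [map_neg, toSer_halfFace]; exact Submodule.neg_mem _ (halfFace_mem_A trivial trivial)
  rw [toSer_expAd (A_mem_Fil h) h.1, map_neg, toSer_halfFace, neg_neg]

theorem toSer_expAd_halfMain (hμ : toSer μ ∈ A (fun _ => 0) Set.univ 0) (z : NC (BananaCell n)) :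
    toSer (NC.expAd deg ((1 / 2 : ℚ) • vMain μ) z)
      = exp (halfMain (toSer μ)) * toSer z * exp (-halfMain (toSer μ)) := by
  have h : toSer ((1 / 2 : ℚ) • vMain μ) ∈ A deg Set.univ 0 := by
    rw [toSer_halfMain]; exact halfMain_mem_A hμ fun _ => trivial
  rw [toSer_expAd (A_mem_Fil h) h.1, toSer_halfMain]

theorem toSer_expAd_neg_halfMain (hμ : toSer μ ∈ A (fun _ => 0) Set.univ 0)
    (z : NC (BananaCell n)) : toSer (NC.expAd deg (-((1 / 2 : ℚ) • vMain μ)) z)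
      = exp (-halfMain (toSer μ)) * toSer z * exp (halfMain (toSer μ)) := by
  have h : toSer (-((1 / 2 : ℚ) • vMain μ)) ∈ A deg Set.univ 0 := by
    rw [map_neg, toSer_halfMain]
    exact Submodule.neg_mem _ (halfMain_mem_A hμ fun _ => trivial)
  rw [toSer_expAd (A_mem_Fil h) h.1, map_neg, toSer_halfMain, neg_neg]

omit [NeZero n] in
theorem toSer_loops (j : Fin (n - 1)) : toSer (loops j) = loopsFrom 0 j := by
  rw [loops, toSer_bch, map_neg, loopsFrom, loop, add_zero,
    show ((j + 1 : ℕ) : ZMod n) + 1 = ((j + 2 : ℕ) : ZMod n) by push_cast; ring]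
  rfl

theorem toSer_actLoops (p : NC (Fin (n - 1))) (z : NC (BananaCell n)) :
    toSer (actLoops p z) = opW (toSer p) (fun j => ad (loopsFrom 0 j)) (toSer z) := by
  have h : ∀ j, toSer (loops (n := n) j) ∈ A deg Set.univ 0 := fun j => by
    rw [toSer_loops]; exact loop_mem_A trivial trivial
  rw [actLoops, toSer_act p (fun j => A_mem_Fil (h j)) fun j => (h j).1]
  simp only [toSer_loops]

theorem toSer_fTwist (i : ZMod n) : toSer (fTwist i) = face' i := toSer_expAd_halfFace i _

theorem toSer_hTwist (hμ : toSer μ ∈ A (fun _ => 0) Set.univ 0) :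
    toSer (hTwist μ) = solid' (toSer μ) := toSer_expAd_halfMain hμ _

theorem toSer_sum_actLoops (P : ZMod n → NC (Fin (n - 1))) :
    toSer (∑ i, actLoops (P i) (fTwist i)) = bdrySum fun i => toSer (P i) := by
  rw [map_sum, bdrySum]
  exact Finset.sum_congr rfl fun i _ => by rw [toSer_actLoops, toSer_fTwist]

theorem toSer_edgeTerm (i : ZMod n) :
    toSer (NC.adSeries deg (fun k => -(bernoulli k / (k.factorial : ℚ))) (gen (.e i)) (gen .a)
      + NC.adSeries deg (fun k => bernoulli' k / (k.factorial : ℚ)) (gen (.e i)) (gen .b))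
    = opS bernS (ad (le i)) (letter .b) - opS (bernS * expNegS) (ad (le i)) (letter .a) := by
  have h : toSer (gen (.e i) : NC (BananaCell n)) ∈ Hom deg 0 := (le_mem_A (S := Set.univ) trivial).1
  rw [map_add, toSer_adSeries _ h, toSer_adSeries _ h, ← bernoulliPowerSeries_eq,
    show PowerSeries.mk (fun k => -(bernoulli k / (k.factorial : ℚ))) = -bernoulliPowerSeries ℚ by
      ext k; simp [bernoulliPowerSeries],
    show PowerSeries.mk (fun k => bernoulli' k / (k.factorial : ℚ)) = bernS by
      ext k; simp [bernoulli'PowerSeries], opS_neg, LinearMap.neg_apply, neg_add_eq_sub]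
  rfl

omit [NeZero n] in
theorem toSer_faceTerm (i : ZMod n) :
    toSer (NC.bchList [-((1 / 2 : ℚ) • vFace i), gen (.e i), -gen (.e (i + 1)),
      (1 / 2 : ℚ) • vFace i]) = bchList [-halfFace i, le i, -le (i + 1), halfFace i] := by
  rw [toSer_bchList, List.map_cons, List.map_cons, List.map_cons, List.map_cons, List.map_nil,
    map_neg, map_neg, toSer_halfFace]
  rfl

theorem toSer_flow_of_agree
    (hD : ∀ k, ∀ z : NC (BananaCell n), toSer z ∈ A deg Set.univ k → toSer (D z) = δ (toSer z))
    {e : NC (BananaCell n)} (he : toSer e ∈ A deg Set.univ 0) (a : NC (BananaCell n)) :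
    toSer (NC.flow deg D e a) = flow δ (toSer e) (toSer a) := by
  rw [toSer_flow D he.1, flow, flow, ← toSer_map, hD 0 e he]

theorem toSer_xFace
    (hD : ∀ k, ∀ z : NC (BananaCell n), toSer z ∈ A deg Set.univ k → toSer (D z) = δ (toSer z))
    (i : ZMod n) : toSer (xFace D i) = flow δ (halfFace i) (letter .a) := by
  rw [xFace, toSer_flow_of_agree hD, toSer_halfFace]; · rfl
  rw [toSer_halfFace]; exact halfFace_mem_A trivial trivial

theorem toSer_xMain (hμ : toSer μ ∈ A (fun _ => 0) Set.univ 0)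
    (hD : ∀ k, ∀ z : NC (BananaCell n), toSer z ∈ A deg Set.univ k → toSer (D z) = δ (toSer z)) :
    toSer (xMain D μ) = flow δ (halfMain (toSer μ)) (letter .a) := by
  rw [xMain, toSer_flow_of_agree hD, toSer_halfMain]; · rfl
  rw [toSer_halfMain]; exact halfMain_mem_A hμ fun _ => trivial

theorem toSer_solidTerm (hμ : toSer μ ∈ A (fun _ => 0) Set.univ 0) :
    toSer (NC.expAd deg (-((1 / 2 : ℚ) • vMain μ)) (∑ i : ZMod n, actLoops (P i)
      (NC.expAd deg ((1 / 2 : ℚ) • vFace i) (gen (.f i)))))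
    = exp (-halfMain (toSer μ)) * bdrySum (fun i => toSer (P i)) * exp (halfMain (toSer μ)) := by
  rw [toSer_expAd_neg_halfMain hμ, ← toSer_sum_actLoops]
  rfl

/-- The formulae for `D` amount to the formulae for a derivation that agrees with `D` on Lie
series. -/
theorem serModel_iff (hμ : toSer μ ∈ A (fun _ => 0) Set.univ 0) (hδ : OddDer deg δ)
    (hD : ∀ k, ∀ z : NC (BananaCell n), toSer z ∈ A deg Set.univ k → toSer (D z) = δ (toSer z))
    (hder : IsGradedDerivation (NC.lieSeries deg) (NC.bracket deg) D)
    (hfil : PreservesBracketFiltration deg D) :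
    IsSymmetricDifferential P μ D ↔ SerModel (fun i => toSer (P i)) (toSer μ) δ := by
  have hgen : ∀ c, toSer (D (gen c)) = δ (letter c) := fun c =>
    hD _ (gen c) (letter_mem_A (deg := deg) trivial)
  have hv : ∀ c : BananaCell n, deg c = -1 → toSer (-((1 / 2 : ℚ) • Banana.br (gen c) (gen c)))
      = -(letter c * letter c) := fun c hc => by
    have h : letter c ∈ Hom deg (-1) := hc ▸ letter_mem_WHom deg c
    rw [vertexTerm_eq h, map_neg, map_smul, toSer_bracket]
    rfl
  constructor
  · intro h
    refine ⟨hδ, ?_, ?_, fun i => ?_, fun i => ?_, ?_⟩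
    · rw [← hgen, h.vertex_a, hv _ rfl]
    · rw [← hgen, h.vertex_b, hv _ rfl]
    · rw [le, ← hgen, h.edge, toSer_edgeTerm]; rfl
    · rw [← hgen, h.face, map_sub, toSer_bracket, toSer_faceTerm, toSer_xFace hD]; rfl
    · rw [← toSer_solidTerm hμ, ← h.solid, map_add, toSer_bracket, toSer_xMain hμ hD, hgen]; rfl
  · intro h
    refine ⟨hder, hfil, toSer_injective ?_, toSer_injective ?_, fun i => toSer_injective ?_,
      fun i => toSer_injective ?_, toSer_injective ?_⟩
    · rw [hgen, h.vertex_a, hv _ rfl]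
    · rw [hgen, h.vertex_b, hv _ rfl]
    · rw [hgen, toSer_edgeTerm]; exact h.edge i
    · rw [hgen, h.face, map_sub, toSer_bracket, toSer_faceTerm, toSer_xFace hD]; rfl
    · rw [toSer_solidTerm hμ, ← h.solid, map_add, toSer_bracket, toSer_xMain hμ hD, hgen]; rfl

theorem serModel_extend (hμ : toSer μ ∈ A (fun _ => 0) Set.univ 0)
    (h : IsSymmetricDifferential P μ D) :
    SerModel (fun i => toSer (P i)) (toSer μ) (extend deg D) :=
  have hs := extend_spec h.derivation h.filtration
  (serModel_iff hμ hs.1 hs.2 h.derivation h.filtration).mp h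

theorem exists_isSymmetricDifferential (P : ZMod n → NC (Fin (n - 1)))
    (hμ : toSer μ ∈ A (fun _ => 0) Set.univ 0) : ∃ D, IsSymmetricDifferential P μ D := by
  obtain ⟨δ, hδ⟩ := exists_serModel (fun i => toSer (P i)) hμ
  refine ⟨ofSerMap δ, (serModel_iff hμ hδ.odd (fun _ _ _ => rfl) ⟨fun k z hz => ?_,
    fun p q x hx y hy => toSer_injective ?_⟩ fun k z _ m hm => hδ.odd.der.pres m (toSer z) hm).mpr hδ⟩
  · exact mem_lieSeries.mpr (hδ.map_A hμ (mem_lieSeries.mp hz))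
  · exact hδ.odd.leibniz_br (mem_lieSeries.mp hx).1 (mem_lieSeries.mp hy).1

end

end Ser

/-! ### Linear parts of the boundaries, and the model property. -/

namespace Ser

theorem bch_sub_mem {X : Type} {f g : Ser X} (hf : f ∈ Fil X 1) (hg : g ∈ Fil X 1) :
    bch f g - (f + g) ∈ Fil X 2 := by
  have h0 := (Fil X 1).zero_mem
  have := bch_sub_bch_mem hf h0 hg h0 (m := 1) (by rwa [sub_zero]) (by rwa [sub_zero])
  rwa [bch_zero h0, sub_zero, sub_zero, sub_zero] at this

theorem conj_sub_mem {X : Type} {w z : Ser X} {m : ℕ} (hw : w ∈ Fil X 1) (hz : z ∈ Fil X m) :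
    exp w * z * exp (-w) - z ∈ Fil X (m + 1) := by
  have := opS_sub_mem (raises_ad hw) expS hz
  rwa [opS_exp_ad hw, ← PowerSeries.coeff_zero_eq_constantCoeff_apply, PowerSeries.coeff_exp,
    Nat.factorial_zero, Nat.cast_one, div_one, map_one,
    one_smul] at this

theorem opW_sub_mem {X ι : Type} [Fintype ι] {T : ι → Module.End ℚ (Ser X)}
    (hT : ∀ i, Raises (T i)) (P : Ser ι) {m : ℕ} {z : Ser X} (hz : z ∈ Fil X m) :
    opW P T z - coeff [] P • z ∈ Fil X (m + 1) := by
  rw [opW_rec hT, add_sub_cancel_left]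
  exact Submodule.sum_mem _ fun i _ => hT i m _ (pres_opW hT _ m z hz)

variable {n : ℕ} [NeZero n]

namespace SerModel

variable {P : ZMod n → Ser (Fin (n - 1))} {μ : Ser (ZMod n)}
  {δ : Ser (BananaCell n) →ₗ[ℚ] Ser (BananaCell n)} (hδ : SerModel P μ δ)
include hδ

theorem flow_mem_Fil {w : Ser (BananaCell n)} (hw : w ∈ Fil (BananaCell n) 1) :
    flow δ w (letter .a) ∈ Fil (BananaCell n) 1 :=
  (Fil _ 1).add_mem (pres_opS (raises_ad hw) _ 1 _ (letter_mem _))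
    (pres_opS (raises_ad hw) _ 1 _ (hδ.odd.der.pres 1 _ hw))

theorem edge_sub_mem (i : ZMod n) :
    δ (le i) - (letter .b - letter .a) ∈ Fil (BananaCell n) 2 := by
  have hT := raises_ad (le_mem i)
  have h1 := opS_sub_mem hT bernS (letter_mem .b)
  have h2 := opS_sub_mem hT (bernS * expNegS) (letter_mem .a)
  rw [← PowerSeries.coeff_zero_eq_constantCoeff_apply,
    show PowerSeries.coeff 0 bernS = (1 : ℚ) by simp [bernS, bernoulli'PowerSeries],
    one_smul] at h1
  rw [← bernoulliPowerSeries_eq, ← PowerSeries.coeff_zero_eq_constantCoeff_apply,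
    show PowerSeries.coeff 0 (bernoulliPowerSeries ℚ) = (1 : ℚ) by simp [bernoulliPowerSeries],
    one_smul, bernoulliPowerSeries_eq] at h2
  rw [hδ.edge, sub_sub_sub_comm]
  exact (Fil _ 2).sub_mem h1 h2

/-- Modulo words of length `2`, BCH is a sum, in which the two halves of `vᵢ` cancel, and the
bracket with the centre disappears. -/
theorem face_sub_mem (i : ZMod n) :
    δ (letter (.f i)) - (le i - le (i + 1)) ∈ Fil (BananaCell n) 2 := by
  have hw := halfFace_mem i
  have hw' := (Fil _ 1).neg_mem hw
  have h1 := le_mem i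
  have h2 := (Fil _ 1).neg_mem (le_mem (i + 1))
  have b2 := bch_sub_mem h2 hw
  have b1 := bch_sub_mem h1 (bch_mem h2 hw)
  have b0 := bch_sub_mem hw' (bch_mem h1 (bch_mem h2 hw))
  have hb := br_mem_Fil (deg := deg) (hδ.flow_mem_Fil hw) (letter_mem (.f i))
  rw [hδ.face, bchList, bchList, bchList, bchList, bchList, bch_zero hw]
  convert (Fil _ 2).sub_mem ((Fil _ 2).add_mem b0 ((Fil _ 2).add_mem b1 b2)) hb using 1
  abel

/-- Conjugations and the operators `Pᵢ` are the identity to leading order, the latter because the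
constant terms are `1`. -/
theorem solid_sub_mem (hμ : μ ∈ A (fun _ => 0) Set.univ 0) (hP : ∀ i, coeff [] (P i) = 1) :
    δ (letter .h) - ∑ i, letter (.f i) ∈ Fil (BananaCell n) 2 := by
  have hw := A_mem_Fil (halfMain_mem_A (n := n) (S := Set.univ) hμ fun _ => trivial)
  have hb := br_mem_Fil (deg := deg) (hδ.flow_mem_Fil hw) (letter_mem .h)
  have hB := A_mem_Fil (bdrySum_mem_A (P := P))
  have h1 := conj_sub_mem ((Fil _ 1).neg_mem hw) hB
  rw [neg_neg] at h1
  have hf : ∀ i, face' i - letter (.f i) ∈ Fil (BananaCell n) 2 := fun i =>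
    conj_sub_mem (halfFace_mem i) (letter_mem _)
  have h2 : bdrySum P - ∑ i, letter (.f i) ∈ Fil (BananaCell n) 2 := by
    rw [bdrySum, ← Finset.sum_sub_distrib]
    refine Submodule.sum_mem _ fun i _ => ?_
    have hf1 : face' i ∈ Fil (BananaCell n) 1 := conj_mem _ _ (letter_mem _)
    have := opW_sub_mem (fun j => raises_ad (loopsFrom_mem 0 j)) (P i) hf1
    rw [hP, one_smul] at this
    rw [← sub_add_sub_cancel]
    exact (Fil _ 2).add_mem this (hf i)
  rw [eq_sub_of_add_eq hδ.solid]
  convert (Fil _ 2).sub_mem ((Fil _ 2).add_mem h1 h2) hb using 1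
  abel

theorem initial (hμ : μ ∈ A (fun _ => 0) Set.univ 0) (hP : ∀ i, coeff [] (P i) = 1)
    (c y : BananaCell n) : coeff [y] (δ (letter c)) = (Banana.boundary c y : ℚ) := by
  have key : ∀ f g : Ser (BananaCell n), f - g ∈ Fil (BananaCell n) 2 → coeff [y] f = coeff [y] g :=
    fun f g h => sub_eq_zero.mp ((map_sub _ _ _).symm.trans (h [y] (by simp)))
  classical
  have hl : ∀ x : BananaCell n, coeff [y] (letter x) = if x = y then 1 else 0 := fun x => by
    rw [coeff_letter]
    simp only [List.cons.injEq, and_true, eq_comm]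
  have hsq : ∀ x : BananaCell n, -(letter x * letter x) - 0 ∈ Fil (BananaCell n) 2 := fun x => by
    rw [sub_zero]
    exact Submodule.neg_mem _ (mul_mem_Fil (letter_mem _) (letter_mem _))
  match c with
  | .a => rw [hδ.vertex_a, key _ _ (hsq _)]; simp [Banana.boundary]
  | .b => rw [hδ.vertex_b, key _ _ (hsq _)]; simp [Banana.boundary]
  | .e i =>
    rw [← le, key _ _ (hδ.edge_sub_mem i), map_sub, hl, hl]
    simp [Banana.boundary, Finsupp.single_apply]
  | .f i =>
    rw [key _ _ (hδ.face_sub_mem i), map_sub, le, le, hl, hl]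
    simp [Banana.boundary, Finsupp.single_apply]
  | .h =>
    rw [key _ _ (hδ.solid_sub_mem hμ hP), map_sum]
    simp [Banana.boundary, Finsupp.single_apply, hl]

end SerModel

section
variable {P : ZMod n → NC (Fin (n - 1))} {μ : NC (ZMod n)}
  {D : NC (BananaCell n) →ₗ[ℚ] NC (BananaCell n)}

omit [NeZero n] in
theorem toSer_boundaryCondition (h : BoundaryCondition P) :
    ∑ j : Fin (n - 1), opW (toSer (P ((j + 1 : ℕ) : ZMod n))) (fun j => ad (letter j)) (letter j)
      = opW (toSer (P 0)) (fun j => ad (letter j)) (bchList (List.ofFn letter)) := by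
  have hm : ∀ (p z : NC (Fin (n - 1))), toSer (NC.act (fun _ => 0) p NC.var z)
      = opW (toSer p) (fun j => ad (letter j)) (toSer z) := fun p z =>
    toSer_act p (y := NC.var) (fun j => letter_mem j)
      (fun j => letter_mem_WHom (fun _ => (0 : ℤ)) j) z
  have h' := congrArg toSer h
  rw [map_sum, hm, toSer_bchList, List.map_ofFn] at h'
  simp only [hm] at h'
  exact h'

theorem isModel (hP : ∀ i, P i [] = 1) (hbdry : BoundaryCondition P)
    (hμ : toSer μ ∈ A (fun _ => 0) Set.univ 0) (h : IsSymmetricDifferential P μ D) :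
    IsModel (cells n) D := by
  have hs := (extend_spec h.derivation h.filtration).2
  have hδ := serModel_extend hμ h
  have hgen : ∀ c, toSer (D (gen c)) = extend deg D (letter c) := fun c =>
    hs _ (gen c) (letter_mem_A (deg := deg) trivial)
  have hsq := hδ.sq_eq_zero hμ (sum_loop_eq_zero (toSer_boundaryCondition hbdry))
  refine ⟨⟨?_, h.derivation, fun p x hx => toSer_injective ?_⟩, h.filtration, fun c hc => ?_,
    fun c y => ?_, fun c => ?_⟩
  · have hA : NC.lieSeries deg = fun k => (A deg Set.univ k : Submodule ℚ (NC (BananaCell n))) :=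
      funext fun k => Submodule.ext fun z => mem_lieSeries
    show IsGradedLieAlgebra (NC.lieSeries deg) _
    rw [hA]
    exact isGradedLieAlgebra deg
  · have hx' := mem_lieSeries.mp hx
    rw [hs (p - 1) (D x) (mem_lieSeries.mp (h.derivation.mem p x hx)), hs p x hx', map_zero]
    exact LinearMap.congr_fun hsq _
  · match c, hc with
    | .a, _ => exact (congrArg (· + _) h.vertex_a).trans (neg_add_cancel _)
    | .b, _ => exact (congrArg (· + _) h.vertex_b).trans (neg_add_cancel _)
  · exact (congrArg (coeff [y]) (hgen c)).trans (hδ.initial hμ hP c y)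
  · refine mem_lieSeriesOn.mpr ?_
    exact (hgen c).symm ▸ hδ.locality hμ c

theorem twisted_face (hμ : toSer μ ∈ A (fun _ => 0) Set.univ 0)
    (h : IsSymmetricDifferential P μ D) (i : ZMod n) :
    D (fTwist i) + Banana.br (gen .a) (fTwist i) = NC.bch (gen (.e i)) (-gen (.e (i + 1))) :=
  toSer_injective (by
    have hf : toSer (fTwist i) ∈ A deg Set.univ 1 := by
      rw [toSer_fTwist]
      exact conj_mem_A (halfFace_mem_A trivial trivial) (f_mem_A trivial)
    rw [map_add, (extend_spec h.derivation h.filtration).2 1 _ hf, toSer_bracket, toSer_bch, map_neg,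
      toSer_fTwist]
    exact (serModel_extend hμ h).twist_face' i)

theorem twisted_solid (hμ : toSer μ ∈ A (fun _ => 0) Set.univ 0)
    (h : IsSymmetricDifferential P μ D) :
    D (hTwist μ) + Banana.br (gen .a) (hTwist μ) = ∑ i : ZMod n, actLoops (P i) (fTwist i) :=
  toSer_injective (by
    have hf : toSer (hTwist μ) ∈ A deg Set.univ 2 := by
      rw [toSer_hTwist hμ]
      exact conj_mem_A (halfMain_mem_A hμ fun _ => trivial) (h_mem_A trivial)
    rw [map_add, (extend_spec h.derivation h.filtration).2 2 _ hf, toSer_bracket, toSer_hTwist hμ,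
      toSer_sum_actLoops]
    exact (serModel_extend hμ h).twist_solid' hμ)

end

end Ser

/-! ### Symmetries of the model. -/

namespace Ser

variable {X Y Z : Type}

theorem IsHom.comp {g : Ser Y →ₗ[ℚ] Ser Z} {g' : Ser X →ₗ[ℚ] Ser Y} (hg : IsHom g)
    (hg' : IsHom g') : IsHom (g ∘ₗ g') where
  pres := hg.pres.comp hg'.pres
  map_one := by rw [LinearMap.comp_apply, hg'.map_one, hg.map_one]
  map_mul f f' := by simp only [LinearMap.comp_apply, hg'.map_mul, hg.map_mul]

theorem IsHom.map_ad {g : Ser X →ₗ[ℚ] Ser Y} (hg : IsHom g) (f z : Ser X) :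
    g (ad f z) = ad (g f) (g z) := by
  rw [ad_apply, ad_apply, map_sub, hg.map_mul, hg.map_mul]

theorem IsHom.map_opW_ad {ι : Type} [Fintype ι] {g : Ser X →ₗ[ℚ] Ser Y} (hg : IsHom g)
    {y : ι → Ser X} (hy : ∀ i, y i ∈ Fil X 1) (Q : Ser ι) (z : Ser X) :
    g (opW Q (fun i => ad (y i)) z) = opW Q (fun i => ad (g (y i))) (g z) :=
  map_opW (fun i => raises_ad (hy i)) (fun i => raises_ad (hg.map_mem (hy i)))
    (fun i z => hg.map_ad (y i) z) Q z

theorem IsHom.map_conj {g : Ser X →ₗ[ℚ] Ser Y} (hg : IsHom g) {w : Ser X} (hw : w ∈ Fil X 1)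
    (z : Ser X) : g (exp w * z * exp (-w)) = exp (g w) * g z * exp (-g w) := by
  rw [hg.map_mul, hg.map_mul, hg.map_exp hw, hg.map_exp ((Fil X 1).neg_mem hw), map_neg]

/-! ### Commutators of derivations and homomorphisms -/

section
variable [Fintype X] {deg : X → ℤ} {δ T : Ser X →ₗ[ℚ] Ser X} (hδ : OddDer deg δ) (hT : IsHom T)
  (hdeg : ∀ x, T (letter x) ∈ Hom deg (deg x))
include hδ hT hdeg

/-- The commutator obeys a Leibniz rule twisted by `T`, so invariance may be tested on letters, and
the lemmas on exponentials, conjugation and Lie series apply to it. -/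
theorem isDer_comm : IsDer T (sgn deg 1 ∘ₗ T) (δ ∘ₗ T - T ∘ₗ δ) where
  pres := (hδ.der.pres.comp hT.pres).sub (hT.pres.comp hδ.der.pres)
  leibniz f g := by
    simp only [LinearMap.sub_apply, LinearMap.comp_apply, hT.map_mul, hδ.der.leibniz, map_add,
      hT.map_sgn hdeg, LinearMap.id_apply]
    noncomm_ring

/-- Both flow equations prescribe the differential of an exponential, and `T` carries one to the
other. So the commutator kills `exp e`, hence `e`. -/
theorem comm_exp_eq_zero {e a b : Ser X} (he1 : e ∈ Fil X 1) (he : e ∈ Hom deg 0)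
    (h : flow δ e a = b) (h' : flow δ (T e) (T a) = T b) : (δ ∘ₗ T - T ∘ₗ δ) e = 0 := by
  have hTe := hT.map_Hom hdeg he
  have hTe1 := hT.map_mem he1
  refine (isDer_comm hδ hT hdeg).eq_zero_of_exp hT ((isHom_sgn deg 1).comp hT) he1
    (sgn_even hTe 1).symm ?_
  rw [LinearMap.sub_apply, LinearMap.comp_apply, LinearMap.comp_apply, hT.map_exp he1,
    (flow_eq_iff hδ.der hTe1 hTe).mp h', (flow_eq_iff hδ.der he1 he).mp h, map_sub, hT.map_mul,
    hT.map_mul, hT.map_exp he1, sub_self]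

omit [Fintype X] hδ hdeg in
theorem map_flow {e a : Ser X} (he1 : e ∈ Fil X 1) (h : (δ ∘ₗ T - T ∘ₗ δ) e = 0) :
    T (flow δ e a) = flow δ (T e) (T a) := by
  have hr := raises_ad he1
  have hr' := raises_ad (hT.map_mem he1)
  rw [flow, map_add, map_opS hT.pres hr (hT.map_ad e) , map_opS hT.pres hr (hT.map_ad e), flow,
    show δ (T e) = T (δ e) from sub_eq_zero.mp h]

end

variable {n : ℕ} [NeZero n]

/-! ### Symmetries of the banana -/

section
variable {P : ZMod n → Ser (Fin (n - 1))}

/-- The series `Pᵢ` evaluated at the next loops. -/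
theorem opW_loopsFrom_succ
    (hcyc : ∀ i, P (i + 1) = subst (P i) fun j => toSer (cyclicShift n j)) (i k : ZMod n)
    (z : Ser (BananaCell n)) :
    opW (P (i + 1)) (fun j => ad (loopsFrom k j)) z
      = opW (P i) (fun j => ad (loopsFrom (k + 1) j)) z := by
  have hl : ∀ f ∈ List.ofFn (letter : Fin (n - 1) → Ser _), f ∈ A (fun _ => 0) Set.univ 0 :=
    fun f hf => by
      obtain ⟨j, rfl⟩ := (List.mem_ofFn' _ _).mp hf
      exact letter_mem_A (deg := fun _ => 0) trivial
  have hb : toSer (NC.bchList (List.ofFn fun j : Fin (n - 1) => NC.var j))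
      = bchList (List.ofFn letter) := by
    rw [toSer_bchList, List.map_ofFn]; rfl
  have hA : ∀ j, toSer (cyclicShift n j) ∈ A (fun _ => 0) Set.univ 0 := fun j => by
    rw [cyclicShift]
    split_ifs
    · exact letter_mem_A (deg := fun _ => 0) trivial
    · rw [map_neg, hb]
      exact Submodule.neg_mem _ (bchList_mem_A hl)
  -- All variables but the last move to the next loop. The last one is minus BCH of the `n - 1`
  -- loops after loop `k`, that is loop `k` itself, which modulo `n` closes the shifted sequence.
  have hs : ∀ j, subst (toSer (cyclicShift n j)) (loopsFrom k) = loopsFrom (k + 1) j := fun j => by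
    rw [cyclicShift]
    split_ifs with hj
    · refine (subst_letter (loopsFrom_mem k) _).trans ?_
      rw [loopsFrom, loopsFrom]
      push_cast
      ring_nf
    · have hom := isHom_subst (loopsFrom_mem k)
      have hc : substL (loopsFrom k) ∘ letter = loopsFrom k :=
        funext fun j => subst_letter (loopsFrom_mem k) j
      rw [map_neg, hb, ← substL_apply, map_neg, hom.map_bchList fun f hf => A_mem_Fil (hl f hf),
        List.map_ofFn, hc, bchList_loopsFrom, neg_neg, loopsFrom,
        show (j : ℕ) + 1 = n - 1 by omega, Nat.cast_sub NeZero.one_le, ZMod.natCast_self]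
      push_cast
      ring_nf
  rw [hcyc, opW_subst (fun j => A_mem_Fil (hA j)) (fun j => raises_ad (loopsFrom_mem k j))]
  congr 1
  refine congrArg _ (funext fun j => LinearMap.ext fun z => ?_)
  rw [opW_ad_of_mem_Lie (loopsFrom_mem k) (hA j).2, hs]

-- The reversal condition at the level of operators: substituting negated letters in reverse order
-- negates and reverses the loops.
omit [NeZero n] in
theorem opW_neg_loopsFrom_rev (hrev : ∀ i, P (-i) = subst (P i) fun j => -letter (Fin.rev j))
    (i k : ZMod n) (z : Ser (BananaCell n)) :
    opW (P (-i)) (fun j => ad (loopsFrom k j)) z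
      = opW (P i) (fun j => ad (-loopsFrom k (Fin.rev j))) z := by
  have hr : ∀ j, Raises (ad (loopsFrom k j)) := fun j => raises_ad (loopsFrom_mem k j)
  rw [hrev, opW_subst (fun j => Submodule.neg_mem _ (letter_mem _)) hr]
  congr 1
  refine congrArg _ (funext fun j => LinearMap.ext fun z => ?_)
  rw [ad_neg, LinearMap.neg_apply, ← opW_letter hr (Fin.rev j) z]
  exact map_neg (evalW (fun j => ad (loopsFrom k j)) z) _

end

/-- The symmetric model of the banana is invariant under homomorphisms compatible with the
formulae. -/
theorem comm_eq_zero {δ T : Ser (BananaCell n) →ₗ[ℚ] Ser (BananaCell n)} (hδ : OddDer deg δ)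
    (hT : IsHom T) (hdeg : ∀ x, T (letter x) ∈ Hom deg (deg x))
    (h : ∀ x, δ (T (letter x)) = T (δ (letter x))) : δ ∘ₗ T = T ∘ₗ δ :=
  sub_eq_zero.mp ((isDer_comm hδ hT hdeg).eq_zero_of_letters hT ((isHom_sgn deg 1).comp hT)
    fun x => sub_eq_zero.mpr (h x))

namespace SerModel

variable {P : ZMod n → Ser (Fin (n - 1))} {μ : Ser (ZMod n)}
  {δ T : Ser (BananaCell n) →ₗ[ℚ] Ser (BananaCell n)} (hδ : SerModel P μ δ) (hT : IsHom T)
  (hdeg : ∀ x, T (letter x) ∈ Hom deg (deg x))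
include hδ hT hdeg

theorem comm_of_mem_edges (h : ∀ i, flow δ (T (le i)) (T (letter .a)) = T (letter .b))
    {k : ℤ} {z : Ser (BananaCell n)} (hz : z ∈ A deg (edges n) k) :
    (δ ∘ₗ T - T ∘ₗ δ) z = 0 :=
  (isDer_comm hδ.odd hT hdeg).eq_zero_of_mem_Lie (deg := deg) (fun x hx => by
    obtain ⟨i, rfl⟩ := hx
    exact comm_exp_eq_zero hδ.odd hT hdeg (le_mem i) (le_mem_A (S := Set.univ) trivial).1
      (hδ.flow_le i) (h i)) hz.2

/-- Invariance under a symmetry that fixes the vertices. -/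
theorem comm_of_fixed (hμ : μ ∈ A (fun _ => 0) Set.univ 0) (ha : T (letter .a) = letter .a)
    (hb : T (letter .b) = letter .b) (he : ∀ i, ∃ j, T (le i) = le j)
    (hf : ∀ i, twist δ (T (face' i)) = T (loop i))
    (hh : twist δ (T (solid' μ)) = T (bdrySum P)) : δ ∘ₗ T = T ∘ₗ δ := by
  have hE : ∀ i, flow δ (T (le i)) (T (letter .a)) = T (letter .b) := fun i => by
    obtain ⟨j, hj⟩ := he i
    rw [hj, ha, hb, hδ.flow_le]
  -- As `T` fixes `a`, commuting with `δ` and commuting with the twisted differential are the same.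
  have htw : ∀ z, twist δ (T z) = T (twist δ z) → (δ ∘ₗ T - T ∘ₗ δ) z = 0 := fun z h => by
    have := hT.map_br hdeg a_mem_Hom z
    rw [LinearMap.add_apply, LinearMap.add_apply, map_add, this, ha] at h
    exact sub_eq_zero.mpr (add_right_cancel h)
  have der := isDer_comm hδ.odd hT hdeg
  have hom := (isHom_sgn deg 1).comp hT
  refine comm_eq_zero hδ.odd hT hdeg fun x => ?_
  match x with
  | .a => rw [ha, hδ.vertex_a, map_neg, hT.map_mul, ha]
  | .b => rw [hb, hδ.vertex_b, map_neg, hT.map_mul, hb]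
  | .e i => exact sub_eq_zero.mp (hδ.comm_of_mem_edges hT hdeg hE (le_mem_A (e_mem_edges i)))
  | .f i =>
    refine sub_eq_zero.mp (der.eq_zero_of_conj hT hom (halfFace_mem i)
      (hδ.comm_of_mem_edges hT hdeg hE (halfFace_mem_A (e_mem_edges _) (e_mem_edges _)))
      (htw (face' i) ?_))
    rw [hδ.twist_face', hf]
  | .h =>
    have hw := halfMain_mem_A hμ (e_mem_edges (n := n))
    refine sub_eq_zero.mp (der.eq_zero_of_conj hT hom (A_mem_Fil hw)
      (hδ.comm_of_mem_edges hT hdeg hE hw) (htw (solid' μ) ?_))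
    rw [hδ.twist_solid' hμ, hh]

end SerModel

section
variable {T : Ser (BananaCell n) →ₗ[ℚ] Ser (BananaCell n)} (hT : IsHom T)
include hT

omit [NeZero n] in
theorem map_loop (i : ZMod n) : T (loop i) = bch (T (le i)) (-T (le (i + 1))) := by
  rw [loop, hT.map_bch (le_mem _) (Submodule.neg_mem _ (le_mem _)), map_neg]

omit [NeZero n] in
theorem map_halfFace (i : ZMod n) :
    T (halfFace i) = (1 / 2 : ℚ) • mu2 (T (le i)) (T (le (i + 1))) := by
  rw [halfFace, map_smul, hT.map_mu2 (le_mem _) (le_mem _)]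

theorem map_halfMain (μ : Ser (ZMod n)) :
    T (halfMain μ) = (1 / 2 : ℚ) • subst μ fun i => T (le i) := by
  rw [halfMain, map_smul, hT.map_subst le_mem]

theorem map_face' (i : ZMod n) :
    T (face' i) = exp (T (halfFace i)) * T (letter (.f i)) * exp (-T (halfFace i)) :=
  hT.map_conj (halfFace_mem i) _

theorem map_bdrySum (P : ZMod n → Ser (Fin (n - 1))) :
    T (bdrySum P) = ∑ i, opW (P i) (fun j => ad (T (loopsFrom 0 j))) (T (face' i)) := by
  rw [bdrySum, map_sum]
  exact Finset.sum_congr rfl fun i _ => hT.map_opW_ad (loopsFrom_mem 0) _ _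

theorem map_halfMain_of_perm {μ : Ser (ZMod n)}
    (hsymm : ∀ π : Equiv.Perm (ZMod n), subst μ (fun i => letter (π i)) = μ)
    (π : Equiv.Perm (ZMod n)) (h : ∀ i, T (le i) = le (π i)) : T (halfMain μ) = halfMain μ := by
  rw [map_halfMain hT, halfMain]
  congr 1
  conv_rhs => rw [← hsymm π, subst_subst (fun i => letter_mem (π i)) le_mem]
  exact congrArg _ (funext fun i => by rw [h, subst_letter le_mem])

end

namespace SerModel

variable {P : ZMod n → Ser (Fin (n - 1))} {μ : Ser (ZMod n)}
  {δ T : Ser (BananaCell n) →ₗ[ℚ] Ser (BananaCell n)} (hδ : SerModel P μ δ) (hT : IsHom T)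
  (hdeg : ∀ x, T (letter x) ∈ Hom deg (deg x)) (hμ : μ ∈ A (fun _ => 0) Set.univ 0)
include hδ hT hdeg hμ

theorem comm_rotation
    (hsymm : ∀ π : Equiv.Perm (ZMod n), subst μ (fun i => letter (π i)) = μ)
    (hcyc : ∀ i, P (i + 1) = subst (P i) fun j => toSer (cyclicShift n j))
    (ha : T (letter .a) = letter .a) (hb : T (letter .b) = letter .b)
    (he : ∀ i, T (le i) = le (i + 1)) (hf : ∀ i, T (letter (.f i)) = letter (.f (i + 1)))
    (hh : T (letter .h) = letter .h) : δ ∘ₗ T = T ∘ₗ δ := by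
  have hw := A_mem_Fil (halfMain_mem_A hμ (e_mem_edges (n := n)))
  have hl : ∀ i, T (loop i) = loop (i + 1) := fun i => by rw [map_loop hT, he, he, loop]
  have hf' : ∀ i, T (face' i) = face' (i + 1) := fun i => by
    rw [map_face' hT, map_halfFace hT, he, he, hf, face', halfFace]
  refine hδ.comm_of_fixed hT hdeg hμ ha hb (fun i => ⟨_, he i⟩) (fun i => ?_) ?_
  · rw [hf', hδ.twist_face', hl]
  · rw [solid', hT.map_conj hw, map_halfMain_of_perm hT hsymm (Equiv.addRight 1) he, hh]
    refine (hδ.twist_solid' hμ).trans ?_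
    -- After the shift of the summation index, the term of `P (i + 1)` at the loops from `0` is that
    -- of `P i` at the loops from `1`, which are the rotated ones.
    rw [map_bdrySum hT, bdrySum, ← Equiv.sum_comp (Equiv.addRight (1 : ZMod n))]
    refine Finset.sum_congr rfl fun i _ => ?_
    rw [Equiv.coe_addRight, opW_loopsFrom_succ hcyc, hf']
    simp only [loopsFrom, hl, zero_add, add_zero]

theorem comm_reflection
    (hsymm : ∀ π : Equiv.Perm (ZMod n), subst μ (fun i => letter (π i)) = μ)
    (hcyc : ∀ i, P (i + 1) = subst (P i) fun j => toSer (cyclicShift n j))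
    (hrev : ∀ i, P (-i) = subst (P i) fun j => -letter (Fin.rev j))
    (ha : T (letter .a) = letter .a) (hb : T (letter .b) = letter .b)
    (he : ∀ i, T (le i) = le (-i)) (hf : ∀ i, T (letter (.f i)) = -letter (.f (-i - 1)))
    (hh : T (letter .h) = -letter .h) : δ ∘ₗ T = T ∘ₗ δ := by
  have hw := A_mem_Fil (halfMain_mem_A hμ (e_mem_edges (n := n)))
  have hl : ∀ i, T (loop i) = -loop (-i - 1) := fun i => by
    rw [map_loop hT, he, he, neg_loop_eq, sub_add_cancel, neg_add']
  have hf' : ∀ i, T (face' i) = -face' (-i - 1) := fun i => by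
    rw [map_face' hT, map_halfFace hT, he, he, hf, face', halfFace, sub_add_cancel, neg_add',
      mu2_comm (le_mem _) (le_mem _), mul_neg, neg_mul]
  refine hδ.comm_of_fixed hT hdeg hμ ha hb (fun i => ⟨_, he i⟩) (fun i => ?_) ?_
  · rw [hf', map_neg, hδ.twist_face', hl]
  · rw [solid', hT.map_conj hw, map_halfMain_of_perm hT hsymm (Equiv.neg _) he, hh, mul_neg, neg_mul,
      map_neg]
    refine (congrArg _ (hδ.twist_solid' hμ)).trans ?_
    rw [map_bdrySum hT, bdrySum, ← Finset.sum_neg_distrib,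
      ← Equiv.sum_comp (Equiv.subLeft (-1 : ZMod n))]
    refine Finset.sum_congr rfl fun i _ => ?_
    -- The reflection sends face `i` to face `-i - 1`, whereas reversal relates `P i` to `P (-i)`.
    -- One cyclic shift makes up the difference: `P (-i - 1)` at the loops from `0` is `P (-i)` at
    -- the loops from `-1`.
    have h1 := opW_loopsFrom_succ hcyc (-i - 1) (-1)
    rw [neg_add_cancel, sub_add_cancel] at h1
    rw [hf', map_neg, Equiv.subLeft_apply, show (-1 : ZMod n) - i = -i - 1 by ring, ← h1,
      opW_neg_loopsFrom_rev hrev]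
    congr 3
    funext j
    rw [loopsFrom, loopsFrom, hl, Fin.val_rev,
      show n - 1 - (j + 1) + 1 = n - (j + 1) by omega, Nat.cast_sub (by omega), ZMod.natCast_self]
    push_cast
    ring_nf

/-- The exchange does not fix `a`, so the twisted form is of no use. It does fix the centres of the
faces and of the solid, and the formulae based at the centres are compared directly. -/
theorem comm_exchange (hflow : flow δ (subst μ le) (letter .a) = letter .b)
    (hodd : subst μ (fun i => -letter i) = -μ)
    (hswap : ∀ i, exp (halfMain μ) * opW (P i) (fun j => ad (bch (-le ((j + 1 : ℕ) : ZMod n))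
        (le ((j + 2 : ℕ) : ZMod n)))) (exp (-halfFace i) * letter (.f i) * exp (halfFace i))
        * exp (-halfMain μ)
      = exp (-halfMain μ) * opW (P i) (fun j => ad (loopsFrom 0 j)) (face' i) * exp (halfMain μ))
    (ha : T (letter .a) = letter .b) (hb : T (letter .b) = letter .a)
    (he : ∀ i, T (le i) = -le i) (hf : ∀ i, T (letter (.f i)) = -letter (.f i))
    (hh : T (letter .h) = -letter .h) : δ ∘ₗ T = T ∘ₗ δ := by
  have hleA : ∀ i, le i ∈ A deg (edges n) 0 := fun i => le_mem_A (e_mem_edges i)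
  have hmA := halfMain_mem_A hμ (e_mem_edges (n := n))
  have hm := A_mem_Fil hmA
  have hE : ∀ i, flow δ (T (le i)) (T (letter .a)) = T (letter .b) := fun i => by
    rw [he, ha, hb, ← hδ.flow_le i, flow_neg hδ.odd.der (le_mem i) (hleA i).1]
  have hfw : ∀ i, T (halfFace i) = -halfFace i := fun i => by
    rw [map_halfFace hT, he, he, mu2_neg_neg (le_mem _) (le_mem _), smul_neg, halfFace]
  have hmw : T (halfMain μ) = -halfMain μ := by
    have h := congrArg (substL (le (n := n))) hodd
    rw [substL_apply, subst_subst (fun i => Submodule.neg_mem _ (letter_mem i)) le_mem, map_neg] at h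
    rw [map_halfMain hT, halfMain, ← smul_neg]
    congr 1
    refine Eq.trans (congrArg _ (funext fun i => ?_)) h
    rw [he, ← substL_apply, map_neg, substL_apply, subst_letter le_mem]
  -- The image of the midpoint reached from `a` along half of `w` is reached from `b` along minus
  -- half of `w`; by `flow_half` these points coincide.
  have hx : ∀ w, T ((1 / 2 : ℚ) • w) = -((1 / 2 : ℚ) • w) → w ∈ A deg (edges n) 0 →
      flow δ w (letter .a) = letter .b →
      T (flow δ ((1 / 2 : ℚ) • w) (letter .a)) = flow δ ((1 / 2 : ℚ) • w) (letter .a) := by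
    intro w hTw hw h
    have hw2 := (A deg (edges n) 0).smul_mem (1 / 2 : ℚ) hw
    rw [map_flow hT (A_mem_Fil hw2) (hδ.comm_of_mem_edges hT hdeg hE hw2), hTw, ha,
      flow_half hδ.odd.der hw h]
  have hxf : ∀ i, T (flow δ (halfFace i) (letter .a)) = flow δ (halfFace i) (letter .a) := fun i =>
    hx _ (hfw i) (mu2_mem_A (hleA _) (hleA _))
      (flow_mu2 hδ.odd.der (hleA _) (hleA _) b_mem_Hom (hδ.flow_le _) (hδ.flow_le _))
  have hxm : T (flow δ (halfMain μ) (letter .a)) = flow δ (halfMain μ) (letter .a) :=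
    hx _ hmw (subst_mem_A hleA hμ) hflow
  refine comm_eq_zero hδ.odd hT hdeg fun x => ?_
  match x with
  | .a => rw [ha, hδ.vertex_a, hδ.vertex_b, map_neg, hT.map_mul, ha]
  | .b => rw [hb, hδ.vertex_a, hδ.vertex_b, map_neg, hT.map_mul, hb]
  | .e i => exact sub_eq_zero.mp (hδ.comm_of_mem_edges hT hdeg hE (hleA i))
  | .f i =>
    have hw := halfFace_mem i
    have hw' := (Fil _ 1).neg_mem hw
    have hfl := flow_mem_Hom hδ.odd hw
      (halfFace_mem_A (e_mem_edges i) (e_mem_edges (i + 1))).1 a_mem_Hom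
    have hB : bchList [-halfFace i, le i, -le (i + 1), halfFace i]
        = exp (-halfFace i) * loop i * exp (halfFace i) := by
      rw [← conj_bchList, ← mul_assoc, ← mul_assoc, exp_neg_mul_exp hw, one_mul, mul_assoc,
        exp_neg_mul_exp hw, mul_one]
    -- Conjugation by `exp vᵢ` reverses the order of `exp (-eᵢ)` and `exp eᵢ₊₁` by `exp_mu2_conj`.
    -- Moving half of `vᵢ` to the other side shows that the exchange negates the boundary loop based
    -- at the centre.
    have hc : exp (halfFace i) * bch (-le i) (le (i + 1)) * exp (-halfFace i)
        = exp (-halfFace i) * bch (le (i + 1)) (-le i) * exp (halfFace i) := by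
      have h1 := le_mem i
      have h2 := le_mem (i + 1)
      have h1' := (Fil _ 1).neg_mem h1
      refine exp_injective (conj_mem _ _ (bch_mem h1' h2)) (conj_mem _ _ (bch_mem h2 h1')) ?_
      rw [exp_conj (exp_neg_mul_exp hw) (exp_mul_exp_neg hw) (bch_mem h1' h2),
        exp_conj (exp_mul_exp_neg hw) (exp_neg_mul_exp hw) (bch_mem h2 h1'), exp_bch h1' h2,
        exp_bch h2 h1', ← exp_mu2_conj h1 h2, ← exp_half_mul_self (mu2_mem h1 h2),
        ← exp_half_mul_self ((Fil _ 1).neg_mem (mu2_mem h1 h2)), smul_neg]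
      show exp (halfFace i) * _ * exp (-halfFace i) = exp (-halfFace i) *
        (exp (halfFace i) * exp (halfFace i) * _ * (exp (-halfFace i) * exp (-halfFace i)))
        * exp (halfFace i)
      have key : ∀ u v p : Ser (BananaCell n), v * u = 1 →
          u * p * v = v * (u * u * p * (v * v)) * u := fun u v p h => by
        rw [show v * (u * u * p * (v * v)) * u = (v * u) * u * p * v * (v * u) by noncomm_ring, h,
          one_mul, mul_one]
      exact key _ _ _ (exp_neg_mul_exp hw)
    rw [hf, map_neg, hδ.face, map_sub, hT.map_br hdeg hfl, hxf, hf, map_neg, hB, hT.map_mul,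
      hT.map_mul, hT.map_exp hw', hT.map_exp hw, map_neg, hfw, neg_neg, map_loop hT, he, he, neg_neg,
      hc, ← neg_loop_eq]
    noncomm_ring
  | .h =>
    have hfl := flow_mem_Hom hδ.odd hm hmA.1 a_mem_Hom
    -- The exchange inverts the signs of `v`, `vᵢ` and the edges, which produces one side of
    -- `hswap`; the total sign comes from the image of `f i`.
    have hC : T (exp (-halfMain μ) * bdrySum P * exp (halfMain μ))
        = -(exp (-halfMain μ) * bdrySum P * exp (halfMain μ)) := by
      rw [hT.map_mul, hT.map_mul, hT.map_exp ((Fil _ 1).neg_mem hm), hT.map_exp hm, map_neg, hmw,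
        neg_neg, map_bdrySum hT, bdrySum, Finset.mul_sum, Finset.sum_mul, Finset.mul_sum,
        Finset.sum_mul, ← Finset.sum_neg_distrib]
      refine Finset.sum_congr rfl fun i _ => ?_
      rw [← hswap i, map_face' hT, hfw, neg_neg, hf, mul_neg, neg_mul, map_neg, mul_neg, neg_mul]
      congr 6
      funext j
      rw [loopsFrom, map_loop hT, he, he, neg_neg]
      push_cast
      ring_nf
    rw [hh, map_neg, eq_sub_of_add_eq hδ.solid, map_sub, hC, hT.map_br hdeg hfl, hxm, hh, map_neg]
    noncomm_ring

end SerModel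

end Ser

/-! ### Invariance in terms of the original formulae. -/

namespace Ser

variable {n : ℕ} [NeZero n]

section
variable {P : ZMod n → NC (Fin (n - 1))} {μ : NC (ZMod n)}
  {D : NC (BananaCell n) →ₗ[ℚ] NC (BananaCell n)}

/-- On Lie series `D` coincides with its extension, and substitution of Lie series of the right
degrees preserves Lie series; so it suffices to commute in the associative algebra. -/
theorem invariantUnder {s : BananaCell n → NC (BananaCell n)}
    (h : IsSymmetricDifferential P μ D) (hs : ∀ c, toSer (s c) ∈ A deg Set.univ (deg c))
    (hcomm : extend deg D ∘ₗ substL (fun c => toSer (s c))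
      = substL (fun c => toSer (s c)) ∘ₗ extend deg D) : InvariantUnder D s := by
  intro k z hz
  have hD := (extend_spec h.derivation h.filtration).2
  have hs1 := fun c => A_mem_Fil (hs c)
  have hz' := mem_lieSeries.mp hz
  have hsub : ∀ z, toSer (NC.subst z s) = substL (fun c => toSer (s c)) (toSer z) := fun z =>
    toSer_subst z hs1
  have hsz : toSer (NC.subst z s) ∈ A deg Set.univ k := by
    rw [hsub]
    refine (isHom_subst hs1).map_A (deg := deg) (S := Set.univ) (fun x => ?_) (fun x _ => ?_) hz' <;>
      rw [substL_apply, subst_letter hs1]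
    exacts [(hs x).1, (hs x).2]
  refine toSer_injective ?_
  rw [hD k _ hsz, hsub, hsub, hD k z hz']
  exact LinearMap.congr_fun hcomm _

theorem gen_mem_A (c : BananaCell n) : toSer (gen c) ∈ A deg Set.univ (deg c) :=
  letter_mem_A (deg := deg) trivial

theorem neg_gen_mem_A (c : BananaCell n) : toSer (-gen c) ∈ A deg Set.univ (deg c) :=
  (A deg Set.univ (deg c)).neg_mem (gen_mem_A c)

theorem tau_mem_A : ∀ c : BananaCell n, toSer (tau c) ∈ A deg Set.univ (deg c)
  | .a => gen_mem_A .a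
  | .b => gen_mem_A .b
  | .e i => gen_mem_A (.e (i + 1))
  | .f i => gen_mem_A (.f (i + 1))
  | .h => gen_mem_A .h

theorem sigma_mem_A : ∀ c : BananaCell n, toSer (sigma c) ∈ A deg Set.univ (deg c)
  | .a => gen_mem_A .a
  | .b => gen_mem_A .b
  | .e i => gen_mem_A (.e (-i))
  | .f i => neg_gen_mem_A (.f (-i - 1))
  | .h => neg_gen_mem_A .h

theorem iota_mem_A : ∀ c : BananaCell n, toSer (iota c) ∈ A deg Set.univ (deg c)
  | .a => gen_mem_A .b
  | .b => gen_mem_A .a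
  | .e i => neg_gen_mem_A (.e i)
  | .f i => neg_gen_mem_A (.f i)
  | .h => neg_gen_mem_A .h

section
variable {s : BananaCell n → NC (BananaCell n)}
  (hs : ∀ c, toSer (s c) ∈ A deg Set.univ (deg c))
include hs

theorem isHom_symmetry : IsHom (substL fun c => toSer (s c)) :=
  isHom_subst fun c => A_mem_Fil (hs c)

theorem symmetry_letter (c : BananaCell n) : substL (fun c => toSer (s c)) (letter c) = toSer (s c) :=
  subst_letter (fun c => A_mem_Fil (hs c)) c

theorem symmetry_letter_mem (c : BananaCell n) :
    substL (fun c => toSer (s c)) (letter c) ∈ Hom deg (deg c) := by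
  rw [symmetry_letter hs]
  exact (hs c).1

end

omit [NeZero n] in
theorem toSer_cyclicCondition (h : CyclicCondition P) (i : ZMod n) :
    toSer (P (i + 1)) = subst (toSer (P i)) fun j => toSer (cyclicShift n j) := by
  rw [h i]
  refine toSer_subst _ fun j => ?_
  rw [cyclicShift]
  split_ifs
  · exact letter_mem _
  · rw [map_neg, toSer_bchList]
    refine Submodule.neg_mem _ (bchList_mem fun f hf => ?_)
    rw [List.map_ofFn] at hf
    obtain ⟨j, rfl⟩ := (List.mem_ofFn' _ _).mp hf
    exact letter_mem j

omit [NeZero n] in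
theorem toSer_reversalCondition (h : ReversalCondition P) (i : ZMod n) :
    toSer (P (-i)) = subst (toSer (P i)) fun j => -letter (Fin.rev j) := by
  rw [h i]
  exact toSer_subst (y := fun j => -NC.var (Fin.rev j)) _ fun j =>
    (Fil _ 1).neg_mem (letter_mem _)

theorem toSer_average_symm (hμ : IsUniversalAverage μ) (π : Equiv.Perm (ZMod n)) :
    subst (toSer μ) (fun i => letter (π i)) = toSer μ := by
  conv_rhs => rw [← hμ.symm π]
  exact (toSer_subst (y := fun i => NC.var (π i)) _ fun i => letter_mem _).symm

theorem toSer_average_odd (hodd : IsOddAverage μ) :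
    subst (toSer μ) (fun i => -letter i) = -toSer μ := by
  rw [← map_neg, ← show _ = -μ from hodd]
  exact (toSer_subst (y := fun i => -NC.var i) _ fun i => (Fil _ 1).neg_mem (letter_mem _)).symm

omit [NeZero n] in
theorem toSer_revLoops (j : Fin (n - 1)) : toSer (revLoops j)
    = bch (-le ((j + 1 : ℕ) : ZMod n)) (le ((j + 2 : ℕ) : ZMod n)) := by
  rw [revLoops, toSer_bch, map_neg]
  rfl

theorem toSer_actRevLoops (p : NC (Fin (n - 1))) (z : NC (BananaCell n)) :
    toSer (actRevLoops p z) = opW (toSer p) (fun j => ad (bch (-le ((j + 1 : ℕ) : ZMod n))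
      (le ((j + 2 : ℕ) : ZMod n)))) (toSer z) := by
  have h : ∀ j, toSer (revLoops (n := n) j) ∈ A deg Set.univ 0 := fun j => by
    rw [toSer_revLoops]
    exact bch_mem_A (Submodule.neg_mem _ (le_mem_A trivial)) (le_mem_A trivial)
  rw [actRevLoops, toSer_act p (fun j => A_mem_Fil (h j)) fun j => (h j).1]
  simp only [toSer_revLoops]

theorem toSer_swapCondition (hμ : toSer μ ∈ A (fun _ => 0) Set.univ 0) (h : SwapCondition P μ)
    (i : ZMod n) : exp (halfMain (toSer μ)) * opW (toSer (P i)) (fun j => ad (bch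
        (-le ((j + 1 : ℕ) : ZMod n)) (le ((j + 2 : ℕ) : ZMod n))))
        (exp (-halfFace i) * letter (.f i) * exp (halfFace i)) * exp (-halfMain (toSer μ))
      = exp (-halfMain (toSer μ)) * opW (toSer (P i)) (fun j => ad (loopsFrom 0 j)) (face' i)
        * exp (halfMain (toSer μ)) := by
  -- The operator identity is only needed on the generator `f i`.
  have h' := congrArg toSer (h i _ (gen (.f i)) (mem_lieSeries.mpr (gen_mem_A (.f i))))
  rwa [toSer_expAd_halfMain hμ, toSer_expAd_neg_halfMain hμ, toSer_actRevLoops, toSer_actLoops,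
    toSer_expAd_neg_halfFace, toSer_expAd_halfFace] at h'

/-- A universal average respects flows only in a DGLA, so `∂² = 0`, and with it the boundary
condition, must be known before `v` can be seen to flow from `a` to `b`. -/
theorem flow_average (hμ : IsUniversalAverage μ) (hP : ∀ i, P i [] = 1)
    (hbdry : BoundaryCondition P) (h : IsSymmetricDifferential P μ D) :
    flow (extend deg D) (subst (toSer μ) le) (letter .a) = letter .b := by
  have hμA := mem_lieSeries.mp hμ.lie
  have hM := isModel hP hbdry hμA h
  have hδ := serModel_extend hμA h
  have hv : toSer (NC.subst μ fun i => gen (.e i)) = subst (toSer μ) (le (n := n)) :=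
    toSer_subst (y := fun i => gen (.e i)) μ fun i => letter_mem _
  have hvA : toSer (NC.subst μ fun i => gen (.e i)) ∈ A deg (Set.univ : Set (BananaCell n)) 0 := by
    rw [hv]
    exact subst_mem_A (fun i => le_mem_A (Set.mem_univ _)) hμA
  have := hμ.flow _ deg D hM.dgla h.filtration (gen .a) (mem_lieSeries.mpr (gen_mem_A .a)) (gen .b)
    (mem_lieSeries.mpr (gen_mem_A .b)) (fun i => gen (.e i))
    (fun i => mem_lieSeries.mpr (gen_mem_A (.e i))) (hM.vertex .a rfl) (hM.vertex .b rfl) fun i =>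
      toSer_injective ((toSer_flow_extend h.derivation h.filtration (gen_mem_A (.e i)) _).trans
        (hδ.flow_le i))
  have h' := congrArg toSer this
  rw [toSer_flow_extend h.derivation h.filtration hvA, hv] at h'
  exact h'

theorem invariantUnder_tau (hμ : IsUniversalAverage μ) (hcyc : CyclicCondition P)
    (h : IsSymmetricDifferential P μ D) : InvariantUnder D tau := by
  have hs := symmetry_letter (tau_mem_A (n := n))
  refine invariantUnder h tau_mem_A ?_
  exact (serModel_extend (mem_lieSeries.mp hμ.lie) h).comm_rotation (isHom_symmetry tau_mem_A)
    (symmetry_letter_mem tau_mem_A) (mem_lieSeries.mp hμ.lie) (toSer_average_symm hμ)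
    (toSer_cyclicCondition hcyc) (hs .a) (hs .b) (fun i => hs (.e i)) (fun i => hs (.f i)) (hs .h)

theorem invariantUnder_sigma (hμ : IsUniversalAverage μ) (hcyc : CyclicCondition P)
    (hrev : ReversalCondition P) (h : IsSymmetricDifferential P μ D) : InvariantUnder D sigma := by
  have hs := symmetry_letter (sigma_mem_A (n := n))
  refine invariantUnder h sigma_mem_A ?_
  exact (serModel_extend (mem_lieSeries.mp hμ.lie) h).comm_reflection (isHom_symmetry sigma_mem_A)
    (symmetry_letter_mem sigma_mem_A) (mem_lieSeries.mp hμ.lie) (toSer_average_symm hμ)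
    (toSer_cyclicCondition hcyc) (toSer_reversalCondition hrev) (hs .a) (hs .b)
    (fun i => hs (.e i)) (fun i => hs (.f i)) (hs .h)

theorem invariantUnder_iota (hμ : IsUniversalAverage μ) (hP : ∀ i, P i [] = 1)
    (hbdry : BoundaryCondition P) (hodd : IsOddAverage μ) (hswap : SwapCondition P μ)
    (h : IsSymmetricDifferential P μ D) : InvariantUnder D iota := by
  have hs := symmetry_letter (iota_mem_A (n := n))
  refine invariantUnder h iota_mem_A ?_
  exact (serModel_extend (mem_lieSeries.mp hμ.lie) h).comm_exchange (isHom_symmetry iota_mem_A)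
    (symmetry_letter_mem iota_mem_A) (mem_lieSeries.mp hμ.lie) (flow_average hμ hP hbdry h)
    (toSer_average_odd hodd) (toSer_swapCondition (mem_lieSeries.mp hμ.lie) hswap) (hs .a) (hs .b)
    (fun i => hs (.e i)) (fun i => hs (.f i)) (hs .h)

end

end Ser

end

/-! ### The theorem. -/

theorem lemma3p2 (n : ℕ) [NeZero n] (hn : 2 ≤ n)
    (P : ZMod n → NC (Fin (n - 1)))
    (hP : ∀ i, P i [] = 1)
    (hbdry : BoundaryCondition P) (hcyc : CyclicCondition P) (hrev : ReversalCondition P) :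
    -- universal averages exist: the explicit barycentre is one, and it is odd
    (IsUniversalAverage (barycentre (ZMod n)) ∧ IsOddAverage (barycentre (ZMod n))) ∧
    ∀ μ : NC (ZMod n), IsUniversalAverage μ →
      -- the formulae define a differential, which is unique
      (∃ D, IsSymmetricDifferential P μ D) ∧
      (∀ D D', IsSymmetricDifferential P μ D → IsSymmetricDifferential P μ D' →
        ∀ k : ℤ, ∀ z ∈ lieSeries (deg (n := n)) k, D z = D' z) ∧
      ∀ D, IsSymmetricDifferential P μ D →
        -- it is a model of the banana
        IsModel (cells n) D ∧
        -- it is obtained by twisting the model localised at `a`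
        (∀ i : ZMod n, D (fTwist i) + br (gen .a) (fTwist i)
          = bch (gen (.e i)) (-gen (.e (i + 1)))) ∧
        D (hTwist μ) + br (gen .a) (hTwist μ) = ∑ i : ZMod n, actLoops (P i) (fTwist i) ∧
        -- it is invariant under the symmetries fixing the vertices
        InvariantUnder D sigma ∧ InvariantUnder D tau ∧
        -- and under the remaining symmetry if the last condition holds
        (IsOddAverage μ → SwapCondition P μ → InvariantUnder D iota) := by
  refine ⟨⟨Ser.isUniversalAverage_barycentre, Ser.isOddAverage_barycentre⟩, fun μ hμ => ?_⟩
  have hμA := Ser.mem_lieSeries.mp hμ.lie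
  refine ⟨Ser.exists_isSymmetricDifferential P hμA, fun D D' h h' k z hz => Ser.toSer_injective ?_,
    fun D h => ⟨Ser.isModel hP hbdry hμA h, Ser.twisted_face hμA h, Ser.twisted_solid hμA h,
      Ser.invariantUnder_sigma hμ hcyc hrev h, Ser.invariantUnder_tau hμ hcyc h,
      fun hodd hswap => Ser.invariantUnder_iota hμ hP hbdry hodd hswap h⟩⟩
  -- Differentials are maps of the ambient space, of which only the values on Lie series are
  -- determined; there each equals its extension, and the two extensions coincide.
  have hz' := Ser.mem_lieSeries.mp hz
  rw [(Ser.extend_spec h.derivation h.filtration).2 k z hz',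
    (Ser.extend_spec h'.derivation h'.filtration).2 k z hz',
    (Ser.serModel_extend hμA h).unique hμA (Ser.serModel_extend hμA h')]
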